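/- Let $n\ge 3$ and $0<\sigma<1$. Work in the half-space model $\mathbb H^{n+1}=\{(x,x_{n+1})\in\mathbb R^{n+1}:x_{n+1}>0\}$ with metric $x_{n+1}^{-2}\sum_{a} dx_a^2$. For $\kappa\in\mathbb R^n$ let $S_k(\kappa)$ be the $k$-th elementary symmetric function, $H_k=\binom nk^{-1}S_k$, $H=H_1$, and $K_2=\{\kappa: S_1(\kappa)>0,\ S_2(\kappa)>0\}$. There is a constant $C>0$, depending only on $n$ and $\sigma$, with the following property. Let $\Omega\subset\mathbb R^n$ be a bounded domain (nonempty, open, connected) whose boundary $\Gamma=\partial\Omega$ is a smooth embedded hypersurface that is mean-convex, i.e. whose Euclidean mean curvature (positive for round spheres bounding balls) is $\ge 0$. Let $\varepsilon\ge 0$ and let $u\in C^\infty(\Omega)\cap C^2(\overline\Omega)$ satisfy $u>0$ in $\Omega$ and $u=\varepsilon$ on $\partial\Omega$, and let $\Sigma$ be the graph $\{(x,u(x))\}$. Thus if $\varepsilon=0$, $\Sigma$ is a complete hypersurface of $\mathbb H^{n+1}$ with asymptotic boundary $\partial\Sigma=\Gamma$ at infinity, and if $\varepsilon>0$, $\Sigma$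 is compact with boundary $\partial\Sigma=\Gamma\times\{\varepsilon\}$. Let $\kappa[\Sigma]$ be the hyperbolic principal curvatures of $\Sigma$ with respect to the upward unit normal, and suppose that over $\Omega$ \[ H_2^{1/2}(\kappa[\Sigma])=\sigma,\qquad \kappa[\Sigma]\in K_2 . \] Then, with $H$ on $\partial\Sigma$ understood as the continuous extension of $H$ from the interior of $\Sigma$, both maxima below (over $\Sigma$ together with $\partial\Sigma$, and over $\partial\Sigma$) are attained, and \[ \max_{\Sigma}|H(\kappa)|\le C\Bigl(1+\max_{\partial\Sigma}|H(\kappa)|\Bigr). \] -/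

import Mathlib

open Set Filter Topology
open scoped ContDiff

noncomputable section

namespace HypGraph

/-- The partial derivative `∂f/∂x_i` at `x`. -/
def pderiv {n : ℕ} (i : Fin n) (f : EuclideanSpace ℝ (Fin n) → ℝ)
    (x : EuclideanSpace ℝ (Fin n)) : ℝ :=
  fderiv ℝ f x (EuclideanSpace.single i 1)

/-! ### The half-space model of hyperbolic space

Points and tangent vectors are written in the coordinates `x_1, …, x_{n+1}`; the height `x_{n+1}` is
the coordinate with index `Fin.last n`, and the model is the set where it is positive. -/

/-- The hyperbolic inner product of two vectors at `p`, `(∑ₐ vₐ wₐ) / x_{n+1}²`. -/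
def hypInner {n : ℕ} (p v w : Fin (n + 1) → ℝ) : ℝ :=
  (∑ a, v a * w a) / p (Fin.last n) ^ 2

/-- The Christoffel symbol `Γ_{ab}^c` of the hyperbolic metric `(∑ dx_a²) / x_{n+1}²` at `p`. -/
def christoffel {n : ℕ} (p : Fin (n + 1) → ℝ) (a b c : Fin (n + 1)) : ℝ :=
  (1 / p (Fin.last n)) *
    (-(if b = c ∧ a = Fin.last n then 1 else 0) - (if a = c ∧ b = Fin.last n then 1 else 0)
      + (if a = b ∧ c = Fin.last n then 1 else 0))

/-! ### Parametrized hypersurfaces -/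

/-- The coordinate tangent vector `X_i = ∂X/∂x_i`. -/
def tangentVec {n : ℕ} (X : EuclideanSpace ℝ (Fin n) → Fin (n + 1) → ℝ) (i : Fin n)
    (x : EuclideanSpace ℝ (Fin n)) : Fin (n + 1) → ℝ :=
  fun c => pderiv i (fun z => X z c) x

/-- The covariant derivative `∇_{X_i} X_j` for the hyperbolic Levi-Civita connection. -/
def covDeriv {n : ℕ} (X : EuclideanSpace ℝ (Fin n) → Fin (n + 1) → ℝ) (i j : Fin n)
    (x : EuclideanSpace ℝ (Fin n)) : Fin (n + 1) → ℝ :=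
  fun c => pderiv i (fun z => tangentVec X j z c) x +
    ∑ a, ∑ b, christoffel (X x) a b c * tangentVec X i x a * tangentVec X j x b

/-- The first fundamental form `g_{ij} = ⟨X_i, X_j⟩`. -/
def firstForm {n : ℕ} (X : EuclideanSpace ℝ (Fin n) → Fin (n + 1) → ℝ)
    (x : EuclideanSpace ℝ (Fin n)) : Matrix (Fin n) (Fin n) ℝ :=
  Matrix.of fun i j => hypInner (X x) (tangentVec X i x) (tangentVec X j x)

/-- The second fundamental form `h_{ij} = ⟨∇_{X_i} X_j, N⟩` with respect to the normal field `N`. -/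
def secondForm {n : ℕ} (X N : EuclideanSpace ℝ (Fin n) → Fin (n + 1) → ℝ)
    (x : EuclideanSpace ℝ (Fin n)) : Matrix (Fin n) (Fin n) ℝ :=
  Matrix.of fun i j => hypInner (X x) (covDeriv X i j x) (N x)

/-! ### Vertical graphs -/

/-- The graph parametrization `x ↦ (x, u x)`. -/
def graphMap {n : ℕ} (u : EuclideanSpace ℝ (Fin n) → ℝ)
    (x : EuclideanSpace ℝ (Fin n)) : Fin (n + 1) → ℝ :=
  Fin.snoc (α := fun _ => ℝ) (fun i => x i) (u x)

/-- `w = √(1 + |Du|²)`. -/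
def slopeFactor {n : ℕ} (u : EuclideanSpace ℝ (Fin n) → ℝ) (x : EuclideanSpace ℝ (Fin n)) : ℝ :=
  Real.sqrt (1 + ∑ i, pderiv i u x ^ 2)

/-- The upward hyperbolic unit normal `u · (-Du / w, 1 / w)` of the graph of `u`. -/
def upNormal {n : ℕ} (u : EuclideanSpace ℝ (Fin n) → ℝ)
    (x : EuclideanSpace ℝ (Fin n)) : Fin (n + 1) → ℝ :=
  fun a => u x *
    Fin.snoc (α := fun _ => ℝ) (fun i => -pderiv i u x / slopeFactor u x) (1 / slopeFactor u x) a

/-- The hyperbolic principal curvatures of the graph of `u` at `(x, u x)`, with respect to the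
upward normal: the eigenvalues, with multiplicity, of the shape operator `g⁻¹ h`. -/
def principalCurvatures {n : ℕ} (u : EuclideanSpace ℝ (Fin n) → ℝ)
    (x : EuclideanSpace ℝ (Fin n)) : Multiset ℝ :=
  ((firstForm (graphMap u) x)⁻¹ * secondForm (graphMap u) (upNormal u) x).charpoly.roots

/-! ### Symmetric functions of the principal curvatures -/

/-- The normalized elementary symmetric function `H_k(κ) = S_k(κ) / (n choose k)`. -/
def normSymm (n k : ℕ) (κ : Multiset ℝ) : ℝ :=
  κ.esymm k / (n.choose k : ℝ)

/-- The `k`-th Gårding cone `K_k`: all of `S_1, …, S_k` are positive. -/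
def InGardingCone (k : ℕ) (κ : Multiset ℝ) : Prop :=
  ∀ j : ℕ, 1 ≤ j → j ≤ k → 0 < κ.esymm j

/-- The hyperbolic mean curvature `H = H_1(κ)` of the graph of `u` at `(x, u x)`. -/
def meanCurvature {n : ℕ} (u : EuclideanSpace ℝ (Fin n) → ℝ)
    (x : EuclideanSpace ℝ (Fin n)) : ℝ :=
  normSymm n 1 (principalCurvatures u x)

/-- The mean curvature of the graph of `u` over `Ω`, extended by continuity to points over `∂Ω`
(which may lie at infinity, that is, at height `0`). -/
def meanCurvatureExt {n : ℕ} (Ω : Set (EuclideanSpace ℝ (Fin n)))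
    (u : EuclideanSpace ℝ (Fin n) → ℝ) : EuclideanSpace ℝ (Fin n) → ℝ :=
  extendFrom Ω (meanCurvature u)

/-! ### Smooth mean-convex domains of `ℝⁿ` -/

/-- `ρ` is a smooth defining function of `Ω` near the boundary point `y`. -/
def IsDefiningFunctionAt {n : ℕ} (Ω : Set (EuclideanSpace ℝ (Fin n)))
    (ρ : EuclideanSpace ℝ (Fin n) → ℝ) (y : EuclideanSpace ℝ (Fin n)) : Prop :=
  ContDiff ℝ ∞ ρ ∧ fderiv ℝ ρ y ≠ 0 ∧ ∀ᶠ z in 𝓝 y, (z ∈ Ω ↔ ρ z < 0)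

/-- A bounded domain whose boundary is a smooth embedded closed hypersurface of `ℝⁿ`. -/
structure IsSmoothBoundedDomain {n : ℕ} (Ω : Set (EuclideanSpace ℝ (Fin n))) : Prop where
  isOpen : IsOpen Ω
  isConnected : IsConnected Ω
  isBounded : Bornology.IsBounded Ω
  smooth_boundary : ∀ y ∈ frontier Ω, ∃ ρ, IsDefiningFunctionAt Ω ρ y

/-- `div (Dρ / |Dρ|)` at `y`: for a defining function `ρ` of `Ω`, the Euclidean mean curvature (sum
of the principal curvatures) of `∂Ω` at `y`, with the sign for which spheres bounding balls have
positive mean curvature. -/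
def levelMeanCurvature {n : ℕ} (ρ : EuclideanSpace ℝ (Fin n) → ℝ)
    (y : EuclideanSpace ℝ (Fin n)) : ℝ :=
  ∑ i, pderiv i (fun z => pderiv i ρ z / Real.sqrt (∑ j, pderiv j ρ z ^ 2)) y

/-- `∂Ω` is mean-convex: its Euclidean mean curvature is nonnegative. -/
def IsMeanConvex {n : ℕ} (Ω : Set (EuclideanSpace ℝ (Fin n))) : Prop :=
  ∀ y ∈ frontier Ω, ∀ ρ, IsDefiningFunctionAt Ω ρ y → 0 ≤ levelMeanCurvature ρ y

end HypGraph

end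

/-!
The graph of `u` is studied through its angle function `ν = 1 / √(1 + |Du|²)` (`angle`) and its
shape operator `A = ν (1 - ν² Du Duᵀ) (1 + Du Duᵀ + u D²u)` (`shapeMat`). The formula for `A`
makes sense at height `0`, so that `H = tr A / n` is continuous up to the boundary and both maxima
exist (`IsSolution.meanCurvatureExt_eq`). The hypotheses on the curvatures say that `tr A > 0` and
`(tr A)² - tr A² = n (n - 1) σ²`. The estimate rests on two applications of the maximum principle.

The first is the gradient bound `ν ≥ σ` (`IsSolution.le_angle`), the only place where the
mean-convexity of the boundary is used. The functions `(σ + δ - ν) / u` with `δ > 0` have no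
interior local maximum (`AdaptedFrame.no_interior_max`). If `ν < σ` somewhere, such a function is
therefore maximal on `{u ≥ τ}` at a point of the level set `{u = τ}`, and the derivative in the
direction of `Du` together with the curvature equation bounds the mean curvature of this level set
away from zero, with the sign opposite to that of a mean-convex boundary
(`IsSolution.exists_gap_point`). As `τ` tends to the boundary height `ε`, these points accumulate
at a boundary point, where `{u = ε}` is the boundary itself and mean-convexity is contradicted
(`hessian_trace_sub_le_of_mean_convex`).

The second concerns `(tr A) ^ (n - 1) / ν ^ n`. At an interior maximum, the identity of Simons
(`AdaptedFrame.sum_trace_second`) and the equation for `ν` (`AdaptedFrame.sum_angle_second`) are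
inserted in the second derivative test, weighted with the linearized operator. The gradient terms
have no sign by themselves, but the derivatives of the second fundamental form in the identity of
Simons contribute enough to absorb them, one eigendirection at a time
(`AdaptedFrame.sum_sq_sub_sum_trace_sq`, `single_direction_bound`). Hence `tr A` is bounded by a
constant of `n` and `σ` there (`AdaptedFrame.trace_le_of_isLocalMax`). So the maximum is either
small or lies on the boundary, and as `σ ≤ ν ≤ 1` this bounds `tr A` everywhere
(`IsSolution.trace_le`).

All computations at a point are done with ordinary derivatives in `ℝⁿ` along constant vector
fields that diagonalize the second fundamental form at that point (`AdaptedFrame`), instead of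
covariant derivatives on the hypersurface.
-/

open scoped Matrix

namespace HypGraph

/-! ### Derivatives along constant vector fields -/

/-- The derivative of `f` in the direction of the constant vector field `v`. -/
noncomputable def dd {n : ℕ} (v : EuclideanSpace ℝ (Fin n)) (f : EuclideanSpace ℝ (Fin n) → ℝ)
    (x : EuclideanSpace ℝ (Fin n)) : ℝ :=
  fderiv ℝ f x v

section DirectionalDerivative

variable {n : ℕ} {v w x : EuclideanSpace ℝ (Fin n)} {f g : EuclideanSpace ℝ (Fin n) → ℝ}

theorem contDiffAt_dd {m k : WithTop ℕ∞} (hf : ContDiffAt ℝ k f x) (h : m + 1 ≤ k) :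
    ContDiffAt ℝ m (dd v f) x :=
  (hf.fderiv_right h).clm_apply contDiffAt_const

theorem contDiffAt_dd_infty (hf : ContDiffAt ℝ ∞ f x) : ContDiffAt ℝ ∞ (dd v f) x :=
  contDiffAt_dd hf (by simp)

theorem dd_congr (h : f =ᶠ[𝓝 x] g) : dd v f x = dd v g x := by
  unfold dd; rw [h.fderiv_eq]

theorem dd_eventuallyEq (h : f =ᶠ[𝓝 x] g) : dd v f =ᶠ[𝓝 x] dd v g := by
  filter_upwards [h.eventuallyEq_nhds] with y hy using dd_congr hy

theorem dd_const (c : ℝ) : dd v (fun _ => c) = fun _ => 0 := by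
  ext y; simp [dd]

theorem dd_add (hf : DifferentiableAt ℝ f x) (hg : DifferentiableAt ℝ g x) :
    dd v (fun y => f y + g y) x = dd v f x + dd v g x := by
  unfold dd; rw [fderiv_fun_add hf hg]; rfl

theorem dd_mul (hf : DifferentiableAt ℝ f x) (hg : DifferentiableAt ℝ g x) :
    dd v (fun y => f y * g y) x = dd v f x * g x + f x * dd v g x := by
  unfold dd; rw [fderiv_fun_mul hf hg]; simp; ring

theorem dd_sum {ι : Type*} {s : Finset ι} {F : ι → EuclideanSpace ℝ (Fin n) → ℝ}
    (hF : ∀ i ∈ s, DifferentiableAt ℝ (F i) x) :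
    dd v (fun y => ∑ i ∈ s, F i y) x = ∑ i ∈ s, dd v (F i) x := by
  unfold dd; rw [fderiv_fun_sum hF]; simp

theorem _root_.ContDiffAt.differentiableAt_infty (hf : ContDiffAt ℝ ∞ f x) :
    DifferentiableAt ℝ f x :=
  hf.differentiableAt (by simp)

theorem eventually_contDiffAt_infty (hf : ContDiffAt ℝ ∞ f x) :
    ∀ᶠ y in 𝓝 x, DifferentiableAt ℝ f y := by
  have h2 : ContDiffAt ℝ 1 f x := hf.of_le (by norm_cast)
  filter_upwards [h2.eventually (by simp)] with y hy using hy.differentiableAt (by simp)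

theorem dd_dd_add (hf : ContDiffAt ℝ ∞ f x) (hg : ContDiffAt ℝ ∞ g x) :
    dd w (dd v (fun y => f y + g y)) x = dd w (dd v f) x + dd w (dd v g) x := by
  have h : dd v (fun y => f y + g y) =ᶠ[𝓝 x] fun y => dd v f y + dd v g y := by
    filter_upwards [eventually_contDiffAt_infty hf, eventually_contDiffAt_infty hg] with y h1 h2
      using dd_add h1 h2
  rw [dd_congr h, dd_add]
  · exact ContDiffAt.differentiableAt_infty (contDiffAt_dd_infty hf)
  · exact ContDiffAt.differentiableAt_infty (contDiffAt_dd_infty hg)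

theorem dd_dd_mul (hf : ContDiffAt ℝ ∞ f x) (hg : ContDiffAt ℝ ∞ g x) :
    dd v (dd v (fun y => f y * g y)) x =
      dd v (dd v f) x * g x + 2 * (dd v f x * dd v g x) + f x * dd v (dd v g) x := by
  have h : dd v (fun y => f y * g y) =ᶠ[𝓝 x] fun y => dd v f y * g y + f y * dd v g y := by
    filter_upwards [eventually_contDiffAt_infty hf, eventually_contDiffAt_infty hg] with y h1 h2
      using dd_mul h1 h2
  have hf' := ContDiffAt.differentiableAt_infty hf
  have hg' := ContDiffAt.differentiableAt_infty hg
  have hf'' := ContDiffAt.differentiableAt_infty (contDiffAt_dd_infty (v := v) hf)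
  have hg'' := ContDiffAt.differentiableAt_infty (contDiffAt_dd_infty (v := v) hg)
  rw [dd_congr h, dd_add (hf''.fun_mul hg') (hf'.fun_mul hg''), dd_mul hf'' hg', dd_mul hf' hg'']
  ring

theorem dd_dd_sum {ι : Type*} {s : Finset ι} {F : ι → EuclideanSpace ℝ (Fin n) → ℝ}
    (hF : ∀ i ∈ s, ContDiffAt ℝ ∞ (F i) x) :
    dd w (dd v (fun y => ∑ i ∈ s, F i y)) x = ∑ i ∈ s, dd w (dd v (F i)) x := by
  have h : dd v (fun y => ∑ i ∈ s, F i y) =ᶠ[𝓝 x] fun y => ∑ i ∈ s, dd v (F i) y := by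
    have := (Filter.eventually_all_finset s).2 fun i hi => eventually_contDiffAt_infty (hF i hi)
    filter_upwards [this] with y hy using dd_sum hy
  rw [dd_congr h, dd_sum]
  exact fun i hi => ContDiffAt.differentiableAt_infty (contDiffAt_dd_infty (hF i hi))

theorem dd_dd_apply (hf : ContDiffAt ℝ 2 f x) :
    dd w (dd v f) x = fderiv ℝ (fderiv ℝ f) x w v := by
  have h1 : DifferentiableAt ℝ (fderiv ℝ f) x :=
    (hf.fderiv_right (m := 1) (by norm_num)).differentiableAt (by simp)
  unfold dd
  rw [fderiv_clm_apply h1 (differentiableAt_const _)]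
  simp

theorem dd_comm (hf : ContDiffAt ℝ 2 f x) : dd w (dd v f) x = dd v (dd w f) x := by
  rw [dd_dd_apply hf, dd_dd_apply hf]
  exact (hf.isSymmSndFDerivAt (by simp)).eq w v

theorem dd_comm_eventuallyEq (hf : ContDiffAt ℝ ∞ f x) :
    dd w (dd v f) =ᶠ[𝓝 x] dd v (dd w f) := by
  have h2 : ContDiffAt ℝ 2 f x := hf.of_le (by norm_cast)
  filter_upwards [h2.eventually (by simp)] with y hy using dd_comm hy

theorem dd_eq_zero_of_isLocalMax (hf : IsLocalMax f x) : dd v f x = 0 := by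
  unfold dd; rw [hf.fderiv_eq_zero]; rfl

theorem dd_log (hf : DifferentiableAt ℝ f x) (h0 : f x ≠ 0) :
    dd v (fun y => Real.log (f y)) x = dd v f x / f x := by
  unfold dd; rw [fderiv.log hf h0]; simp; ring

theorem dd_dd_log (hf : ContDiffAt ℝ ∞ f x) (h0 : f x ≠ 0) :
    dd v (dd v (fun y => Real.log (f y))) x =
      dd v (dd v f) x / f x - (dd v f x / f x) ^ 2 := by
  -- Differentiating `(log f)' f = f'` avoids a quotient rule.
  have h : (fun y => dd v (fun y => Real.log (f y)) y * f y) =ᶠ[𝓝 x] dd v f := by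
    filter_upwards [eventually_contDiffAt_infty hf, hf.continuousAt.eventually_ne h0] with y h1 h2
    rw [dd_log h1 h2, div_mul_cancel₀ _ h2]
  have hl : ContDiffAt ℝ ∞ (dd v (fun y => Real.log (f y))) x := contDiffAt_dd_infty (hf.log h0)
  have h3 := dd_congr (v := v) h
  rw [dd_mul hl.differentiableAt_infty hf.differentiableAt_infty,
    dd_log hf.differentiableAt_infty h0] at h3
  field_simp at h3 ⊢
  linarith

theorem deriv_lineMap {t : ℝ} (hf : DifferentiableAt ℝ f (x + t • v)) :
    deriv (fun s : ℝ => f (x + s • v)) t = dd v f (x + t • v) := by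
  have h1 : HasDerivAt (fun s : ℝ => x + s • v) v t := by
    simpa using ((hasDerivAt_id t).smul_const v).const_add x
  exact (hf.hasFDerivAt.comp_hasDerivAt t h1).deriv

/-- The second derivative test: a pure second derivative is nonpositive at a local maximum. -/
theorem dd_dd_nonpos_of_isLocalMax (hf : ContDiffAt ℝ 2 f x) (hm : IsLocalMax f x) :
    dd v (dd v f) x ≤ 0 := by
  by_contra! hpos
  have hc : Tendsto (fun s : ℝ => x + s • v) (𝓝 0) (𝓝 x) := by
    have : Continuous fun s : ℝ => x + s • v := by fun_prop
    simpa using this.tendsto 0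
  have hd : ∀ᶠ y in 𝓝 x, DifferentiableAt ℝ f y := by
    filter_upwards [hf.eventually (by simp)] with y hy using hy.differentiableAt (by simp)
  have h1 : deriv (fun s : ℝ => f (x + s • v)) =ᶠ[𝓝 0] fun t => dd v f (x + t • v) := by
    filter_upwards [hc.eventually hd] with t ht using deriv_lineMap ht
  have h2 : deriv (deriv (fun s : ℝ => f (x + s • v))) 0 = dd v (dd v f) x := by
    have hd2 : DifferentiableAt ℝ (dd v f) x :=
      (contDiffAt_dd (m := 1) hf (by norm_num)).differentiableAt (by simp)
    rw [h1.deriv_eq, deriv_lineMap (by simpa using hd2)]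
    simp
  have h3 : deriv (fun s : ℝ => f (x + s • v)) 0 = 0 := by
    rw [h1.eq_of_nhds]; simpa using dd_eq_zero_of_isLocalMax hm
  have hcont : ContinuousAt (fun s : ℝ => f (x + s • v)) 0 := by
    have : ContinuousAt f (x + (0:ℝ) • v) := by simpa using hf.continuousAt
    exact ContinuousAt.comp (f := fun s : ℝ => x + s • v) this (by fun_prop)
  have hmin : IsLocalMin (fun s : ℝ => f (x + s • v)) 0 :=
    isLocalMin_of_deriv_deriv_pos (by rw [h2]; exact hpos) h3 hcont
  -- A strict second-order minimum along the line would be a maximum too, so `f` would be constant.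
  have hmax : ∀ᶠ s in 𝓝 (0:ℝ), f (x + s • v) ≤ f x := hc.eventually hm
  have heq : (fun s : ℝ => f (x + s • v)) =ᶠ[𝓝 0] fun _ => f x := by
    filter_upwards [hmax, hmin] with s h4 h5
    simp only [zero_smul, add_zero] at h5
    exact le_antisymm h4 h5
  have h6 : deriv (fun s : ℝ => f (x + s • v)) =ᶠ[𝓝 0] fun _ => 0 := by
    filter_upwards [heq.eventuallyEq_nhds] with s hs
    rw [hs.deriv_eq]; simp
  rw [h6.deriv_eq] at h2
  simp at h2
  linarith

end DirectionalDerivative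

/-! ### Second-order jets in one direction -/

/-- `f` is smooth at `x`, and `a`, `b`, `c` are its value and its first and second derivatives at
`x` in the direction `v`. -/
structure HasJet {n : ℕ} (v x : EuclideanSpace ℝ (Fin n)) (f : EuclideanSpace ℝ (Fin n) → ℝ)
    (a b c : ℝ) : Prop where
  smooth : ContDiffAt ℝ ∞ f x
  value : f x = a
  first : dd v f x = b
  second : dd v (dd v f) x = c

namespace HasJet

variable {n : ℕ} {v x : EuclideanSpace ℝ (Fin n)} {f g : EuclideanSpace ℝ (Fin n) → ℝ}
  {a b c a' b' c' : ℝ}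

theorem of_smooth (hf : ContDiffAt ℝ ∞ f x) :
    HasJet v x f (f x) (dd v f x) (dd v (dd v f) x) :=
  ⟨hf, rfl, rfl, rfl⟩

theorem const (r : ℝ) : HasJet v x (fun _ => r) r 0 0 :=
  ⟨contDiffAt_const, rfl, by simp [dd_const], by simp [dd_const]⟩

theorem add (hf : HasJet v x f a b c) (hg : HasJet v x g a' b' c') :
    HasJet v x (fun y => f y + g y) (a + a') (b + b') (c + c') :=
  ⟨hf.smooth.add hg.smooth, by rw [hf.value, hg.value],
    by rw [dd_add hf.smooth.differentiableAt_infty hg.smooth.differentiableAt_infty,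
      hf.first, hg.first],
    by rw [dd_dd_add hf.smooth hg.smooth, hf.second, hg.second]⟩

theorem mul (hf : HasJet v x f a b c) (hg : HasJet v x g a' b' c') :
    HasJet v x (fun y => f y * g y) (a * a') (b * a' + a * b')
      (c * a' + 2 * (b * b') + a * c') :=
  ⟨hf.smooth.mul hg.smooth, by rw [hf.value, hg.value],
    by rw [dd_mul hf.smooth.differentiableAt_infty hg.smooth.differentiableAt_infty,
      hf.first, hg.first, hf.value, hg.value],
    by rw [dd_dd_mul hf.smooth hg.smooth, hf.second, hg.second, hf.first, hg.first, hf.value,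
      hg.value]⟩

theorem sum {ι : Type*} {s : Finset ι} {F : ι → EuclideanSpace ℝ (Fin n) → ℝ} {A B C : ι → ℝ}
    (hF : ∀ i ∈ s, HasJet v x (F i) (A i) (B i) (C i)) :
    HasJet v x (fun y => ∑ i ∈ s, F i y) (∑ i ∈ s, A i) (∑ i ∈ s, B i) (∑ i ∈ s, C i) :=
  ⟨ContDiffAt.sum fun i hi => (hF i hi).smooth, Finset.sum_congr rfl fun i hi => (hF i hi).value,
    by rw [dd_sum fun i hi => (hF i hi).smooth.differentiableAt_infty]
       exact Finset.sum_congr rfl fun i hi => (hF i hi).first,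
    by rw [dd_dd_sum fun i hi => (hF i hi).smooth]
       exact Finset.sum_congr rfl fun i hi => (hF i hi).second⟩

theorem unique (hf : HasJet v x f a b c) (hg : HasJet v x g a' b' c') (h : f =ᶠ[𝓝 x] g) :
    a = a' ∧ b = b' ∧ c = c' :=
  ⟨by rw [← hf.value, ← hg.value, h.eq_of_nhds], by rw [← hf.first, ← hg.first, dd_congr h],
    by rw [← hf.second, ← hg.second, dd_congr (dd_eventuallyEq h)]⟩

end HasJet

/-! ### Adapted frames -/

/-- The data of a graph near a point `x`, written in a frame that is adapted to its second
fundamental form at `x`.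

* `φ = u / u(x)` is the height, normalized to be `1` at `x`, and `ν` is the angle function.
* The constant vector fields `w i` are `u(x)` times vectors whose lifts to the tangent space of the
  graph are Euclidean orthonormal at `x`. Their inner products, divided by `u(x)²`, are therefore
  `δ_ij - b_i b_j`, where `b i` is the derivative of `φ` along `w i` at `x`; the inverse of this
  matrix is `δ_ij + b_i b_j / ν(x)²`.
* `A` is the matrix of the shape operator in the frame, and its value at `x` is diagonal with the
  entries `ν(x) lam_i`, which are the principal curvatures.

The fields `angle_eq` and `shape_eq` are the equations `ν² (1 + |Du|²) = 1` and
`(1 + Du Duᵀ) A = ν (1 + Du Duᵀ + u D²u)` near `x`, in this frame. -/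
structure AdaptedFrame {n : ℕ} (x : EuclideanSpace ℝ (Fin n))
    (w : Fin n → EuclideanSpace ℝ (Fin n)) (φ ν : EuclideanSpace ℝ (Fin n) → ℝ)
    (A : Fin n → Fin n → EuclideanSpace ℝ (Fin n) → ℝ) (b lam : Fin n → ℝ) : Prop where
  smooth_height : ContDiffAt ℝ ∞ φ x
  smooth_angle : ContDiffAt ℝ ∞ ν x
  smooth_shape : ∀ i j, ContDiffAt ℝ ∞ (A i j) x
  height : φ x = 1
  grad : ∀ i, dd (w i) φ x = b i
  hess : ∀ i j, dd (w i) (dd (w j) φ) x = if i = j then lam j - 1 else 0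
  angle_pos : 0 < ν x
  angle_sq : ν x ^ 2 + ∑ i, b i ^ 2 = 1
  angle_eq : ∀ᶠ y in 𝓝 x, ν y * ν y * (1 + (∑ i, dd (w i) φ y * dd (w i) φ y +
    (1 / ν x ^ 2) * ((∑ i, b i * dd (w i) φ y) * (∑ i, b i * dd (w i) φ y)))) = 1
  shape_eq : ∀ i j, ∀ᶠ y in 𝓝 x,
    ∑ d, ((if i = d then 1 else 0) - b i * b d + dd (w i) φ y * dd (w d) φ y) * A d j y =
      ν y * (((if i = j then 1 else 0) - b i * b j + dd (w i) φ y * dd (w j) φ y) +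
        φ y * dd (w i) (dd (w j) φ) y)

namespace AdaptedFrame

variable {n : ℕ} {x : EuclideanSpace ℝ (Fin n)}
    {w : Fin n → EuclideanSpace ℝ (Fin n)} {φ ν : EuclideanSpace ℝ (Fin n) → ℝ}
    {A : Fin n → Fin n → EuclideanSpace ℝ (Fin n) → ℝ} {b lam : Fin n → ℝ}

/-- The third derivatives of the normalized height along the frame. -/
noncomputable def third (x : EuclideanSpace ℝ (Fin n))
    (w : Fin n → EuclideanSpace ℝ (Fin n)) (φ : EuclideanSpace ℝ (Fin n) → ℝ) (i j k : Fin n) : ℝ :=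
  dd (w i) (dd (w j) (dd (w k) φ)) x

theorem third_comm_left (h : AdaptedFrame x w φ ν A b lam) (i j k : Fin n) :
    third x w φ i j k = third x w φ j i k :=
  dd_comm ((contDiffAt_dd_infty h.smooth_height).of_le (by norm_cast))

theorem third_comm_right (h : AdaptedFrame x w φ ν A b lam) (i j k : Fin n) :
    third x w φ i j k = third x w φ i k j :=
  dd_congr (dd_comm_eventuallyEq h.smooth_height)

theorem fourth_comm (h : AdaptedFrame x w φ ν A b lam) (i j : Fin n) :
    dd (w i) (dd (w i) (dd (w j) (dd (w j) φ))) x =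
      dd (w j) (dd (w j) (dd (w i) (dd (w i) φ))) x := by
  have h1 := contDiffAt_dd_infty (v := w i) h.smooth_height
  have h2 := contDiffAt_dd_infty (v := w j) h.smooth_height
  calc _ = dd (w i) (dd (w j) (dd (w i) (dd (w j) φ))) x := dd_congr (dd_comm_eventuallyEq h2)
    _ = dd (w i) (dd (w j) (dd (w j) (dd (w i) φ))) x :=
        dd_congr (dd_eventuallyEq (dd_comm_eventuallyEq h.smooth_height))
    _ = dd (w j) (dd (w i) (dd (w j) (dd (w i) φ))) x :=
        dd_comm ((contDiffAt_dd_infty h1).of_le (by norm_cast))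
    _ = _ := dd_congr (dd_comm_eventuallyEq h1)

theorem jet_height (h : AdaptedFrame x w φ ν A b lam) (c : Fin n) :
    HasJet (w c) x φ 1 (b c) (lam c - 1) :=
  ⟨h.smooth_height, h.height, h.grad c, by rw [h.hess]; simp⟩

theorem jet_grad (h : AdaptedFrame x w φ ν A b lam) (c i : Fin n) :
    HasJet (w c) x (dd (w i) φ) (b i) (if c = i then lam i - 1 else 0) (third x w φ c c i) :=
  ⟨contDiffAt_dd_infty h.smooth_height, h.grad i, h.hess c i, rfl⟩

theorem jet_hess (h : AdaptedFrame x w φ ν A b lam) (c i j : Fin n) :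
    HasJet (w c) x (dd (w i) (dd (w j) φ)) (if i = j then lam j - 1 else 0) (third x w φ c i j)
      (dd (w c) (dd (w c) (dd (w i) (dd (w j) φ))) x) :=
  ⟨contDiffAt_dd_infty (contDiffAt_dd_infty h.smooth_height), h.hess i j, rfl, rfl⟩

theorem sum_sq (h : AdaptedFrame x w φ ν A b lam) : ∑ i, b i * b i = 1 - ν x ^ 2 := by
  have := h.angle_sq
  simp only [sq] at this ⊢
  linarith

/-- The first two derivatives of the angle function, from the identity `angle_eq`. -/
theorem jet_angle (h : AdaptedFrame x w φ ν A b lam) (c : Fin n) :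
    dd (w c) ν x = -ν x * b c * (lam c - 1) ∧
    dd (w c) (dd (w c) ν) x = ν x * (2 * b c ^ 2 * (lam c - 1) ^ 2 - ν x ^ 2 * (lam c - 1) ^ 2 -
      ∑ i, b i * third x w φ c c i) := by
  have hbU : HasJet (w c) x (fun y => ∑ i, b i * dd (w i) φ y) _ _ _ :=
    HasJet.sum fun i _ => (HasJet.const (b i)).mul (h.jet_grad c i)
  have hUU : HasJet (w c) x (fun y => ∑ i, dd (w i) φ y * dd (w i) φ y) _ _ _ :=
    HasJet.sum fun i _ => (h.jet_grad c i).mul (h.jet_grad c i)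
  have hν := HasJet.of_smooth (v := w c) h.smooth_angle
  have hl := (hν.mul hν).mul ((HasJet.const 1).add
    (hUU.add ((HasJet.const (1 / ν x ^ 2)).mul (hbU.mul hbU))))
  obtain ⟨-, h1, h2⟩ := hl.unique (HasJet.const 1) h.angle_eq
  have hpos := h.angle_pos
  have hs := h.sum_sq
  simp only [zero_mul, mul_ite, ite_mul, mul_zero, Finset.sum_add_distrib, Finset.sum_ite_eq,
    Finset.mem_univ, if_true, zero_add, hs, add_zero] at h1 h2
  have e1 : dd (w c) ν x = -ν x * b c * (lam c - 1) := by
    field_simp at h1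
    nlinarith
  refine ⟨e1, ?_⟩
  rw [e1] at h2
  have hs' : ∑ i, third x w φ c c i * b i = ∑ i, b i * third x w φ c c i :=
    Finset.sum_congr rfl fun i _ => mul_comm _ _
  rw [hs'] at h2
  generalize (∑ i, b i * third x w φ c c i) = X at *
  generalize dd (w c) (dd (w c) ν) x = Y at *
  have h3 : 2 / ν x * (Y - ν x * (2 * b c ^ 2 * (lam c - 1) ^ 2 - ν x ^ 2 * (lam c - 1) ^ 2 - X))
      = 0 := by
    rw [← h2]; field_simp; ring
  have h4 : 2 / ν x ≠ 0 := by positivity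
  linarith [(mul_eq_zero.1 h3).resolve_left h4]

/-- The shape operator is diagonal at the base point. -/
theorem shape_value (h : AdaptedFrame x w φ ν A b lam) (i j : Fin n) :
    A i j x = if i = j then ν x * lam j else 0 := by
  have h1 := (h.shape_eq i j).self_of_nhds
  simp only [h.grad, h.hess, h.height] at h1
  simp only [ite_mul, one_mul, zero_mul, sub_add_cancel, Finset.sum_ite_eq, Finset.mem_univ,
    if_true] at h1
  rw [h1]
  split_ifs <;> ring

/-- The components of the covariant derivative of the second fundamental form in the frame,
divided by the angle function: the third derivatives of the normalized height and the lower order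
terms that the connection contributes. They are symmetric in all three indices, which is the
Codazzi equation. -/
noncomputable def dSecond (x : EuclideanSpace ℝ (Fin n))
    (w : Fin n → EuclideanSpace ℝ (Fin n)) (φ : EuclideanSpace ℝ (Fin n) → ℝ) (b lam : Fin n → ℝ)
    (i j k : Fin n) : ℝ :=
  third x w φ i j k + (if i = j then b k * (2 * lam i - 1 - lam i * lam k) else 0) +
    (if i = k then b j * (2 * lam i - 1 - lam i * lam j) else 0) +
    (if j = k then b i * (2 * lam j - 1 - lam j * lam i) else 0)

theorem dSecond_comm_left (h : AdaptedFrame x w φ ν A b lam) (i j k : Fin n) :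
    dSecond x w φ b lam i j k = dSecond x w φ b lam j i k := by
  unfold dSecond
  rw [h.third_comm_left i j k]
  by_cases h1 : i = j
  · subst h1; ring
  · simp only [h1, Ne.symm h1, if_false]; ring

theorem dSecond_comm_right (h : AdaptedFrame x w φ ν A b lam) (i j k : Fin n) :
    dSecond x w φ b lam i j k = dSecond x w φ b lam i k j := by
  unfold dSecond
  rw [h.third_comm_right i j k]
  by_cases h1 : j = k
  · subst h1; ring
  · simp only [h1, Ne.symm h1, if_false]; ring

theorem third_eq (x : EuclideanSpace ℝ (Fin n))
    (w : Fin n → EuclideanSpace ℝ (Fin n)) (φ : EuclideanSpace ℝ (Fin n) → ℝ) (b lam : Fin n → ℝ)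
    (i j k : Fin n) : third x w φ i j k = dSecond x w φ b lam i j k -
      ((if i = j then b k * (2 * lam i - 1 - lam i * lam k) else 0) +
    (if i = k then b j * (2 * lam i - 1 - lam i * lam j) else 0) +
    (if j = k then b i * (2 * lam j - 1 - lam j * lam i) else 0)) := by
  unfold dSecond; ring

/-- The Hessian of the angle function in terms of the covariant derivative of the second fundamental
form, for a repeated index. -/
theorem angle_second (h : AdaptedFrame x w φ ν A b lam) (c : Fin n) :
    dd (w c) (dd (w c) ν) x = ν x * (-ν x ^ 2 * lam c ^ 2 + 2 * lam c - 1 -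
      lam c * ∑ i, b i ^ 2 * lam i - ∑ i, b i * dSecond x w φ b lam i c c) := by
  rw [(h.jet_angle c).2]
  have h1 : ∑ i, b i * third x w φ c c i = ∑ i, b i * dSecond x w φ b lam i c c -
      ∑ i, ((2 * lam c - 1) * (b i * b i) - lam c * (b i ^ 2 * lam i) +
        if i = c then 2 * b c ^ 2 * (2 * lam c - 1 - lam c * lam c) else 0) := by
    rw [← Finset.sum_sub_distrib]
    refine Finset.sum_congr rfl fun i _ => ?_
    rw [third_eq x w φ b lam, ← h.dSecond_comm_right, ← h.dSecond_comm_left,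
      ← h.dSecond_comm_right]
    by_cases hi : i = c
    · subst hi; simp; ring
    · simp only [hi, Ne.symm hi, if_true, if_false]; ring
  rw [h1, Finset.sum_add_distrib, Finset.sum_sub_distrib, ← Finset.mul_sum, ← Finset.mul_sum,
    h.sum_sq, Finset.sum_ite_eq']
  simp only [Finset.mem_univ, if_true]
  ring

/-- The entries of the shape operator have the covariant derivative of the second fundamental form
as their first derivatives, up to two terms which come from the frame not being parallel. -/
theorem shape_first (h : AdaptedFrame x w φ ν A b lam) (c i j : Fin n) :
    dd (w c) (A i j) x = ν x * (dSecond x w φ b lam i j c +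
      (if i = c then b j * (lam j - lam c) else 0) +
      (if j = c then lam c * b i * (lam i - lam c) else 0)) := by
  have hG : ∀ d, HasJet (w c) x
      (fun y => ((if i = d then 1 else 0) - b i * b d) + dd (w i) φ y * dd (w d) φ y) _ _ _ :=
    fun d => (HasJet.const ((if i = d then 1 else 0) - b i * b d)).add
      ((h.jet_grad c i).mul (h.jet_grad c d))
  have hA : ∀ d, HasJet (w c) x (A d j) _ _ _ := fun d => HasJet.of_smooth (h.smooth_shape d j)
  have hL : HasJet (w c) x (fun y => ∑ d, (((if i = d then 1 else 0) - b i * b d) +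
      dd (w i) φ y * dd (w d) φ y) * A d j y) _ _ _ := HasJet.sum fun d _ => (hG d).mul (hA d)
  have hR := (HasJet.of_smooth (v := w c) h.smooth_angle).mul
    (((HasJet.const ((if i = j then 1 else 0) - b i * b j)).add
      ((h.jet_grad c i).mul (h.jet_grad c j))).add ((h.jet_height c).mul (h.jet_hess c i j)))
  obtain ⟨-, h1, -⟩ := hL.unique hR (h.shape_eq i j)
  simp only [h.shape_value, zero_mul, mul_ite, ite_mul, mul_zero, Finset.sum_add_distrib,
    Finset.sum_ite_eq, Finset.sum_ite_eq', add_mul, sub_add_cancel, one_mul,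
    Finset.mem_univ, if_true, zero_add] at h1
  rw [(h.jet_angle c).1, third_eq x w φ b lam, h.dSecond_comm_left, h.dSecond_comm_right] at h1
  rw [← sub_eq_zero] at h1 ⊢
  refine Eq.trans ?_ h1
  by_cases hij : i = j
  · subst hij
    by_cases hc : i = c
    · subst hc; simp; ring
    · simp only [hc, Ne.symm hc, if_true, if_false]; ring
  · by_cases hc : i = c
    · subst hc
      simp only [hij, Ne.symm hij, if_true, if_false]; ring
    · by_cases hjc : j = c
      · subst hjc
        simp only [hc, Ne.symm hc, if_true, if_false]; ring
      · simp only [hij, hc, hjc, Ne.symm hc, Ne.symm hjc, if_false]; ring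

/-- The second derivatives of the diagonal entries of the shape operator, in terms of derivatives
of the height up to the fourth order. -/
theorem shape_second (h : AdaptedFrame x w φ ν A b lam) {c i : Fin n} (hc : i ≠ c) :
    dd (w c) (dd (w c) (A i i)) x = ν x * (dd (w c) (dd (w c) ν) x / ν x * lam i +
      2 * b c * third x w φ c i i - 2 * b c ^ 2 * (lam c - 1) * (lam i - 1)
      + dd (w c) (dd (w c) (dd (w i) (dd (w i) φ))) x + (lam c - 1) * (lam i - 1)
      - 2 * (lam i - 1) * b i * third x w φ c c i
      - 2 * (lam c - 1) * b c * third x w φ c i i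
      - 2 * (lam c - 1) * b i * (dSecond x w φ b lam c i c + b i * (lam i - lam c))) := by
  have hG : ∀ d, HasJet (w c) x
      (fun y => ((if i = d then 1 else 0) - b i * b d) + dd (w i) φ y * dd (w d) φ y) _ _ _ :=
    fun d => (HasJet.const ((if i = d then 1 else 0) - b i * b d)).add
      ((h.jet_grad c i).mul (h.jet_grad c d))
  have hA : ∀ d, HasJet (w c) x (A d i) _ _ _ := fun d => HasJet.of_smooth (h.smooth_shape d i)
  have hL : HasJet (w c) x (fun y => ∑ d, (((if i = d then 1 else 0) - b i * b d) +
      dd (w i) φ y * dd (w d) φ y) * A d i y) _ _ _ := HasJet.sum fun d _ => (hG d).mul (hA d)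
  have hR := (HasJet.of_smooth (v := w c) h.smooth_angle).mul
    (((HasJet.const ((if i = i then 1 else 0) - b i * b i)).add
      ((h.jet_grad c i).mul (h.jet_grad c i))).add ((h.jet_height c).mul (h.jet_hess c i i)))
  obtain ⟨-, -, h1⟩ := hL.unique hR (h.shape_eq i i)
  simp only [h.shape_value, zero_mul, mul_ite, ite_mul, mul_zero, Finset.sum_add_distrib,
    Finset.sum_ite_eq, Finset.sum_ite_eq', add_mul, sub_add_cancel, one_mul, Ne.symm hc, if_false,
    Finset.mem_univ, if_true, zero_add, add_zero, h.shape_first, (h.jet_angle c).1, hc] at h1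
  rw [← sub_eq_zero] at h1 ⊢
  refine Eq.trans ?_ h1
  have := h.angle_pos.ne'
  field_simp
  ring

/-- The commutation formula for the pure second derivatives of the diagonal entries of the shape
operator, the form that Simons' identity takes in the frame. -/
theorem shape_second_sub (h : AdaptedFrame x w φ ν A b lam) (c i : Fin n) :
    dd (w c) (dd (w c) (A i i)) x - dd (w i) (dd (w i) (A c c)) x =
      lam i * dd (w c) (dd (w c) ν) x - lam c * dd (w i) (dd (w i) ν) x +
      ν x * (2 * b c * lam i * dSecond x w φ b lam i i c -
        2 * b i * lam c * dSecond x w φ b lam c c i +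
        2 * (lam c - lam i) * (b c ^ 2 * lam i + b i ^ 2 * lam c)) := by
  by_cases hc : i = c
  · subst hc; ring
  have h0 := h.angle_pos.ne'
  -- The fourth derivatives of the height cancel, and third derivatives remain.
  rw [h.shape_second hc, h.shape_second (Ne.symm hc), h.fourth_comm c i]
  rw [third_eq x w φ b lam c i i, third_eq x w φ b lam c c i, third_eq x w φ b lam i c c,
    third_eq x w φ b lam i i c]
  rw [h.dSecond_comm_right c i c, h.dSecond_comm_left c i i, h.dSecond_comm_right i c i,
    h.dSecond_comm_left i c c, h.dSecond_comm_right c i c]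
  simp only [hc, Ne.symm hc, if_false, if_true]
  field_simp
  ring

end AdaptedFrame

/-! ### The identity of Simons for the trace of the shape operator -/

namespace AdaptedFrame

variable {n : ℕ} {x : EuclideanSpace ℝ (Fin n)}
    {w : Fin n → EuclideanSpace ℝ (Fin n)} {φ ν : EuclideanSpace ℝ (Fin n) → ℝ}
    {A : Fin n → Fin n → EuclideanSpace ℝ (Fin n) → ℝ} {b lam : Fin n → ℝ}

theorem trace_value (h : AdaptedFrame x w φ ν A b lam) : ∑ i, A i i x = ν x * ∑ i, lam i := by
  simp [h.shape_value, Finset.mul_sum]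

theorem trace_first (h : AdaptedFrame x w φ ν A b lam) (c : Fin n) :
    dd (w c) (fun y => ∑ i, A i i y) x = ν x * ∑ i, dSecond x w φ b lam i i c := by
  rw [dd_sum fun i _ => (h.smooth_shape i i).differentiableAt_infty, Finset.mul_sum]
  refine Finset.sum_congr rfl fun i _ => ?_
  rw [h.shape_first]
  by_cases hi : i = c
  · subst hi; simp
  · simp [hi]

theorem trace_second (h : AdaptedFrame x w φ ν A b lam) (c : Fin n) :
    dd (w c) (dd (w c) (fun y => ∑ i, A i i y)) x = ∑ i, dd (w c) (dd (w c) (A i i)) x :=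
  dd_dd_sum fun i _ => h.smooth_shape i i

/-- The first two derivatives of the equation `(tr A)² - tr A² = s`. Its linearization at the base
point is diagonal, with the coefficient `∑ lam - lam_i` in the direction `i`. -/
theorem second_symm_first (h : AdaptedFrame x w φ ν A b lam) {s : ℝ}
    (hs : ∀ᶠ y in 𝓝 x, (∑ i, A i i y) * (∑ i, A i i y) + (-1) * ∑ i, ∑ j, A i j y * A j i y = s)
    (c : Fin n) :
    (∑ i, (∑ j, lam j - lam i) * dSecond x w φ b lam i i c = 0) ∧
    ∑ i, (∑ j, lam j - lam i) * dd (w c) (dd (w c) (A i i)) x =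
      ν x * (∑ i, ∑ j, dSecond x w φ b lam i j c ^ 2
        + 2 * (1 + lam c) * ∑ j, dSecond x w φ b lam c c j * (b j * (lam j - lam c))
        + 2 * lam c * ∑ j, (b j * (lam j - lam c)) ^ 2
        - (∑ i, dSecond x w φ b lam i i c) ^ 2) := by
  have hA : ∀ i j, HasJet (w c) x (A i j) _ _ _ := fun i j => HasJet.of_smooth (h.smooth_shape i j)
  have hT : HasJet (w c) x (fun y => ∑ i, A i i y) _ _ _ := HasJet.sum fun i _ => hA i i
  have hAA : HasJet (w c) x (fun y => ∑ i, ∑ j, A i j y * A j i y) _ _ _ :=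
    HasJet.sum fun i _ => HasJet.sum fun j _ => (hA i j).mul (hA j i)
  obtain ⟨-, h1, h2⟩ := ((hT.mul hT).add ((HasJet.const (-1)).mul hAA)).unique
    (HasJet.const s) hs
  have hpos := h.angle_pos.ne'
  have e1 := h.trace_value
  have e2 : ∑ i, dd (w c) (A i i) x = ν x * ∑ i, dSecond x w φ b lam i i c := by
    rw [← h.trace_first c, dd_sum fun i _ => (h.smooth_shape i i).differentiableAt_infty]
  have e3 : ∀ i, dd (w c) (A i i) x = ν x * dSecond x w φ b lam i i c := by
    intro i
    rw [h.shape_first]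
    by_cases hi : i = c
    · subst hi; simp
    · simp [hi]
  rw [e1, e2] at h1 h2
  have e4 : ∑ i, ∑ j, (dd (w c) (A i j) x * A j i x + A i j x * dd (w c) (A j i) x) =
      2 * ν x ^ 2 * ∑ i, lam i * dSecond x w φ b lam i i c := by
    simp only [h.shape_value, mul_ite, mul_zero, ite_mul, zero_mul, Finset.sum_add_distrib,
      Finset.sum_ite_eq, Finset.sum_ite_eq', Finset.mem_univ, if_true, e3]
    rw [← Finset.sum_add_distrib, Finset.mul_sum]
    exact Finset.sum_congr rfl fun i _ => by ring
  have e5 : ∑ i, ∑ j, (dd (w c) (dd (w c) (A i j)) x * A j i x +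
      2 * (dd (w c) (A i j) x * dd (w c) (A j i) x) + A i j x * dd (w c) (dd (w c) (A j i)) x) =
      2 * ν x * (∑ i, lam i * dd (w c) (dd (w c) (A i i)) x) +
        2 * ∑ i, ∑ j, dd (w c) (A i j) x * dd (w c) (A j i) x := by
    simp only [h.shape_value, mul_ite, mul_zero, ite_mul, zero_mul, Finset.sum_add_distrib,
      Finset.sum_ite_eq, Finset.sum_ite_eq', Finset.mem_univ, if_true, ← Finset.mul_sum]
    simp only [mul_comm (dd (w c) (dd (w c) (A _ _)) x), mul_assoc, ← Finset.mul_sum]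
    ring
  have e6 : ∑ i, ∑ j, dd (w c) (A i j) x * dd (w c) (A j i) x =
      ν x ^ 2 * (∑ i, ∑ j, dSecond x w φ b lam i j c ^ 2
        + 2 * (1 + lam c) * ∑ j, dSecond x w φ b lam c c j * (b j * (lam j - lam c))
        + 2 * lam c * ∑ j, (b j * (lam j - lam c)) ^ 2) := by
    have key : ∀ i j, dd (w c) (A i j) x * dd (w c) (A j i) x =
        ν x ^ 2 * (dSecond x w φ b lam i j c ^ 2 +
          (if i = c then (1 + lam c) * (dSecond x w φ b lam c c j * (b j * (lam j - lam c)))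
            + lam c * (b j * (lam j - lam c)) ^ 2 else 0) +
          (if j = c then (1 + lam c) * (dSecond x w φ b lam c c i * (b i * (lam i - lam c)))
            + lam c * (b i * (lam i - lam c)) ^ 2 else 0)) := by
      intro i j
      rw [h.shape_first, h.shape_first, h.dSecond_comm_left j i c]
      by_cases hi : i = c
      · subst hi
        by_cases hj : j = i
        · subst hj; simp; ring
        · rw [h.dSecond_comm_right i j i]
          simp only [hj, if_true, if_false]; ring
      · by_cases hj : j = c
        · subst hj
          rw [h.dSecond_comm_left i j j, h.dSecond_comm_right j i j]
          simp only [hi, if_true, if_false]; ring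
        · simp only [hi, hj, if_false]; ring
    simp only [key, ← Finset.mul_sum, Finset.sum_add_distrib, Finset.sum_ite_eq',
      Finset.mem_univ, if_true]
    rw [Finset.sum_comm (γ := Fin n)]
    simp only [Finset.sum_add_distrib, ← Finset.mul_sum, Finset.sum_ite_eq', Finset.mem_univ,
      if_true, Finset.sum_ite_irrel, Finset.sum_const_zero]
    ring
  rw [e4] at h1
  rw [e5, e6] at h2
  simp only [sub_mul, Finset.sum_sub_distrib, ← Finset.mul_sum]
  constructor
  · have : 2 * ν x ^ 2 * ((∑ i, lam i) * ∑ i, dSecond x w φ b lam i i c -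
        ∑ i, lam i * dSecond x w φ b lam i i c) = 0 := by linear_combination h1
    exact (mul_eq_zero.1 this).resolve_left (by positivity)
  · have h3 := mul_left_cancel₀ (a := 2 * ν x) (by positivity)
      (b := (∑ i, lam i) * ∑ i, dd (w c) (dd (w c) (A i i)) x -
        ∑ i, lam i * dd (w c) (dd (w c) (A i i)) x)
      (c := ν x * (∑ i, ∑ j, dSecond x w φ b lam i j c ^ 2
        + 2 * (1 + lam c) * ∑ j, dSecond x w φ b lam c c j * (b j * (lam j - lam c))
        + 2 * lam c * ∑ j, (b j * (lam j - lam c)) ^ 2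
        - (∑ i, dSecond x w φ b lam i i c) ^ 2)) (by linear_combination h2)
    exact h3

/-- The linearized operator applied to the angle function. The third derivatives of the height drop
out by the differentiated equation. -/
theorem sum_angle_second (h : AdaptedFrame x w φ ν A b lam) {s : ℝ}
    (hs : ∀ᶠ y in 𝓝 x, (∑ i, A i i y) * (∑ i, A i i y) + (-1) * ∑ i, ∑ j, A i j y * A j i y = s) :
    ∑ c, (∑ j, lam j - lam c) * dd (w c) (dd (w c) ν) x =
      ν x * (-ν x ^ 2 * ∑ c, (∑ j, lam j - lam c) * lam c ^ 2 +
        2 * ∑ c, (∑ j, lam j - lam c) * lam c - ∑ c, (∑ j, lam j - lam c) -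
        (∑ i, b i ^ 2 * lam i) * ∑ c, (∑ j, lam j - lam c) * lam c) := by
  have h0 : ∑ c, (∑ j, lam j - lam c) * ∑ i, b i * dSecond x w φ b lam i c c = 0 := by
    simp only [Finset.mul_sum]
    rw [Finset.sum_comm]
    refine Finset.sum_eq_zero fun i _ => ?_
    have := (h.second_symm_first hs i).1
    rw [← mul_zero (b i), ← this, Finset.mul_sum]
    refine Finset.sum_congr rfl fun c _ => ?_
    rw [h.dSecond_comm_left i c c, h.dSecond_comm_right c i c]; ring
  simp only [h.angle_second]
  generalize (∑ j, lam j) = L at *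
  generalize (∑ i, b i ^ 2 * lam i) = Z at *
  have : ν x * ∑ c, (L - lam c) * ∑ i, b i * dSecond x w φ b lam i c c = 0 := by
    rw [h0, mul_zero]
  rw [← sub_zero (ν x * _), ← this]
  simp only [Finset.mul_sum, ← Finset.sum_add_distrib, ← Finset.sum_sub_distrib]
  refine Finset.sum_congr rfl fun c _ => ?_
  simp only [← Finset.mul_sum]
  ring

/-- The linearized operator applied to the trace of the shape operator. Exchanging the derivatives
with `shape_second_sub` leaves derivatives of the equation itself, which are quadratic in the
covariant derivative of the second fundamental form. -/
theorem sum_trace_second (h : AdaptedFrame x w φ ν A b lam) {s : ℝ}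
    (hs : ∀ᶠ y in 𝓝 x, (∑ i, A i i y) * (∑ i, A i i y) + (-1) * ∑ i, ∑ j, A i j y * A j i y = s) :
    ∑ c, (∑ j, lam j - lam c) * dd (w c) (dd (w c) (fun y => ∑ i, A i i y)) x =
      ν x * ((∑ c, ∑ i, ∑ j, dSecond x w φ b lam i j c ^ 2) -
        (∑ c, (∑ i, dSecond x w φ b lam i i c) ^ 2) +
        (∑ c, ∑ a, (∑ j, lam j - lam c) * ((lam c - lam a) * (1 - ν x ^ 2 * lam a * lam c))) -
        2 * (∑ c, (∑ j, lam j - lam c) * (b c * ∑ i, dSecond x w φ b lam i i c)) +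
        (∑ c, (∑ j, lam j - lam c) * lam c) * ∑ c, b c * ∑ i, dSecond x w φ b lam i i c) := by
  have hX0 : ∑ c, (∑ j, lam j - lam c) * ∑ i, b i * dSecond x w φ b lam i c c = 0 := by
    simp only [Finset.mul_sum]
    rw [Finset.sum_comm]
    refine Finset.sum_eq_zero fun i _ => ?_
    have := (h.second_symm_first hs i).1
    rw [← mul_zero (b i), ← this, Finset.mul_sum]
    refine Finset.sum_congr rfl fun c _ => ?_
    rw [h.dSecond_comm_left i c c, h.dSecond_comm_right c i c]; ring
  have hX1 : ∑ c, ∑ i, b i * dSecond x w φ b lam i c c =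
      ∑ c, b c * ∑ i, dSecond x w φ b lam i i c := by
    rw [Finset.sum_comm]
    refine Finset.sum_congr rfl fun i _ => ?_
    rw [Finset.mul_sum]
    refine Finset.sum_congr rfl fun c _ => ?_
    rw [h.dSecond_comm_left i c c, h.dSecond_comm_right c i c]
  have h2 := fun c => (h.second_symm_first hs c).2
  have h1 := fun c => (h.second_symm_first hs c).1
  have hsub := h.shape_second_sub
  have hang := h.angle_second
  set H := dSecond x w φ b lam with hH
  set L := ∑ j, lam j with hL
  set Z := ∑ i, b i ^ 2 * lam i
  have step1 : ∑ c, (L - lam c) * dd (w c) (dd (w c) (fun y => ∑ i, A i i y)) x =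
      (∑ c, ∑ i, (L - lam i) * dd (w c) (dd (w c) (A i i)) x) +
      ∑ c, ∑ i, (L - lam c) * (dd (w c) (dd (w c) (A i i)) x - dd (w i) (dd (w i) (A c c)) x) := by
    rw [Finset.sum_comm (f := fun c i => (L - lam i) * dd (w c) (dd (w c) (A i i)) x),
      ← Finset.sum_add_distrib]
    refine Finset.sum_congr rfl fun c _ => ?_
    rw [h.trace_second, Finset.mul_sum, ← Finset.sum_add_distrib]
    exact Finset.sum_congr rfl fun i _ => by ring
  rw [step1]
  simp only [h2, hsub, hang]
  -- The terms that are linear in the derivatives of the second fundamental form.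
  have lin : (∑ c, ∑ i, (L - lam c) * (2 * b c * lam i * H i i c - 2 * b i * lam c * H c c i)) +
      ∑ c, 2 * (1 + lam c) * ∑ j, H c c j * (b j * (lam j - lam c)) =
      - 2 * ∑ c, (L - lam c) * (b c * ∑ i, H i i c) := by
    have e1 : ∑ c, ∑ i, (L - lam c) * (2 * b c * lam i * H i i c) =
        ∑ c, ∑ i, (L - lam i) * (2 * b i * lam c * H c c i) := Finset.sum_comm
    have e2 : ∑ c, ∑ i, 2 * (b i * H c c i * (lam i - lam c)) =
        - 2 * ∑ c, (L - lam c) * (b c * ∑ i, H i i c) := by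
      rw [Finset.sum_comm, Finset.mul_sum]
      refine Finset.sum_congr rfl fun c _ => ?_
      have := h1 c
      simp only [sub_mul, Finset.sum_sub_distrib, ← Finset.mul_sum] at this
      have e3 : ∑ i, 2 * (b c * H i i c * (lam c - lam i)) =
          2 * b c * lam c * (∑ i, H i i c) - 2 * b c * ∑ i, lam i * H i i c := by
        rw [Finset.mul_sum, Finset.mul_sum, ← Finset.sum_sub_distrib]
        exact Finset.sum_congr rfl fun i _ => by ring
      rw [e3]
      linear_combination 2 * b c * this
    rw [← e2]
    simp only [mul_sub (_ : ℝ) (_ * _ * _ * _ : ℝ), Finset.sum_sub_distrib, Finset.mul_sum] at e1 ⊢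
    rw [e1]
    simp only [← Finset.sum_sub_distrib, ← Finset.sum_add_distrib]
    exact Finset.sum_congr rfl fun c _ => Finset.sum_congr rfl fun i _ => by ring
  -- The terms that are quadratic in `b` cancel.
  have quad : (∑ c, ∑ i, (L - lam c) *
        (2 * (lam c - lam i) * (b c ^ 2 * lam i + b i ^ 2 * lam c))) +
      ∑ c, 2 * lam c * ∑ j, (b j * (lam j - lam c)) ^ 2 = 0 := by
    have e1 : ∑ c, ∑ i, (L - lam c) * (2 * (lam c - lam i) * (b c ^ 2 * lam i)) =
        ∑ c, ∑ i, (L - lam i) * (2 * (lam i - lam c) * (b i ^ 2 * lam c)) := Finset.sum_comm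
    simp only [mul_add, Finset.sum_add_distrib, Finset.mul_sum] at e1 ⊢
    rw [e1]
    simp only [← Finset.sum_add_distrib]
    exact Finset.sum_eq_zero fun c _ => Finset.sum_eq_zero fun i _ => by ring
  -- The terms that contain second derivatives of the angle function.
  have ang : ∑ c, ∑ i, (L - lam c) * (lam i * (ν x * (-ν x ^ 2 * lam c ^ 2 + 2 * lam c - 1 -
        lam c * Z - ∑ i, b i * H i c c)) - lam c * (ν x * (-ν x ^ 2 * lam i ^ 2 + 2 * lam i - 1 -
        lam i * Z - ∑ j, b j * H j i i))) =
      ν x * ((∑ c, ∑ a, (L - lam c) * ((lam c - lam a) * (1 - ν x ^ 2 * lam a * lam c))) +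
        (∑ c, (L - lam c) * lam c) * ∑ c, b c * ∑ i, H i i c) := by
    have e1 : ∑ c, ∑ i, (L - lam c) * (lam i * ∑ j, b j * H j c c) = 0 := by
      rw [Finset.sum_comm, ← Finset.sum_const_zero (ι := Fin n) (s := Finset.univ)]
      refine Finset.sum_congr rfl fun i _ => ?_
      rw [← mul_zero (lam i), ← hX0, Finset.mul_sum]
      exact Finset.sum_congr rfl fun c _ => by ring
    have e2 : ∑ c, ∑ i, (L - lam c) * (lam c * ∑ j, b j * H j i i) =
        (∑ c, (L - lam c) * lam c) * ∑ c, b c * ∑ i, H i i c := by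
      rw [← hX1, Finset.sum_mul_sum]
      exact Finset.sum_congr rfl fun c _ => Finset.sum_congr rfl fun i _ => by ring
    have e3 : ν x * ∑ c, ∑ i, (L - lam c) * (lam i * ∑ j, b j * H j c c) = 0 := by rw [e1, mul_zero]
    rw [← e2, mul_add, ← sub_zero (_ + _), ← e3]
    simp only [Finset.mul_sum _ _ (ν x), ← Finset.sum_add_distrib, ← Finset.sum_sub_distrib]
    exact Finset.sum_congr rfl fun c _ => Finset.sum_congr rfl fun i _ => by ring
  simp only [mul_add (L - lam _), Finset.sum_add_distrib]
  rw [ang]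
  have e4 : ∑ c, ∑ i, (L - lam c) * (ν x * (2 * b c * lam i * H i i c - 2 * b i * lam c * H c c i +
        2 * (lam c - lam i) * (b c ^ 2 * lam i + b i ^ 2 * lam c))) =
      ν x * ((∑ c, ∑ i, (L - lam c) * (2 * b c * lam i * H i i c - 2 * b i * lam c * H c c i)) +
       ∑ c, ∑ i, (L - lam c) * (2 * (lam c - lam i) * (b c ^ 2 * lam i + b i ^ 2 * lam c))) := by
    rw [← Finset.sum_add_distrib, Finset.mul_sum]
    refine Finset.sum_congr rfl fun c _ => ?_
    rw [← Finset.sum_add_distrib, Finset.mul_sum]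
    exact Finset.sum_congr rfl fun i _ => by ring
  rw [e4, ← Finset.mul_sum]
  simp only [Finset.sum_add_distrib, Finset.sum_sub_distrib] at lin quad ⊢
  linear_combination ν x * lin + ν x * quad

end AdaptedFrame

/-! ### Inequalities between principal curvatures -/

/-- The Cauchy-Schwarz inequality with the weight `3` on all directions but `c`, where it is `1`:
these are the weights with which the components `ξ_i = h_iic` occur among all the components
`h_ijk`. -/
theorem sum_sq_two_weights {ι : Type*} [Fintype ι] (lam ξ : ι → ℝ) (c : ι) (L : ℝ)
    (hL : ∑ i, lam i ^ 2 ≤ L ^ 2) :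
    3 * (∑ i, lam i * ξ i) ^ 2 ≤
      (L ^ 2 + 2 * lam c ^ 2) * (3 * ∑ i, ξ i ^ 2 - 2 * ξ c ^ 2) := by
  classical
  have h1 := Finset.sum_sq_le_sum_mul_sum_of_sq_le_mul Finset.univ
    (r := fun i => lam i * ξ i) (f := fun i => lam i ^ 2 + if i = c then 2 * lam i ^ 2 else 0)
    (g := fun i => ξ i ^ 2 - if i = c then 2 / 3 * ξ i ^ 2 else 0)
    (fun i _ => by split_ifs <;> positivity)
    (fun i _ => by split_ifs <;> nlinarith [sq_nonneg (ξ i)])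
    (fun i _ => le_of_eq (by split_ifs <;> ring))
  simp only [Finset.sum_add_distrib, Finset.sum_sub_distrib, Finset.sum_ite_eq', Finset.mem_univ,
    if_true] at h1
  have h2 : ξ c ^ 2 ≤ ∑ i, ξ i ^ 2 :=
    Finset.single_le_sum (f := fun i => ξ i ^ 2) (fun i _ => sq_nonneg _) (Finset.mem_univ c)
  have h3 : 0 ≤ ∑ i, ξ i ^ 2 - 2 / 3 * ξ c ^ 2 := by nlinarith [sq_nonneg (ξ c)]
  nlinarith [mul_le_mul_of_nonneg_right hL h3]

theorem neg_inv_le_quadratic {a y : ℝ} (ha : 0 < a) : -(1 / a) ≤ a * y ^ 2 + 2 * y := by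
  have : a * y ^ 2 + 2 * y + 1 / a = (a * y + 1) ^ 2 / a := by field_simp; ring
  have h2 : 0 ≤ (a * y + 1) ^ 2 / a := by positivity
  linarith

/-- A large negative eigenvalue has a large square; the angle bound `σ ≤ ν` enters here. -/
theorem le_mul_sq_of_lt {n L lam ν σ : ℝ} (hn : 3 ≤ n) (hσ : 0 < σ) (hν : σ ≤ ν)
    (hs : lam < -(L / 10)) (hLσ : 20 * n ≤ σ * L) : 3 * n ≤ ν ^ 2 / (n - 1) * lam ^ 2 := by
  rw [div_mul_eq_mul_div, le_div_iff₀ (by linarith)]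
  have ha : 2 * n ≤ σ * (-lam) := by
    have := mul_le_mul_of_nonneg_left hs.le hσ.le
    linarith
  have hlam : 0 < -lam := by
    by_contra! hc
    have := mul_nonpos_of_nonneg_of_nonpos hσ.le hc
    linarith
  have hb : σ * (-lam) ≤ ν * (-lam) := mul_le_mul_of_nonneg_right hν hlam.le
  have hc : (2 * n) ^ 2 ≤ (ν * (-lam)) ^ 2 :=
    pow_le_pow_left₀ (by linarith) (ha.trans hb) 2
  have hd : 3 * n * (n - 1) ≤ (2 * n) ^ 2 := by nlinarith only [hn]
  calc 3 * n * (n - 1) ≤ (ν * (-lam)) ^ 2 := hd.trans hc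
    _ = ν ^ 2 * lam ^ 2 := by ring

/-- The contribution of one eigendirection to the second derivative test at a maximum of
`(n - 1) log (tr A) - n log ν`, with `N = n / (n - 1)`: the derivative of the trace in this
direction is a multiple of `N L (lam - 1)`. The first term on the right is what the Cauchy-Schwarz
inequality gives for the derivatives of the second fundamental form; without it the
second term could not be absorbed. If `lam` is very negative, the cubic term on the left takes over. -/
theorem single_direction_bound {n N L lam ν σ : ℝ} (hn : 3 ≤ n) (hN : N * (n - 1) = n)
    (hσ : 0 < σ) (hν : σ ≤ ν) (hL : 0 < L) (h1 : lam < L)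
    (h2 : L - lam ≤ (n - 1) * (L + lam)) (hL10 : 10 ≤ L) (hLσ : 20 * n ≤ σ * L) :
    -(4 / 5 * L + ν ^ 2 / (n - 1) * (L - lam) * lam ^ 2) ≤
      2 * (L ^ 2 - lam ^ 2) / (L ^ 2 + 2 * lam ^ 2) * (N ^ 2 * (lam - 1) ^ 2 * L) -
        (L - lam) * (N ^ 2 * (lam - 1) ^ 2) + 2 * N * (L - lam) * (lam - 1) +
        N * (L - lam) * (lam - 1) ^ 2 := by
  have hn1 : 0 < n - 1 := by linarith
  have hN0 : 0 < N := by
    rw [← eq_div_iff hn1.ne'] at hN; rw [hN]; positivity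
  have hf : 0 < L - lam := by linarith
  have hneg : -L < lam := by nlinarith
  have hnn : 0 ≤ ν ^ 2 / (n - 1) * (L - lam) * lam ^ 2 := by positivity
  have hden : 0 < L ^ 2 + 2 * lam ^ 2 := by positivity
  set m := 2 * (L + lam) * L / (L ^ 2 + 2 * lam ^ 2) with hm
  have hmeq : m * (L ^ 2 + 2 * lam ^ 2) = 2 * (L + lam) * L := by rw [hm]; field_simp
  have hid : 2 * (L ^ 2 - lam ^ 2) / (L ^ 2 + 2 * lam ^ 2) * (N ^ 2 * (lam - 1) ^ 2 * L) -
        (L - lam) * (N ^ 2 * (lam - 1) ^ 2) + 2 * N * (L - lam) * (lam - 1) +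
        N * (L - lam) * (lam - 1) ^ 2 =
      (L - lam) * ((m - 1 / n) * (N * (lam - 1)) ^ 2 + 2 * (N * (lam - 1))) := by
    have hNn : N = N ^ 2 * (1 - 1 / n) := by
      have : n ≠ 0 := by linarith
      field_simp; linear_combination -hN
    have e : 2 * (L ^ 2 - lam ^ 2) / (L ^ 2 + 2 * lam ^ 2) * (N ^ 2 * (lam - 1) ^ 2 * L) =
        (L - lam) * m * (N ^ 2 * (lam - 1) ^ 2) := by rw [hm]; field_simp; ring
    rw [e]
    linear_combination (L - lam) * (lam - 1) ^ 2 * hNn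
  rw [hid]
  -- `L - lam ≤ (n - 1) (L + lam)` says that `2 L ≤ n (L + lam)`.
  have hmlow : 4 / (3 * n) ≤ m := by
    have h3 : 2 * L ≤ n * (L + lam) := by linarith
    rw [hm, div_le_div_iff₀ (by positivity) hden]
    have h4 : lam ^ 2 ≤ L ^ 2 := by nlinarith
    nlinarith [mul_le_mul_of_nonneg_right h3 hL.le]
  have hmn : 1 / (3 * n) ≤ m - 1 / n := by
    have : 4 / (3 * n) - 1 / n = 1 / (3 * n) := by field_simp; ring
    linarith
  have hn0 : 0 < n := by linarith
  have h3n : 0 < 1 / (3 * n) := by positivity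
  set y := N * (lam - 1) with hy
  rcases le_or_gt 1 lam with hl | hl
  · have : 0 ≤ y := mul_nonneg hN0.le (by linarith)
    have h5 : 0 ≤ (m - 1 / n) * y ^ 2 + 2 * y :=
      add_nonneg (mul_nonneg (by linarith) (sq_nonneg _)) (by linarith)
    have := mul_nonneg hf.le h5
    linarith
  -- For `lam` between `-L / 10` and `1` the coefficient `m` is so close to `2` that the loss is at
  -- most `100 / 141` of `L - lam`, hence at most `4 / 5` of `L`.
  rcases le_or_gt (-(L / 10)) lam with hs | hs
  · have hm2 : 176 / 100 ≤ m := by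
      rw [hm, le_div_iff₀ hden]
      nlinarith
    have h13 : 1 / n ≤ 1 / 3 := one_div_le_one_div_of_le (by norm_num) hn
    have h6 := neg_inv_le_quadratic (a := 141 / 100) (y := y) (by norm_num)
    have h7 : 141 / 100 * y ^ 2 ≤ (m - 1 / n) * y ^ 2 :=
      mul_le_mul_of_nonneg_right (by linarith) (sq_nonneg _)
    have h8 : (L - lam) * (-(100 / 141)) ≤ (L - lam) * ((m - 1 / n) * y ^ 2 + 2 * y) :=
      mul_le_mul_of_nonneg_left (by norm_num at h6; linarith) hf.le
    linarith
  · have h6 := neg_inv_le_quadratic (a := 1 / (3 * n)) (y := y) h3n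
    rw [one_div_one_div] at h6
    have h7 : 1 / (3 * n) * y ^ 2 ≤ (m - 1 / n) * y ^ 2 :=
      mul_le_mul_of_nonneg_right hmn (sq_nonneg _)
    have h8 : (L - lam) * (-(3 * n)) ≤ (L - lam) * ((m - 1 / n) * y ^ 2 + 2 * y) :=
      mul_le_mul_of_nonneg_left (by linarith) hf.le
    have h9 := le_mul_sq_of_lt hn hσ hν hs hLσ
    have h10 := mul_le_mul_of_nonneg_left h9 hf.le
    linarith

/-! ### The gap function has no interior maximum -/

namespace AdaptedFrame

variable {n : ℕ} {x : EuclideanSpace ℝ (Fin n)}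
    {w : Fin n → EuclideanSpace ℝ (Fin n)} {φ ν : EuclideanSpace ℝ (Fin n) → ℝ}
    {A : Fin n → Fin n → EuclideanSpace ℝ (Fin n) → ℝ} {b lam : Fin n → ℝ} {σ : ℝ}

theorem second_symm_value (h : AdaptedFrame x w φ ν A b lam) :
    (∑ i, A i i x) * (∑ i, A i i x) + (-1) * ∑ i, ∑ j, A i j x * A j i x =
      ν x ^ 2 * ((∑ i, lam i) ^ 2 - ∑ i, lam i ^ 2) := by
  rw [h.trace_value]
  simp only [h.shape_value, mul_ite, mul_zero, ite_mul, zero_mul,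
    Finset.sum_ite_eq', Finset.mem_univ, if_true]
  have : ∑ i, ν x * lam i * (ν x * lam i) = ν x ^ 2 * ∑ i, lam i ^ 2 := by
    rw [Finset.mul_sum]; exact Finset.sum_congr rfl fun i _ => by ring
  rw [this]; ring

theorem angle_le_one (h : AdaptedFrame x w φ ν A b lam) : ν x ≤ 1 := by
  have h1 := h.angle_sq
  have h2 : 0 ≤ ∑ i, b i ^ 2 := Finset.sum_nonneg fun i _ => sq_nonneg _
  have := h.angle_pos
  nlinarith

theorem sum_coeff (lam : Fin n → ℝ) :
    ∑ c, (∑ j, lam j - lam c) = (n - 1) * ∑ j, lam j := by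
  rw [Finset.sum_sub_distrib]; simp; ring

theorem sum_coeff_mul (lam : Fin n → ℝ) :
    ∑ c, (∑ j, lam j - lam c) * lam c = (∑ j, lam j) ^ 2 - ∑ j, lam j ^ 2 := by
  simp only [sub_mul, Finset.sum_sub_distrib, ← Finset.mul_sum, sq]

theorem abs_lt_sum {lam : Fin n → ℝ} (hL : 0 < ∑ i, lam i)
    (hlt : ∑ i, lam i ^ 2 < (∑ i, lam i) ^ 2) (c : Fin n) : |lam c| < ∑ i, lam i := by
  refine abs_lt_of_sq_lt_sq ?_ hL.le
  have : lam c ^ 2 ≤ ∑ i, lam i ^ 2 :=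
    Finset.single_le_sum (f := fun i => lam i ^ 2) (fun i _ => sq_nonneg _) (Finset.mem_univ c)
  linarith

/-- The inequality `H₂ ^ (1 / 2) ≤ H₁`. -/
theorem mul_le_angle_mul_sum (lam : Fin n → ℝ) {ν : ℝ} (hn : 2 ≤ n) (hν : 0 < ν)
    (hL : 0 < ∑ i, lam i)
    (hS : ν ^ 2 * ((∑ i, lam i) ^ 2 - ∑ i, lam i ^ 2) = n * (n - 1) * σ ^ 2) :
    n * σ ≤ ν * ∑ i, lam i := by
  have hnR : (2:ℝ) ≤ n := by exact_mod_cast hn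
  have h6 : (0:ℝ) < n - 1 := by linarith
  have hcs : (∑ i, lam i) ^ 2 ≤ n * ∑ i, lam i ^ 2 := by
    simpa using sq_sum_le_card_mul_sum_sq (s := Finset.univ) (f := lam)
  refine abs_le_of_sq_le_sq' ?_ (by positivity) |>.2
  have h5 := mul_le_mul_of_nonneg_left hcs (sq_nonneg ν)
  have h7 : (n - 1) * (n * σ) ^ 2 ≤ (n - 1) * (ν * ∑ i, lam i) ^ 2 := by
    have : (n - 1) * (n * σ) ^ 2 = n * (n * (n - 1) * σ ^ 2) := by ring
    rw [this, ← hS]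
    linarith
  exact le_of_mul_le_mul_left h7 h6

/-- The gap function `(σ + δ - ν) / φ` has no interior local maximum. At a critical point the
equation for the angle function contains the cubic sum `∑ (L - lam) lam²`, which the inequality
`∑ (L - lam) (ν lam - σ)² ≥ 0` bounds from below; `H₂ ^ (1 / 2) ≤ H₁` then gives the wrong sign for the
linearized operator, strictly so because of `δ`. -/
theorem no_interior_max (h : AdaptedFrame x w φ ν A b lam) (hn : 2 ≤ n) (hσ0 : 0 < σ)
    (hσ1 : σ < 1) {δ : ℝ} (hδ : 0 < δ) (hL : 0 < ∑ i, lam i)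
    (hs : ∀ᶠ y in 𝓝 x, (∑ i, A i i y) * (∑ i, A i i y) + (-1) * ∑ i, ∑ j, A i j y * A j i y =
      n * (n - 1) * σ ^ 2)
    (hmax : IsLocalMax (fun y => (σ + δ - ν y) / φ y) x) : False := by
  have hφ0 : φ x ≠ 0 := by rw [h.height]; norm_num
  have hsm : ContDiffAt ℝ ∞ (fun y => (σ + δ - ν y) / φ y) x :=
    (contDiffAt_const.sub h.smooth_angle).div h.smooth_height hφ0
  have hval : (σ + δ - ν x) / φ x = σ + δ - ν x := by rw [h.height, div_one]
  have hjet : ∀ c, -dd (w c) ν x = (σ + δ - ν x) * b c ∧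
      -dd (w c) (dd (w c) ν) x ≤ (σ + δ - ν x) * (lam c - 1) := by
    intro c
    have hd2 := dd_dd_nonpos_of_isLocalMax (v := w c) (hsm.of_le (by norm_cast)) hmax
    have hΘ : HasJet (w c) x (fun y => (σ + δ - ν y) / φ y) (σ + δ - ν x) 0 _ :=
      ⟨hsm, hval, dd_eq_zero_of_isLocalMax hmax, rfl⟩
    have hR : HasJet (w c) x (fun y => (σ + δ) + (-1) * ν y) _ _ _ :=
      (HasJet.const _).add ((HasJet.const (-1)).mul (HasJet.of_smooth h.smooth_angle))
    obtain ⟨-, h1, h2⟩ := (hΘ.mul (h.jet_height c)).unique hR (by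
      filter_upwards [h.smooth_height.continuousAt.eventually_ne hφ0] with y hy
      field_simp; ring)
    constructor <;> linarith
  have hν := h.angle_pos
  have hν1 := h.angle_le_one
  have hsum := h.sum_angle_second hs
  have hS := h.second_symm_value.symm.trans hs.self_of_nhds
  have hnR : (2:ℝ) ≤ n := by exact_mod_cast hn
  set L := ∑ j, lam j with hLdef
  have hspos : 0 < (n:ℝ) * (n - 1) * σ ^ 2 := by
    have : (0:ℝ) < n - 1 := by linarith
    positivity
  have hlt : ∑ i, lam i ^ 2 < L ^ 2 := by
    by_contra! hc
    nlinarith [mul_nonneg (sq_nonneg (ν x)) (sub_nonneg.2 hc)]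
  have hf : ∀ c, 0 < L - lam c := fun c => by
    have := (abs_lt.1 (abs_lt_sum hL hlt c)).2; linarith
  have hP : ∑ c, (L - lam c) = (n - 1) * L := sum_coeff lam
  have hs' : ∑ c, (L - lam c) * lam c = L ^ 2 - ∑ j, lam j ^ 2 := sum_coeff_mul lam
  -- The critical point condition determines the weighted sum of the principal curvatures.
  have hZ : ν x * ∑ i, b i ^ 2 * lam i = (σ + δ) * (1 - ν x ^ 2) := by
    have e : ∀ i, ν x * (b i ^ 2 * lam i) = (σ + δ) * (b i * b i) := by
      intro i
      have := (hjet i).1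
      rw [(h.jet_angle i).1] at this
      linear_combination b i * this
    rw [Finset.mul_sum, ← h.sum_sq, Finset.mul_sum]
    exact Finset.sum_congr rfl fun i _ => e i
  have hmain : -∑ c, (L - lam c) * dd (w c) (dd (w c) ν) x ≤
      (σ + δ - ν x) * (∑ c, (L - lam c) * lam c - ∑ c, (L - lam c)) := by
    rw [← Finset.sum_neg_distrib, ← Finset.sum_sub_distrib, Finset.mul_sum]
    refine Finset.sum_le_sum fun c _ => ?_
    have := mul_le_mul_of_nonneg_left (hjet c).2 (hf c).le
    linarith
  rw [hsum] at hmain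
  set R := ∑ c, (L - lam c) * lam c ^ 2 with hR
  set P := ∑ c, (L - lam c) with hPdef
  set s := ∑ c, (L - lam c) * lam c with hsdef
  have hquad : 2 * σ * ν x * s - σ ^ 2 * P ≤ ν x ^ 2 * R := by
    have h0 : 0 ≤ ∑ c, (L - lam c) * (ν x * lam c - σ) ^ 2 :=
      Finset.sum_nonneg fun c _ => mul_nonneg (hf c).le (sq_nonneg _)
    have e : ∑ c, (L - lam c) * (ν x * lam c - σ) ^ 2 =
        ν x ^ 2 * R - 2 * σ * ν x * s + σ ^ 2 * P := by
      rw [hR, hPdef, hsdef, Finset.mul_sum, Finset.mul_sum, Finset.mul_sum,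
        ← Finset.sum_sub_distrib, ← Finset.sum_add_distrib]
      exact Finset.sum_congr rfl fun c _ => by ring
    linarith
  have hνs : ν x ^ 2 * s = n * (n - 1) * σ ^ 2 := by rw [hs']; exact hS
  have hLn : n * σ ≤ ν x * L := mul_le_angle_mul_sum lam hn hν hL hS
  have hPs : ν x * s ≤ σ * P := by
    have h6 : (0:ℝ) ≤ (n - 1) * σ := mul_nonneg (by linarith) hσ0.le
    have h7 : ν x * (ν x * s) ≤ ν x * (σ * P) := by
      rw [hP]; nlinarith [mul_le_mul_of_nonneg_left hLn h6]
    exact le_of_mul_le_mul_left h7 hν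
  have hspos' : 0 < s := by
    have : 0 < ν x ^ 2 * s := by rw [hνs]; exact hspos
    exact pos_of_mul_pos_right this (by positivity)
  have hexp : ν x * (ν x ^ 2 * R) - ν x * s - (σ + δ) * ν x ^ 2 * s + (σ + δ) * P ≤ 0 := by
    have e : ν x * ((∑ i, b i ^ 2 * lam i) * s) = (σ + δ) * (1 - ν x ^ 2) * s := by
      rw [← mul_assoc, hZ]
    linarith [e, hmain]
  have h1 : ν x * (2 * σ * ν x * s - σ ^ 2 * P) ≤ ν x * (ν x ^ 2 * R) :=
    mul_le_mul_of_nonneg_left hquad hν.le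
  have h2 : 0 ≤ (1 - ν x * σ) * (σ * P - ν x * s) :=
    mul_nonneg (by nlinarith) (by linarith)
  have h3 : 0 < δ * (P - ν x ^ 2 * s) := by
    apply mul_pos hδ
    have hP0 : 0 < P := by
      have : 0 < ν x * s := by positivity
      exact pos_of_mul_pos_right (this.trans_le hPs) hσ0.le
    have h4 : ν x ^ 2 * s ≤ ν x * (σ * P) := by
      have := mul_le_mul_of_nonneg_left hPs hν.le
      linarith
    have h5 : ν x * σ < 1 := by nlinarith
    have h6 : ν x * σ * P < 1 * P := mul_lt_mul_of_pos_right h5 hP0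
    linarith
  linarith

/-- A lower bound for `|∇h|² - |∇(tr h)|²`. The component `h_iic` with `i ≠ c` occurs three times in
`|∇h|²`, and `h_ccc` once; the differentiated equation `∑ (L - lam_i) h_iic = 0` says that
`∑ lam_i h_iic` is `L` times the derivative of the trace. -/
theorem sum_sq_sub_sum_trace_sq (h : AdaptedFrame x w φ ν A b lam) {L : ℝ} (hL0 : 0 < L)
    (hL : ∑ i, lam i ^ 2 ≤ L ^ 2)
    (hfirst : ∀ c, ∑ i, (L - lam i) * dSecond x w φ b lam i i c = 0) :
    ∑ c, 2 * (L ^ 2 - lam c ^ 2) / (L ^ 2 + 2 * lam c ^ 2) *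
        (∑ i, dSecond x w φ b lam i i c) ^ 2 ≤
      (∑ c, ∑ i, ∑ j, dSecond x w φ b lam i j c ^ 2) -
        ∑ c, (∑ i, dSecond x w φ b lam i i c) ^ 2 := by
  set H := dSecond x w φ b lam with hH
  have h1 : ∀ c, (∑ i, H i i c ^ 2) + 2 * (∑ i, H c c i ^ 2) - 2 * H c c c ^ 2 ≤
      ∑ i, ∑ j, H i j c ^ 2 := by
    intro c
    have hrow : ∀ i, (if i = c then ∑ j, H c j c ^ 2 else H i i c ^ 2 + H i c c ^ 2) ≤
        ∑ j, H i j c ^ 2 := by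
      intro i
      split_ifs with hi
      · subst hi; rfl
      · rw [← Finset.sum_pair (f := fun j => H i j c ^ 2) hi]
        exact Finset.sum_le_sum_of_subset_of_nonneg (Finset.subset_univ _)
          fun j _ _ => sq_nonneg _
    have hsum := Finset.sum_le_sum fun i (_ : i ∈ Finset.univ) => hrow i
    have e : ∀ i, (if i = c then ∑ j, H c j c ^ 2 else H i i c ^ 2 + H i c c ^ 2) =
        H i i c ^ 2 + H c c i ^ 2 + if i = c then (∑ j, H c c j ^ 2) - 2 * H c c c ^ 2 else 0 := by
      intro i
      have e2 : ∀ j, H c j c = H c c j := fun j => h.dSecond_comm_right c j c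
      simp only [e2]
      split_ifs with hi
      · subst hi; ring
      · rw [hH, h.dSecond_comm_left i c c, h.dSecond_comm_right c i c]; ring
    simp only [e, Finset.sum_add_distrib, Finset.sum_ite_eq', Finset.mem_univ, if_true] at hsum
    linarith
  have h2 : ∑ c, ((3 * ∑ i, H i i c ^ 2) - 2 * H c c c ^ 2) ≤ ∑ c, ∑ i, ∑ j, H i j c ^ 2 := by
    refine le_trans (le_of_eq ?_) (Finset.sum_le_sum fun c (_ : c ∈ Finset.univ) => h1 c)
    simp only [Finset.sum_sub_distrib, Finset.sum_add_distrib, ← Finset.mul_sum]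
    rw [Finset.sum_comm (f := fun c i => H c c i ^ 2)]
    ring
  refine le_trans ?_ (sub_le_sub_right h2 _)
  rw [← Finset.sum_sub_distrib]
  refine Finset.sum_le_sum fun c _ => ?_
  have h3 := sum_sq_two_weights lam (fun i => H i i c) c L hL
  have h4 : ∑ i, lam i * H i i c = L * ∑ i, H i i c := by
    have := hfirst c
    simp only [sub_mul, Finset.sum_sub_distrib, ← Finset.mul_sum] at this
    linarith
  rw [h4] at h3
  have hden : 0 < L ^ 2 + 2 * lam c ^ 2 := by positivity
  rw [div_mul_eq_mul_div, div_le_iff₀ hden]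
  linarith

end AdaptedFrame

/-! ### The curvature bound at an interior maximum -/

namespace AdaptedFrame

variable {n : ℕ} {x : EuclideanSpace ℝ (Fin n)}
    {w : Fin n → EuclideanSpace ℝ (Fin n)} {φ ν : EuclideanSpace ℝ (Fin n) → ℝ}
    {A : Fin n → Fin n → EuclideanSpace ℝ (Fin n) → ℝ} {b lam : Fin n → ℝ} {σ : ℝ}

set_option maxHeartbeats 1000000 in
/-- At an interior maximum of `(tr A) ^ (n - 1) / ν ^ n` the trace of the shape operator is bounded.
In the second derivative test, weighted with the linearized operator, the terms of the highest order
in the principal curvatures have a sign because `n / (n - 1) > 1`, and what is left is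
`L / 5 ≤ 2 n²` for `L = ∑ lam` large. -/
theorem trace_le_of_isLocalMax (h : AdaptedFrame x w φ ν A b lam) (hn : 3 ≤ n) (hσ0 : 0 < σ)
    (hσν : σ ≤ ν x) (hL : 0 < ∑ i, lam i)
    (hs : ∀ᶠ y in 𝓝 x, (∑ i, A i i y) * (∑ i, A i i y) + (-1) * ∑ i, ∑ j, A i j y * A j i y =
      n * (n - 1) * σ ^ 2)
    (hmax : IsLocalMax (fun y => (n - 1 : ℝ) * Real.log (∑ i, A i i y) +
      (-n : ℝ) * Real.log (ν y)) x) :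
    ∑ i, lam i ≤ 20 * n / σ + 10 * n ^ 2 := by
  by_contra! hbig
  have hν := h.angle_pos
  have hν1 := h.angle_le_one
  have hsum := h.sum_angle_second hs
  have hsimons := h.sum_trace_second hs
  have hfirst := fun c => (h.second_symm_first hs c).1
  have hS := h.second_symm_value.symm.trans hs.self_of_nhds
  have hnR : (3:ℝ) ≤ n := by exact_mod_cast hn
  -- The first and second derivative tests in the direction `c`.
  have hjet : ∀ c, (n - 1) * ∑ i, dSecond x w φ b lam i i c =
        -n * (∑ i, lam i) * (b c * (lam c - 1)) ∧
      (n - 1) * (dd (w c) (dd (w c) (fun y => ∑ i, A i i y)) x / (ν x * ∑ i, lam i) -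
        ((∑ i, dSecond x w φ b lam i i c) / ∑ i, lam i) ^ 2) -
        n * (dd (w c) (dd (w c) ν) x / ν x - b c ^ 2 * (lam c - 1) ^ 2) ≤ 0 := by
    intro c
    have hT : ContDiffAt ℝ ∞ (fun y => ∑ i, A i i y) x :=
      ContDiffAt.sum fun i _ => h.smooth_shape i i
    have hT0 : ∑ i, A i i x ≠ 0 := by rw [h.trace_value]; positivity
    have hJ : HasJet (w c) x (fun y => (n - 1 : ℝ) * Real.log (∑ i, A i i y) +
      (-n : ℝ) * Real.log (ν y)) _ _ _ :=
      ((HasJet.const _).mul ⟨hT.log hT0, rfl, dd_log hT.differentiableAt_infty hT0,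
        dd_dd_log hT hT0⟩).add ((HasJet.const _).mul ⟨h.smooth_angle.log hν.ne', rfl,
          dd_log h.smooth_angle.differentiableAt_infty hν.ne', dd_dd_log h.smooth_angle hν.ne'⟩)
    have h1 := dd_eq_zero_of_isLocalMax (v := w c) hmax
    have h2 := dd_dd_nonpos_of_isLocalMax (v := w c) (hJ.smooth.of_le (by norm_cast)) hmax
    rw [hJ.first] at h1
    rw [hJ.second] at h2
    rw [h.trace_first, h.trace_value, (h.jet_angle c).1] at h1 h2
    constructor
    · field_simp at h1
      linear_combination h1
    · refine le_trans (le_of_eq ?_) h2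
      field_simp
      ring
  set L := ∑ j, lam j with hLdef
  have hcs : ∑ i, lam i ^ 2 < L ^ 2 := by
    have hn1 : (0:ℝ) < n - 1 := by linarith
    have hspos : 0 < (n:ℝ) * (n - 1) * σ ^ 2 := by positivity
    by_contra! hc
    have := mul_nonneg (sq_nonneg (ν x)) (sub_nonneg.2 hc)
    linarith
  have habs := fun c => abs_lt_sum hL hcs c
  have hf : ∀ c, 0 < L - lam c := fun c => by
    have := (abs_lt.1 (habs c)).2; linarith
  set q := ∑ i, lam i ^ 2 with hq
  have hP : ∑ c, (L - lam c) = (n - 1) * L := sum_coeff lam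
  have hs' : ∑ c, (L - lam c) * lam c = L ^ 2 - q := sum_coeff_mul lam
  have hH := h.sum_sq_sub_sum_trace_sq hL hcs.le hfirst
  set HH := ∑ c, ∑ i, ∑ j, dSecond x w φ b lam i j c ^ 2
  obtain ⟨T, hTdef⟩ : ∃ T : Fin n → ℝ, ∀ c, ∑ i, dSecond x w φ b lam i i c = T c :=
    ⟨_, fun _ => rfl⟩
  simp only [hTdef] at hsimons hH hjet
  clear_value L q HH
  have hn1 : (0:ℝ) < n - 1 := by linarith
  set N : ℝ := n / (n - 1) with hNdef
  have hN : N * (n - 1) = n := by rw [hNdef]; field_simp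
  have hN0 : 0 < N := by rw [hNdef]; positivity
  have hT : ∀ c, T c = -N * L * (b c * (lam c - 1)) := by
    intro c
    have := (hjet c).1
    apply mul_left_cancel₀ hn1.ne'
    linear_combination this + L * (b c * (lam c - 1)) * hN
  set R := ∑ c, (L - lam c) * lam c ^ 2 with hR
  set Z := ∑ i, b i ^ 2 * lam i with hZ
  have hSS : ∑ c, ∑ a, (L - lam c) * ((lam c - lam a) * (1 - ν x ^ 2 * lam a * lam c)) =
      n * (L ^ 2 - q) - L * ((n - 1) * L) - ν x ^ 2 * (L * R - q * (L ^ 2 - q)) := by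
    have e : ∀ c, ∑ a, (L - lam c) * ((lam c - lam a) * (1 - ν x ^ 2 * lam a * lam c)) =
        n * ((L - lam c) * lam c) - L * (L - lam c) - ν x ^ 2 * (L * ((L - lam c) * lam c ^ 2) -
          q * ((L - lam c) * lam c)) := by
      intro c
      have e1 : ∀ a, (L - lam c) * ((lam c - lam a) * (1 - ν x ^ 2 * lam a * lam c)) =
          (L - lam c) * lam c - (L - lam c) * lam a - ν x ^ 2 * (L - lam c) * lam c ^ 2 * lam a +
          ν x ^ 2 * (L - lam c) * lam c * lam a ^ 2 := fun a => by ring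
      simp only [e1, Finset.sum_add_distrib, Finset.sum_sub_distrib, ← Finset.mul_sum,
        Finset.sum_const, Finset.card_univ, Fintype.card_fin, nsmul_eq_mul]
      rw [← hLdef, ← hq]
      ring
    rw [← hs', ← hP, hR]
    simp only [e, Finset.mul_sum, ← Finset.sum_sub_distrib]
  have hbT : ∑ c, b c * T c = -N * L * (Z - (1 - ν x ^ 2)) := by
    rw [← h.sum_sq, hZ, ← Finset.sum_sub_distrib, Finset.mul_sum]
    exact Finset.sum_congr rfl fun c _ => by rw [hT]; ring
  -- The second derivative tests, weighted with the coefficients of the linearized operator.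
  have hmain : (∑ c, (L - lam c) * dd (w c) (dd (w c) (fun y => ∑ i, A i i y)) x) / (ν x * L) -
      (∑ c, (L - lam c) * (T c / L) ^ 2) -
      N * ((∑ c, (L - lam c) * dd (w c) (dd (w c) ν) x) / ν x -
        ∑ c, (L - lam c) * (b c ^ 2 * (lam c - 1) ^ 2)) ≤ 0 := by
    rw [Finset.sum_div, Finset.sum_div, ← Finset.sum_sub_distrib, ← Finset.sum_sub_distrib,
      Finset.mul_sum, ← Finset.sum_sub_distrib]
    refine Finset.sum_nonpos fun c _ => ?_
    have h2 := (hjet c).2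
    have h3 : dd (w c) (dd (w c) (fun y => ∑ i, A i i y)) x / (ν x * L) - (T c / L) ^ 2 -
        N * (dd (w c) (dd (w c) ν) x / ν x - b c ^ 2 * (lam c - 1) ^ 2) ≤ 0 := by
      refine nonpos_of_mul_nonpos_right ?_ hn1
      refine le_trans (le_of_eq ?_) h2
      rw [mul_sub (n - 1 : ℝ) _ (N * _), ← mul_assoc, mul_comm _ N, hN]
    refine le_trans (le_of_eq ?_) (mul_nonpos_of_nonneg_of_nonpos (hf c).le h3)
    ring
  rw [hsum, hsimons, hSS, hbT, hP, hs', mul_div_mul_left _ _ hν.ne', mul_div_cancel_left₀ _ hν.ne']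
    at hmain
  have hLbig : 10 ≤ L ∧ 20 * n ≤ σ * L := by
    have h1 : 0 ≤ 20 * n / σ := by positivity
    have h2 : (9:ℝ) ≤ n ^ 2 := by nlinarith only [hnR]
    constructor
    · linarith
    · have : 20 * n / σ ≤ L := by linarith
      rw [div_le_iff₀ hσ0] at this
      linarith
  have hdir : ∀ c, b c ^ 2 * -(4 / 5 * L) - ν x ^ 2 / (n - 1) * ((L - lam c) * lam c ^ 2) ≤
      (2 * (L ^ 2 - lam c ^ 2) / (L ^ 2 + 2 * lam c ^ 2) * T c ^ 2) / L -
      (L - lam c) * (T c / L) ^ 2 - 2 * ((L - lam c) * (b c * T c)) / L +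
      N * ((L - lam c) * (b c ^ 2 * (lam c - 1) ^ 2)) := by
    intro c
    -- The Cauchy-Schwarz inequality for the other eigenvalues, and `∑ lam² ≤ L²`.
    have hlow : L - lam c ≤ (n - 1) * (L + lam c) := by
      have h1 : (L - lam c) ^ 2 ≤ (n - 1) * (q - lam c ^ 2) := by
        have h2 := sq_sum_le_card_mul_sum_sq (s := Finset.univ.erase c) (f := lam)
        rw [Finset.sum_erase_eq_sub (Finset.mem_univ c),
          Finset.sum_erase_eq_sub (Finset.mem_univ c),
          Finset.card_erase_of_mem (Finset.mem_univ c), Finset.card_univ, Fintype.card_fin,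
          Nat.cast_sub (by omega), Nat.cast_one] at h2
        rw [hLdef, hq]
        exact h2
      have h3 : (L - lam c) * (L - lam c) ≤ (L - lam c) * ((n - 1) * (L + lam c)) := by
        have : (n - 1) * (q - lam c ^ 2) ≤ (n - 1 : ℝ) * (L ^ 2 - lam c ^ 2) :=
          mul_le_mul_of_nonneg_left (by linarith) hn1.le
        linarith
      exact le_of_mul_le_mul_left h3 (hf c)
    have h1 := single_direction_bound hnR hN hσ0 hσν hL (by linarith [hf c]) hlow hLbig.1 hLbig.2
    have h2 := mul_le_mul_of_nonneg_left h1 (sq_nonneg (b c))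
    have hb1 : b c ^ 2 ≤ 1 := by
      have h3 := h.angle_sq
      have h4 : b c ^ 2 ≤ ∑ i, b i ^ 2 :=
        Finset.single_le_sum (f := fun i => b i ^ 2) (fun i _ => sq_nonneg _) (Finset.mem_univ c)
      linarith [sq_nonneg (ν x)]
    have h3 : b c ^ 2 * (ν x ^ 2 / (n - 1) * (L - lam c) * lam c ^ 2) ≤
        1 * (ν x ^ 2 / (n - 1) * (L - lam c) * lam c ^ 2) := by
      have := hf c
      exact mul_le_mul_of_nonneg_right hb1 (by positivity)
    rw [hT c]
    have hden : 0 < L ^ 2 + 2 * lam c ^ 2 := by positivity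
    refine le_trans (by linarith) (h2.trans (le_of_eq ?_))
    field_simp
    ring
  have hdirs := Finset.sum_le_sum fun c (_ : c ∈ Finset.univ) => hdir c
  simp only [Finset.sum_add_distrib, Finset.sum_sub_distrib, ← Finset.sum_mul, ← Finset.mul_sum,
    ← Finset.sum_div] at hdirs
  rw [← hR] at hdirs
  have hb : ∑ c, b c ^ 2 ≤ 1 := by
    have h3 := h.angle_sq
    linarith [sq_nonneg (ν x)]
  have hbL : -(4 / 5 * L) ≤ (∑ c, b c ^ 2) * -(4 / 5 * L) := by
    have := mul_le_mul_of_nonneg_right hb hL.le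
    linarith
  have hH' := div_le_div_of_nonneg_right hH hL.le
  have hNP : N * ((n - 1) * L) = n * L := by rw [← mul_assoc, hN]
  have hNR : N * ν x ^ 2 * R = ν x ^ 2 * R + ν x ^ 2 / (n - 1) * R := by
    rw [hNdef]; field_simp; ring
  have hq0 : 0 ≤ q := hq ▸ Finset.sum_nonneg fun i _ => sq_nonneg _
  have hs0 : 0 < L ^ 2 - q := by linarith
  have hpos : 0 ≤ (n * (L ^ 2 - q) + ν x ^ 2 * (q * (L ^ 2 - q))) / L := by positivity
  have hfinal : L / 5 ≤ N * (L ^ 2 - q) * (1 + ν x ^ 2) := by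
    have e : ∀ a d t : ℝ, (a - d + (n * (L ^ 2 - q) - L * ((n - 1) * L) -
        ν x ^ 2 * (L * R - q * (L ^ 2 - q))) - 2 * t +
        (L ^ 2 - q) * (-N * L * (Z - (1 - ν x ^ 2)))) / L =
        (a - d) / L + (n * (L ^ 2 - q) + ν x ^ 2 * (q * (L ^ 2 - q))) / L - (n - 1) * L -
        ν x ^ 2 * R - 2 * t / L - (L ^ 2 - q) * N * (Z - (1 - ν x ^ 2)) := by
      intro a d t
      field_simp
      ring
    rw [e] at hmain
    linarith
  have hsν : (L ^ 2 - q) * σ ^ 2 ≤ n * (n - 1) * σ ^ 2 := by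
    rw [← hS, mul_comm]
    have : σ ^ 2 ≤ ν x ^ 2 := pow_le_pow_left₀ hσ0.le hσν 2
    exact mul_le_mul_of_nonneg_right this hs0.le
  have hs1 : L ^ 2 - q ≤ n * (n - 1) := le_of_mul_le_mul_right hsν (by positivity)
  have h6 : N * (L ^ 2 - q) * (1 + ν x ^ 2) ≤ N * (n * (n - 1)) * 2 := by
    have : ν x ^ 2 ≤ 1 := pow_le_one₀ hν.le hν1
    gcongr
    linarith
  have h7 : N * (n * (n - 1)) * 2 = 2 * n ^ 2 := by
    rw [mul_left_comm, hN]; ring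
  have h8 : 0 ≤ 20 * n / σ := by positivity
  linarith

end AdaptedFrame

/-! ### Symmetric functions and simultaneous diagonalization -/

theorem two_mul_esymm_two {R : Type*} [CommRing R] (s : Multiset R) :
    2 * s.esymm 2 = s.sum ^ 2 - (s.map fun a => a ^ 2).sum := by
  induction s using Multiset.induction_on with
  | empty => simp [Multiset.esymm, Multiset.powersetCard_zero_right]
  | cons a s ih =>
    have h : (a ::ₘ s).esymm 2 = s.esymm 2 + a * s.sum := by
      have h1 : (s.map fun b => a * b).sum = a * s.sum := by
        rw [Multiset.sum_map_mul_left, Multiset.map_id']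
      simp [Multiset.esymm, Multiset.powersetCard_cons, Multiset.powersetCard_one, h1]
    rw [h, mul_add, ih]
    simp
    ring

theorem esymm_one_eq_sum {R : Type*} [CommRing R] (s : Multiset R) : s.esymm 1 = s.sum := by
  simp [Multiset.esymm, Multiset.powersetCard_one]

theorem vecMulVec_self_mul_self {n : ℕ} (p : Fin n → ℝ) :
    Matrix.vecMulVec p p * Matrix.vecMulVec p p = (∑ i, p i ^ 2) • Matrix.vecMulVec p p := by
  rw [Matrix.vecMulVec_mul_vecMulVec]
  ext i j
  simp [Matrix.vecMulVec_apply, dotProduct, sq]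
  ring

theorem one_add_vecMulVec_mul_inv {n : ℕ} {p : Fin n → ℝ} {ν : ℝ}
    (hp : ν ^ 2 * (1 + ∑ i, p i ^ 2) = 1) :
    (1 + Matrix.vecMulVec p p) * (1 - ν ^ 2 • Matrix.vecMulVec p p) = 1 := by
  have h1 := vecMulVec_self_mul_self p
  set P := Matrix.vecMulVec p p
  have : (1 + P) * (1 - ν ^ 2 • P) = 1 + (1 - ν ^ 2) • P - ν ^ 2 • (P * P) := by
    rw [add_mul, one_mul, mul_sub, mul_one, mul_smul_comm, sub_smul, one_smul]; abel
  rw [this, h1, smul_smul, add_sub_assoc, ← sub_smul]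
  have e : 1 - ν ^ 2 - ν ^ 2 * ∑ i, p i ^ 2 = 0 := by linear_combination -hp
  rw [e, zero_smul, add_zero]

/-- A symmetric matrix can be diagonalized by a congruence which takes `1 + p pᵀ` to the identity.
The inverse square root of `1 + p pᵀ` is `1 - (ν² / (1 + ν)) p pᵀ` with `ν² = 1 / (1 + |p|²)`. -/
theorem exists_simultaneous_diagonalization {n : ℕ} {p : Fin n → ℝ} {ν : ℝ} (hν : 0 < ν)
    (hp : ν ^ 2 * (1 + ∑ i, p i ^ 2) = 1) {Q : Matrix (Fin n) (Fin n) ℝ} (hQ : Q.IsSymm) :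
    ∃ (V : Matrix (Fin n) (Fin n) ℝ) (μ : Fin n → ℝ),
      Vᵀ * (1 + Matrix.vecMulVec p p) * V = 1 ∧ Vᵀ * Q * V = Matrix.diagonal μ := by
  have h1 := vecMulVec_self_mul_self p
  have hsymm : (Matrix.vecMulVec p p)ᵀ = Matrix.vecMulVec p p := Matrix.transpose_vecMulVec p p
  set P := Matrix.vecMulVec p p
  set s := ∑ i, p i ^ 2
  set c := ν ^ 2 / (1 + ν) with hc
  have hW : (1 - c • P)ᵀ * (1 + P) * (1 - c • P) = 1 := by
    have e1 : (1 - c • P)ᵀ = 1 - c • P := by simp [hsymm]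
    have e2 : (1 - c • P) * (1 + P) * (1 - c • P) =
        1 + (1 - 2 * c) • P + (c ^ 2 - 2 * c) • (P * P) + c ^ 2 • (P * (P * P)) := by
      simp only [sub_mul, mul_sub, add_mul, mul_add, one_mul, mul_one, smul_mul_assoc,
        mul_smul_comm, smul_smul, smul_add, smul_sub, mul_assoc]
      module
    rw [e1, e2, h1, mul_smul_comm, h1, smul_smul, smul_smul, smul_smul, add_assoc, add_assoc,
      ← add_smul, ← add_smul]
    have e3 : 1 - 2 * c + ((c ^ 2 - 2 * c) * s + c ^ 2 * s * s) = 0 := by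
      have hs : s = 1 / ν ^ 2 - 1 := by
        field_simp; linear_combination hp
      rw [hs, hc]
      field_simp
      ring
    rw [e3, zero_smul, add_zero]
  set W := 1 - c • P
  have hH : (Wᵀ * Q * W).IsHermitian := by
    unfold Matrix.IsHermitian
    rw [Matrix.conjTranspose_eq_transpose_of_trivial]
    simp only [Matrix.transpose_mul, Matrix.transpose_transpose, hQ.eq, Matrix.mul_assoc]
  set U : Matrix (Fin n) (Fin n) ℝ := (hH.eigenvectorUnitary : Matrix (Fin n) (Fin n) ℝ) with hU
  have hUU : Uᵀ * U = 1 := by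
    have := Unitary.coe_star_mul_self hH.eigenvectorUnitary
    rwa [Matrix.star_eq_conjTranspose, Matrix.conjTranspose_eq_transpose_of_trivial] at this
  have hspec : Wᵀ * Q * W = U * Matrix.diagonal hH.eigenvalues * Uᵀ := by
    have := hH.spectral_theorem
    rw [Unitary.conjStarAlgAut_apply, Matrix.star_eq_conjTranspose,
      Matrix.conjTranspose_eq_transpose_of_trivial] at this
    exact this
  refine ⟨W * U, hH.eigenvalues, ?_, ?_⟩
  · calc (W * U)ᵀ * (1 + P) * (W * U) = Uᵀ * (Wᵀ * (1 + P) * W) * U := by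
          simp only [Matrix.transpose_mul, Matrix.mul_assoc]
      _ = 1 := by rw [hW, Matrix.mul_one, hUU]
  · calc (W * U)ᵀ * Q * (W * U) = Uᵀ * (Wᵀ * Q * W) * U := by
          simp only [Matrix.transpose_mul, Matrix.mul_assoc]
      _ = (Uᵀ * U) * Matrix.diagonal hH.eigenvalues * (Uᵀ * U) := by
          refine (congrArg (fun Y => Uᵀ * Y * U) hspec).trans ?_
          simp only [Matrix.mul_assoc]
      _ = _ := by rw [hUU, Matrix.one_mul, Matrix.mul_one]

/-! ### The shape operator of a graph -/

/-- The Euclidean gradient of `u`, as a vector of partial derivatives. -/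
noncomputable def gradVec {n : ℕ} (u : EuclideanSpace ℝ (Fin n) → ℝ)
    (x : EuclideanSpace ℝ (Fin n)) : Fin n → ℝ :=
  fun i => pderiv i u x

/-- The vertical component `1 / w` of the Euclidean upward unit normal. -/
noncomputable def angle {n : ℕ} (u : EuclideanSpace ℝ (Fin n) → ℝ)
    (x : EuclideanSpace ℝ (Fin n)) : ℝ :=
  1 / slopeFactor u x

/-- The matrix `δ_ij + u_i u_j + u u_ij`, the second fundamental form up to the factor `u² w`. It is
also the Hessian of `(u² + |x|²) / 2`. -/
noncomputable def secondMat {n : ℕ} (u : EuclideanSpace ℝ (Fin n) → ℝ)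
    (x : EuclideanSpace ℝ (Fin n)) : Matrix (Fin n) (Fin n) ℝ :=
  1 + Matrix.vecMulVec (gradVec u x) (gradVec u x) +
    u x • Matrix.of fun i j => pderiv i (pderiv j u) x

/-- The shape operator of the graph in the coordinates of the base, given by a formula that remains
meaningful at height `0`. -/
noncomputable def shapeMat {n : ℕ} (u : EuclideanSpace ℝ (Fin n) → ℝ)
    (x : EuclideanSpace ℝ (Fin n)) : Matrix (Fin n) (Fin n) ℝ :=
  angle u x • ((1 - angle u x ^ 2 • Matrix.vecMulVec (gradVec u x) (gradVec u x)) * secondMat u x)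

section Graph

variable {n : ℕ} {u : EuclideanSpace ℝ (Fin n) → ℝ} {x : EuclideanSpace ℝ (Fin n)}

theorem slopeFactor_pos (u : EuclideanSpace ℝ (Fin n) → ℝ) (x : EuclideanSpace ℝ (Fin n)) :
    0 < slopeFactor u x :=
  Real.sqrt_pos.2 (add_pos_of_pos_of_nonneg one_pos (Finset.sum_nonneg fun _ _ => sq_nonneg _))

theorem slopeFactor_sq (u : EuclideanSpace ℝ (Fin n) → ℝ) (x : EuclideanSpace ℝ (Fin n)) :
    slopeFactor u x ^ 2 = 1 + ∑ i, pderiv i u x ^ 2 :=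
  Real.sq_sqrt (add_nonneg zero_le_one (Finset.sum_nonneg fun _ _ => sq_nonneg _))

theorem angle_pos (u : EuclideanSpace ℝ (Fin n) → ℝ) (x : EuclideanSpace ℝ (Fin n)) :
    0 < angle u x := one_div_pos.2 (slopeFactor_pos u x)

theorem angle_sq_mul (u : EuclideanSpace ℝ (Fin n) → ℝ) (x : EuclideanSpace ℝ (Fin n)) :
    angle u x ^ 2 * (1 + ∑ i, gradVec u x i ^ 2) = 1 := by
  unfold angle gradVec
  rw [← slopeFactor_sq]
  have := slopeFactor_pos u x
  field_simp

theorem angle_le_one (u : EuclideanSpace ℝ (Fin n) → ℝ) (x : EuclideanSpace ℝ (Fin n)) :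
    angle u x ≤ 1 := by
  have h1 := angle_sq_mul u x
  have h2 : 0 ≤ ∑ i, gradVec u x i ^ 2 := Finset.sum_nonneg fun i _ => sq_nonneg _
  have h3 := angle_pos u x
  nlinarith [mul_nonneg (sq_nonneg (angle u x)) h2]

theorem tangentVec_castSucc (u : EuclideanSpace ℝ (Fin n) → ℝ) (i k : Fin n)
    (x : EuclideanSpace ℝ (Fin n)) :
    tangentVec (graphMap u) i x k.castSucc = if i = k then 1 else 0 := by
  unfold tangentVec graphMap pderiv
  simp only [Fin.snoc_castSucc]
  have : (fun z : EuclideanSpace ℝ (Fin n) => z k) = EuclideanSpace.proj (𝕜 := ℝ) k := rfl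
  rw [this, ContinuousLinearMap.fderiv]
  simp [eq_comm]

theorem tangentVec_last (u : EuclideanSpace ℝ (Fin n) → ℝ) (i : Fin n)
    (x : EuclideanSpace ℝ (Fin n)) :
    tangentVec (graphMap u) i x (Fin.last n) = pderiv i u x := by
  unfold tangentVec graphMap
  simp only [Fin.snoc_last]

theorem sum_tangentVec (u : EuclideanSpace ℝ (Fin n) → ℝ) (i j : Fin n)
    (x : EuclideanSpace ℝ (Fin n)) :
    ∑ a, tangentVec (graphMap u) i x a * tangentVec (graphMap u) j x a =
      (if i = j then 1 else 0) + pderiv i u x * pderiv j u x := by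
  rw [Fin.sum_univ_castSucc]
  simp [tangentVec_castSucc, tangentVec_last]

theorem sum_christoffel (p v w : Fin (n + 1) → ℝ) (c : Fin (n + 1)) :
    ∑ a, ∑ b, christoffel p a b c * v a * w b = (1 / p (Fin.last n)) *
      (-(v (Fin.last n) * w c) - v c * w (Fin.last n) +
        if c = Fin.last n then ∑ a, v a * w a else 0) := by
  unfold christoffel
  have e : ∀ a b, 1 / p (Fin.last n) * (-(if b = c ∧ a = Fin.last n then 1 else 0) -
      (if a = c ∧ b = Fin.last n then 1 else 0) +
      (if a = b ∧ c = Fin.last n then 1 else 0)) * v a * w b =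
      (1 / p (Fin.last n)) * ((-(if a = Fin.last n then (if b = c then v a * w b else 0) else 0) -
      (if a = c then (if b = Fin.last n then v a * w b else 0) else 0)) +
      (if c = Fin.last n then (if a = b then v a * w b else 0) else 0)) := by
    intro a b
    simp only [ite_and]
    split_ifs <;> ring
  simp only [e, ← Finset.mul_sum, Finset.sum_add_distrib, Finset.sum_sub_distrib,
    Finset.sum_neg_distrib]
  congr 1
  congr 1
  · congr 1
    · congr 1
      rw [Finset.sum_comm]; simp
    · rw [Finset.sum_comm]; simp
  · split_ifs <;> simp

/-- The horizontal part of `∇_{X_i} X_j`. Since `X_j` has constant horizontal part, only Christoffel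
symbols contribute. -/
theorem covDeriv_castSucc (u : EuclideanSpace ℝ (Fin n) → ℝ) (i j k : Fin n)
    (x : EuclideanSpace ℝ (Fin n)) :
    covDeriv (graphMap u) i j x k.castSucc = (1 / u x) *
      (-(pderiv i u x * if j = k then 1 else 0) - (if i = k then 1 else 0) * pderiv j u x) := by
  unfold covDeriv
  rw [sum_christoffel]
  simp only [tangentVec_castSucc, tangentVec_last]
  have h1 : pderiv i (fun _ => if j = k then (1:ℝ) else 0) x = 0 := by simp [pderiv]
  have h2 : k.castSucc ≠ Fin.last n := (Fin.castSucc_lt_last k).ne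
  rw [h1, if_neg h2]
  simp [graphMap]

theorem covDeriv_last (u : EuclideanSpace ℝ (Fin n) → ℝ) (i j : Fin n)
    (x : EuclideanSpace ℝ (Fin n)) :
    covDeriv (graphMap u) i j x (Fin.last n) = pderiv i (pderiv j u) x + (1 / u x) *
      ((if i = j then 1 else 0) - pderiv i u x * pderiv j u x) := by
  unfold covDeriv
  rw [sum_christoffel, sum_tangentVec]
  simp only [tangentVec_last, if_true]
  have : graphMap u x (Fin.last n) = u x := by simp [graphMap]
  rw [this]
  have : pderiv i (fun z => pderiv j u z) x = pderiv i (pderiv j u) x := rfl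
  rw [this]
  ring

theorem firstForm_graph (u : EuclideanSpace ℝ (Fin n) → ℝ) (x : EuclideanSpace ℝ (Fin n)) :
    firstForm (graphMap u) x =
      (1 / u x ^ 2) • (1 + Matrix.vecMulVec (gradVec u x) (gradVec u x)) := by
  ext i j
  simp only [firstForm, hypInner, Matrix.of_apply, sum_tangentVec]
  simp [graphMap, Matrix.vecMulVec_apply, gradVec, Matrix.one_apply]
  ring

theorem secondForm_graph (hu : u x ≠ 0) :
    secondForm (graphMap u) (upNormal u) x = (angle u x / u x ^ 2) • secondMat u x := by
  ext i j
  simp only [secondForm, hypInner, Matrix.of_apply]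
  rw [Fin.sum_univ_castSucc]
  simp only [covDeriv_castSucc, covDeriv_last]
  simp only [upNormal, Fin.snoc_castSucc, Fin.snoc_last]
  have hw := (slopeFactor_pos u x).ne'
  have e : ∑ k : Fin n, 1 / u x * (-(pderiv i u x * if j = k then 1 else 0) -
      (if i = k then 1 else 0) * pderiv j u x) * (u x * (-pderiv k u x / slopeFactor u x)) =
      2 * pderiv i u x * pderiv j u x / slopeFactor u x := by
    have e1 : ∀ k : Fin n, 1 / u x * (-(pderiv i u x * if j = k then 1 else 0) -
      (if i = k then 1 else 0) * pderiv j u x) * (u x * (-pderiv k u x / slopeFactor u x)) =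
      (if j = k then pderiv i u x * pderiv k u x / slopeFactor u x else 0) +
      (if i = k then pderiv j u x * pderiv k u x / slopeFactor u x else 0) := by
      intro k
      split_ifs <;> field_simp <;> ring
    simp only [e1, Finset.sum_add_distrib, Finset.sum_ite_eq, Finset.mem_univ, if_true]
    ring
  rw [e]
  have h2 : graphMap u x (Fin.last n) = u x := by simp [graphMap]
  rw [h2]
  simp only [secondMat, angle, Matrix.smul_apply, Matrix.add_apply, Matrix.vecMulVec_apply,
    Matrix.of_apply, Matrix.one_apply, gradVec, smul_eq_mul]
  field_simp
  ring

theorem one_add_vecMulVec_mul_shapeMat (u : EuclideanSpace ℝ (Fin n) → ℝ)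
    (x : EuclideanSpace ℝ (Fin n)) :
    (1 + Matrix.vecMulVec (gradVec u x) (gradVec u x)) * shapeMat u x =
      angle u x • secondMat u x := by
  unfold shapeMat
  rw [mul_smul_comm, ← mul_assoc, one_add_vecMulVec_mul_inv (angle_sq_mul u x), one_mul]

/-- The powers of the height cancel between `g⁻¹` and `h`. -/
theorem shapeOperator_eq_shapeMat (hu : u x ≠ 0) :
    (firstForm (graphMap u) x)⁻¹ * secondForm (graphMap u) (upNormal u) x = shapeMat u x := by
  have h : firstForm (graphMap u) x * (u x ^ 2 • (1 - angle u x ^ 2 •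
      Matrix.vecMulVec (gradVec u x) (gradVec u x))) = 1 := by
    rw [firstForm_graph, smul_mul_smul_comm, one_add_vecMulVec_mul_inv (angle_sq_mul u x)]
    rw [one_div, inv_mul_cancel₀ (pow_ne_zero 2 hu), one_smul]
  rw [Matrix.inv_eq_right_inv h, secondForm_graph hu, shapeMat, smul_mul_smul_comm]
  congr 1
  field_simp

theorem secondMat_isSymm (hu : ContDiffAt ℝ 2 u x) : (secondMat u x).IsSymm := by
  ext i j
  have h : pderiv i (pderiv j u) x = pderiv j (pderiv i u) x := dd_comm hu
  simp only [secondMat, Matrix.transpose_apply, Matrix.add_apply, Matrix.smul_apply,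
    Matrix.of_apply, Matrix.vecMulVec_apply, Matrix.one_apply, h]
  rw [mul_comm (gradVec u x j)]
  simp only [eq_comm (a := j)]

/-- At each point there is a basis orthonormal for `1 + Du Duᵀ` in which the second fundamental form
is diagonal. -/
theorem exists_principal_basis (hu : ContDiffAt ℝ 2 u x) :
    ∃ (V : Matrix (Fin n) (Fin n) ℝ) (μ : Fin n → ℝ),
      Vᵀ * (1 + Matrix.vecMulVec (gradVec u x) (gradVec u x)) * V = 1 ∧
      Vᵀ * secondMat u x * V = Matrix.diagonal μ ∧ IsUnit V.det ∧
      V⁻¹ * shapeMat u x * V = angle u x • Matrix.diagonal μ := by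
  obtain ⟨V, μ, h1, h2⟩ := exists_simultaneous_diagonalization (angle_pos u x) (angle_sq_mul u x)
    (secondMat_isSymm hu)
  have hV : IsUnit V.det := by
    have := congrArg Matrix.det h1
    rw [Matrix.det_mul, Matrix.det_one] at this
    exact IsUnit.of_mul_eq_one_right _ this
  refine ⟨V, μ, h1, h2, hV, ?_⟩
  have h3 : Vᵀ * (1 + Matrix.vecMulVec (gradVec u x) (gradVec u x)) = V⁻¹ := by
    exact (Matrix.inv_eq_left_inv h1).symm
  rw [← h3, Matrix.mul_assoc Vᵀ, one_add_vecMulVec_mul_shapeMat, Matrix.mul_smul,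
    Matrix.smul_mul, h2]

theorem principalCurvatures_eq (hu : u x ≠ 0) {V : Matrix (Fin n) (Fin n) ℝ} {μ : Fin n → ℝ}
    (hV : IsUnit V.det) (h : V⁻¹ * shapeMat u x * V = angle u x • Matrix.diagonal μ) :
    principalCurvatures u x = Finset.univ.val.map fun i => angle u x * μ i := by
  unfold principalCurvatures
  rw [shapeOperator_eq_shapeMat hu]
  obtain ⟨W, hW⟩ := (Matrix.isUnit_iff_isUnit_det V).2 hV
  have h1 := Matrix.charpoly_units_conj' W (shapeMat u x)
  rw [hW, h] at h1
  rw [← h1, ← Matrix.diagonal_smul, Matrix.charpoly_diagonal]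
  have h2 : ∏ i, (Polynomial.X - Polynomial.C ((angle u x • μ) i)) =
      ((Finset.univ.val.map fun i => angle u x * μ i).map
        fun a => Polynomial.X - Polynomial.C a).prod := by
    rw [Multiset.map_map, Finset.prod_eq_multiset_prod]
    simp only [Pi.smul_apply, smul_eq_mul, Function.comp_apply]
  rw [h2, Polynomial.roots_multiset_prod_X_sub_C]

end Graph

/-! ### Existence of adapted frames -/

section Frame

variable {n : ℕ} {u : EuclideanSpace ℝ (Fin n) → ℝ} {x : EuclideanSpace ℝ (Fin n)}

theorem dd_eq_sum_pderiv (v : EuclideanSpace ℝ (Fin n)) (f : EuclideanSpace ℝ (Fin n) → ℝ)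
    (x : EuclideanSpace ℝ (Fin n)) : dd v f x = ∑ k, v k * pderiv k f x := by
  unfold dd pderiv
  have hv : v = ∑ k, v k • EuclideanSpace.single k (1:ℝ) := by
    ext i
    simp [Pi.single_apply]
  conv_lhs => rw [hv]
  simp

theorem contDiffAt_pderiv {m k : WithTop ℕ∞} (hu : ContDiffAt ℝ k u x) (h : m + 1 ≤ k) (i : Fin n) :
    ContDiffAt ℝ m (pderiv i u) x := contDiffAt_dd hu h

theorem contDiffAt_angle {m k : WithTop ℕ∞} (hu : ContDiffAt ℝ k u x) (h : m + 1 ≤ k) :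
    ContDiffAt ℝ m (angle u) x := by
  have h1 : ContDiffAt ℝ m (fun y => 1 + ∑ i, pderiv i u y ^ 2) x :=
    contDiffAt_const.add (ContDiffAt.sum fun i _ => (contDiffAt_pderiv hu h i).pow 2)
  have h2 : 1 + ∑ i, pderiv i u x ^ 2 ≠ 0 := by
    rw [← slopeFactor_sq]; exact (pow_pos (slopeFactor_pos u x) 2).ne'
  exact contDiffAt_const.div (h1.sqrt h2) (slopeFactor_pos u x).ne'

theorem contDiffAt_secondMat {m k : WithTop ℕ∞} (hu : ContDiffAt ℝ k u x) (h : m + 2 ≤ k)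
    (i j : Fin n) : ContDiffAt ℝ m (fun y => secondMat u y i j) x := by
  have h1 : m + 1 + 1 ≤ k := by rwa [add_assoc, one_add_one_eq_two]
  have hm : m + 1 ≤ k := le_trans (le_self_add) h1
  have hg : ∀ i, ContDiffAt ℝ m (fun y => pderiv i u y) x := fun i => contDiffAt_pderiv hu hm i
  have hh : ContDiffAt ℝ m (fun y => pderiv i (pderiv j u) y) x :=
    contDiffAt_pderiv (contDiffAt_pderiv hu h1 j) le_rfl i
  have hu' : ContDiffAt ℝ m u x := hu.of_le (le_trans le_self_add hm)
  simp only [secondMat, Matrix.add_apply, Matrix.smul_apply, Matrix.of_apply,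
    Matrix.vecMulVec_apply, gradVec, smul_eq_mul]
  exact (contDiffAt_const.add ((hg i).mul (hg j))).add (hu'.mul hh)

/-- The entries of `shapeMat u` lose two derivatives; the height may vanish. -/
theorem contDiffAt_shapeMat {m k : WithTop ℕ∞} (hu : ContDiffAt ℝ k u x) (h : m + 2 ≤ k)
    (i j : Fin n) : ContDiffAt ℝ m (fun y => shapeMat u y i j) x := by
  have h1 : m + 1 + 1 ≤ k := by rwa [add_assoc, one_add_one_eq_two]
  have hm : m + 1 ≤ k := le_trans (le_self_add) h1
  have hg : ∀ i, ContDiffAt ℝ m (fun y => pderiv i u y) x := fun i => contDiffAt_pderiv hu hm i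
  have ha : ContDiffAt ℝ m (fun y => angle u y) x := contDiffAt_angle hu hm
  simp only [shapeMat, Matrix.mul_apply, Matrix.sub_apply, Matrix.smul_apply,
    Matrix.vecMulVec_apply, gradVec, smul_eq_mul]
  exact ha.mul (ContDiffAt.sum fun l _ =>
    (contDiffAt_const.sub ((ha.pow 2).mul ((hg i).mul (hg l)))).mul
      (contDiffAt_secondMat hu h l j))

theorem vecMulVec_mulVec_transpose (V : Matrix (Fin n) (Fin n) ℝ) (p : Fin n → ℝ) :
    Matrix.vecMulVec (Vᵀ *ᵥ p) (Vᵀ *ᵥ p) = Vᵀ * Matrix.vecMulVec p p * V := by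
  rw [Matrix.mul_vecMulVec, Matrix.vecMulVec_mul, Matrix.mulVec_transpose]

theorem sum_mulVec_sq (V : Matrix (Fin n) (Fin n) ℝ) (p q : Fin n → ℝ) :
    ∑ i, (Vᵀ *ᵥ p) i * (Vᵀ *ᵥ q) i = p ⬝ᵥ (V * Vᵀ) *ᵥ q := by
  have : ∑ i, (Vᵀ *ᵥ p) i * (Vᵀ *ᵥ q) i = (Vᵀ *ᵥ p) ⬝ᵥ (Vᵀ *ᵥ q) := rfl
  rw [this, Matrix.mulVec_transpose, ← Matrix.dotProduct_mulVec, Matrix.mulVec_mulVec]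

theorem mul_transpose_eq_of_congr {V : Matrix (Fin n) (Fin n) ℝ} {p : Fin n → ℝ} {ν : ℝ}
    (hp : ν ^ 2 * (1 + ∑ i, p i ^ 2) = 1) (h1 : Vᵀ * (1 + Matrix.vecMulVec p p) * V = 1) :
    V * Vᵀ = 1 - ν ^ 2 • Matrix.vecMulVec p p := by
  have h2 : V * (Vᵀ * (1 + Matrix.vecMulVec p p)) = 1 := mul_eq_one_comm.1 h1
  have h3 := one_add_vecMulVec_mul_inv hp
  calc V * Vᵀ = V * (Vᵀ * (1 + Matrix.vecMulVec p p)) * (1 - ν ^ 2 • Matrix.vecMulVec p p) := by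
        rw [← Matrix.mul_assoc, Matrix.mul_assoc (V * Vᵀ), h3, Matrix.mul_one]
    _ = _ := by rw [h2, Matrix.one_mul]

/-- At a point of positive height, the columns of a matrix that diagonalizes the second
fundamental form, scaled by the height, are an adapted frame. The trace of the shape operator and
of its square do not depend on the frame. -/
theorem exists_adaptedFrame (hu : ContDiffAt ℝ ∞ u x) (hpos : 0 < u x) :
    ∃ (w : Fin n → EuclideanSpace ℝ (Fin n)) (A : Fin n → Fin n → EuclideanSpace ℝ (Fin n) → ℝ)
      (b lam : Fin n → ℝ),
      AdaptedFrame x w (fun y => 1 / u x * u y) (angle u) A b lam ∧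
      (∀ y, ∑ i, A i i y = (shapeMat u y).trace) ∧
      (∀ y, ∑ i, ∑ j, A i j y * A j i y = (shapeMat u y * shapeMat u y).trace) := by
  have hu2 : ContDiffAt ℝ 2 u x := hu.of_le (by norm_cast)
  obtain ⟨V, μ, h1, h2, hV, h3⟩ := exists_principal_basis hu2
  have hν := angle_pos u x
  have hνsq := angle_sq_mul u x
  have hVV := mul_transpose_eq_of_congr hνsq h1
  set p := gradVec u x with hp
  set w : Fin n → EuclideanSpace ℝ (Fin n) := fun i => u x • WithLp.toLp 2 (fun k => V k i)
  set A : Fin n → Fin n → EuclideanSpace ℝ (Fin n) → ℝ :=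
    fun i j y => (V⁻¹ * shapeMat u y * V) i j
  have hgrad : ∀ i, dd (w i) (fun y => 1 / u x * u y) = fun y => (Vᵀ *ᵥ gradVec u y) i := by
    intro i
    ext y
    rw [dd_eq_sum_pderiv]
    have : ∀ k, pderiv k (fun y => 1 / u x * u y) y = 1 / u x * pderiv k u y := by
      intro k
      unfold pderiv
      have h4 : (fun y => 1 / u x * u y) = (1 / u x) • u := rfl
      rw [h4, fderiv_const_smul_field]; rfl
    simp only [this, Matrix.mulVec, dotProduct, gradVec, Matrix.transpose_apply]
    refine Finset.sum_congr rfl fun k _ => ?_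
    simp only [w, PiLp.smul_apply, smul_eq_mul]
    field_simp
  have hcd : ∀ᶠ y in 𝓝 x, ContDiffAt ℝ 2 u y := hu2.eventually (by simp)
  have hhess : ∀ᶠ y in 𝓝 x, ∀ i j, dd (w i) (dd (w j) (fun y => 1 / u x * u y)) y =
      u x * (Vᵀ * (Matrix.of fun k l => pderiv k (pderiv l u) y) * V) i j := by
    filter_upwards [hcd] with y hy i j
    rw [hgrad j]
    have hd : ∀ l, DifferentiableAt ℝ (pderiv l u) y := fun l =>
      (contDiffAt_pderiv (m := 1) hy (by norm_num) l).differentiableAt (by simp)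
    simp only [Matrix.mulVec, dotProduct, gradVec, Matrix.transpose_apply]
    rw [dd_sum (F := fun l y => V l j * pderiv l u y)
      fun l _ => (differentiableAt_const _).fun_mul (hd l)]
    have : ∀ l, dd (w i) (fun y => V l j * pderiv l u y) y =
        ∑ k, u x * (V k i * pderiv k (pderiv l u) y * V l j) := by
      intro l
      rw [dd_mul (differentiableAt_const _) (hd l), dd_const, dd_eq_sum_pderiv, zero_mul, zero_add,
        Finset.mul_sum]
      refine Finset.sum_congr rfl fun k _ => ?_
      simp only [w, PiLp.smul_apply, smul_eq_mul]
      ring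
    simp only [this, Matrix.mul_apply, Matrix.transpose_apply, Matrix.of_apply, Finset.mul_sum,
      Finset.sum_mul]
  have hpp : ∑ i, p i ^ 2 = p ⬝ᵥ p := by simp [dotProduct, sq]
  have hdot : ∀ q : Fin n → ℝ, p ⬝ᵥ (V * Vᵀ) *ᵥ q = angle u x ^ 2 * p ⬝ᵥ q := by
    intro q
    rw [hVV, Matrix.sub_mulVec, Matrix.smul_mulVec, Matrix.one_mulVec, Matrix.vecMulVec_mulVec]
    simp only [dotProduct_sub, dotProduct_smul, smul_eq_mul]
    rw [hpp] at hνsq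
    simp only [op_smul_eq_smul, smul_eq_mul]
    linear_combination (-(p ⬝ᵥ q)) * hνsq
  refine ⟨w, A, Vᵀ *ᵥ p, μ, ?_, ?_, ?_⟩
  · constructor
    · exact contDiffAt_const.mul hu
    · exact contDiffAt_angle hu (by simp)
    · intro i j
      simp only [A, Matrix.mul_apply]
      exact ContDiffAt.sum fun k _ => (ContDiffAt.sum fun l _ => contDiffAt_const.mul
        (contDiffAt_shapeMat hu (by norm_cast) l k)).mul contDiffAt_const
    · field_simp
    · intro i
      rw [hgrad]
    · intro i j
      rw [hhess.self_of_nhds i j]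
      have e : u x • (Vᵀ * (Matrix.of fun k l => pderiv k (pderiv l u) x) * V) =
          Matrix.diagonal μ - 1 := by
        rw [← h2, ← h1, ← Matrix.sub_mul, ← Matrix.mul_sub, secondMat, add_sub_cancel_left]
        rw [Matrix.mul_smul, Matrix.smul_mul]
      have := congrFun (congrFun e i) j
      rw [Matrix.smul_apply, smul_eq_mul] at this
      rw [this, Matrix.sub_apply, Matrix.diagonal_apply, Matrix.one_apply]
      split_ifs with hij
      · rw [hij]
      · ring
    · exact hν
    · have := sum_mulVec_sq V p p
      rw [hdot] at this
      simp only [sq] at this ⊢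
      rw [this, ← hpp]
      linear_combination hνsq
    · refine Eventually.of_forall fun y => ?_
      simp only [hgrad]
      have e1 := sum_mulVec_sq V (gradVec u y) (gradVec u y)
      have e2 := sum_mulVec_sq V p (gradVec u y)
      rw [hdot] at e2
      rw [hVV, Matrix.sub_mulVec, Matrix.smul_mulVec, Matrix.one_mulVec,
        Matrix.vecMulVec_mulVec] at e1
      simp only [dotProduct_sub, dotProduct_smul, smul_eq_mul, op_smul_eq_smul] at e1
      rw [e1, e2, dotProduct_comm (gradVec u y) p]
      have e3 := angle_sq_mul u y
      have e4 : ∑ i, gradVec u y i ^ 2 = gradVec u y ⬝ᵥ gradVec u y := by simp [dotProduct, sq]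
      rw [e4] at e3
      refine Eq.trans ?_ e3
      field_simp
      ring
    · intro i j
      filter_upwards [hhess] with y hy
      have e : (1 - Matrix.vecMulVec (Vᵀ *ᵥ p) (Vᵀ *ᵥ p) +
          Matrix.vecMulVec (Vᵀ *ᵥ gradVec u y) (Vᵀ *ᵥ gradVec u y)) * (V⁻¹ * shapeMat u y * V) =
          angle u y • ((1 - Matrix.vecMulVec (Vᵀ *ᵥ p) (Vᵀ *ᵥ p) +
          Matrix.vecMulVec (Vᵀ *ᵥ gradVec u y) (Vᵀ *ᵥ gradVec u y)) +
          u y • (Vᵀ * (Matrix.of fun k l => pderiv k (pderiv l u) y) * V)) := by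
        have e1 : 1 - Matrix.vecMulVec (Vᵀ *ᵥ p) (Vᵀ *ᵥ p) +
            Matrix.vecMulVec (Vᵀ *ᵥ gradVec u y) (Vᵀ *ᵥ gradVec u y) =
            Vᵀ * (1 + Matrix.vecMulVec (gradVec u y) (gradVec u y)) * V := by
          have h4 := h1
          rw [Matrix.mul_add, Matrix.mul_one, Matrix.add_mul] at h4
          rw [vecMulVec_mulVec_transpose, vecMulVec_mulVec_transpose, Matrix.mul_add,
            Matrix.mul_one, Matrix.add_mul]
          conv_lhs => rw [← h4]
          abel
        rw [e1, Matrix.mul_assoc, ← Matrix.mul_assoc V, ← Matrix.mul_assoc V,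
          Matrix.mul_nonsing_inv V hV, Matrix.one_mul, Matrix.mul_assoc, ← Matrix.mul_assoc _ _ V,
          one_add_vecMulVec_mul_shapeMat, secondMat]
        simp only [Matrix.mul_add, Matrix.add_mul, Matrix.mul_smul, Matrix.smul_mul,
          Matrix.mul_assoc, smul_add]
      have e2 := congrFun (congrFun e i) j
      rw [Matrix.mul_apply] at e2
      simp only [Matrix.add_apply, Matrix.sub_apply, Matrix.vecMulVec_apply, Matrix.one_apply,
        Matrix.smul_apply, smul_eq_mul] at e2
      simp only [hgrad]
      have hy' := hy i j
      rw [hgrad] at hy'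
      refine e2.trans ?_
      rw [hy']
      field_simp
  · intro y
    have : ∑ i, A i i y = (V⁻¹ * shapeMat u y * V).trace := rfl
    rw [this, Matrix.trace_mul_comm, ← Matrix.mul_assoc, Matrix.mul_nonsing_inv V hV,
      Matrix.one_mul]
  · intro y
    have : ∑ i, ∑ j, A i j y * A j i y =
        ((V⁻¹ * shapeMat u y * V) * (V⁻¹ * shapeMat u y * V)).trace := by
      simp only [Matrix.trace, Matrix.diag, A, Matrix.mul_apply (M := V⁻¹ * shapeMat u y * V)]
    rw [this]
    have e : (V⁻¹ * shapeMat u y * V) * (V⁻¹ * shapeMat u y * V) =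
        V⁻¹ * (shapeMat u y * shapeMat u y * V) := by
      calc _ = V⁻¹ * (shapeMat u y * (V * V⁻¹) * (shapeMat u y * V)) := by
            simp only [Matrix.mul_assoc]
        _ = _ := by rw [Matrix.mul_nonsing_inv V hV]; simp only [Matrix.mul_one, Matrix.mul_assoc]
    rw [e, Matrix.trace_mul_comm, Matrix.mul_assoc, Matrix.mul_nonsing_inv V hV, Matrix.mul_one]

/-- The elementary symmetric functions of the principal curvatures as traces of the shape
operator. -/
theorem principalCurvatures_sums (hu : ContDiffAt ℝ 2 u x) (hpos : u x ≠ 0) :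
    (principalCurvatures u x).esymm 1 = (shapeMat u x).trace ∧
    2 * (principalCurvatures u x).esymm 2 =
      (shapeMat u x).trace ^ 2 - (shapeMat u x * shapeMat u x).trace := by
  obtain ⟨V, μ, -, -, hV, h3⟩ := exists_principal_basis hu
  rw [esymm_one_eq_sum, two_mul_esymm_two, principalCurvatures_eq hpos hV h3]
  have hS : shapeMat u x = V * (angle u x • Matrix.diagonal μ) * V⁻¹ := by
    rw [← h3]
    simp only [← Matrix.mul_assoc]
    rw [Matrix.mul_nonsing_inv V hV, Matrix.one_mul, Matrix.mul_assoc, Matrix.mul_nonsing_inv V hV,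
      Matrix.mul_one]
  have e1 : (shapeMat u x).trace = ∑ i, angle u x * μ i := by
    rw [hS, Matrix.trace_mul_comm, ← Matrix.mul_assoc, Matrix.nonsing_inv_mul V hV, Matrix.one_mul]
    simp [Matrix.trace]
  have e2 : (shapeMat u x * shapeMat u x).trace = ∑ i, (angle u x * μ i) ^ 2 := by
    have : shapeMat u x * shapeMat u x =
        V * ((angle u x • Matrix.diagonal μ) * (angle u x • Matrix.diagonal μ)) * V⁻¹ := by
      rw [hS]
      calc _ = V * (angle u x • Matrix.diagonal μ) * (V⁻¹ * V) * (angle u x • Matrix.diagonal μ) *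
            V⁻¹ := by simp only [Matrix.mul_assoc]
        _ = _ := by rw [Matrix.nonsing_inv_mul V hV]; simp only [Matrix.mul_one, Matrix.mul_assoc]
    rw [this, Matrix.trace_mul_comm, ← Matrix.mul_assoc, Matrix.nonsing_inv_mul V hV,
      Matrix.one_mul, ← Matrix.diagonal_smul, Matrix.diagonal_mul_diagonal, Matrix.trace_diagonal]
    exact Finset.sum_congr rfl fun i _ => by simp only [Pi.smul_apply, smul_eq_mul]; ring
  rw [e1, e2, Multiset.map_map]
  exact ⟨rfl, rfl⟩

end Frame

/-! ### The curvature equation at an interior point -/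

section Interior

variable {n : ℕ} {u : EuclideanSpace ℝ (Fin n) → ℝ} {x : EuclideanSpace ℝ (Fin n)}
  {σ ε : ℝ} {Ω : Set (EuclideanSpace ℝ (Fin n))}

/-- The curvature equation and the cone condition, expressed through the shape operator. -/
def SolvesAt (σ : ℝ) (u : EuclideanSpace ℝ (Fin n) → ℝ) (x : EuclideanSpace ℝ (Fin n)) : Prop :=
  0 < (shapeMat u x).trace ∧
    (shapeMat u x).trace ^ 2 - (shapeMat u x * shapeMat u x).trace = n * (n - 1) * σ ^ 2

theorem solvesAt_of_curvature (hn : 2 ≤ n) (hσ : 0 < σ) (hu : ContDiffAt ℝ 2 u x) (hpos : 0 < u x)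
    (hcone : InGardingCone 2 (principalCurvatures u x))
    (heq : Real.sqrt (normSymm n 2 (principalCurvatures u x)) = σ) : SolvesAt σ u x := by
  obtain ⟨h1, h2⟩ := principalCurvatures_sums hu hpos.ne'
  refine ⟨h1 ▸ hcone 1 le_rfl (by norm_num), ?_⟩
  rw [← h2]
  -- A negative `H₂` would have the square root `0`, which `σ > 0` excludes.
  have h3 : normSymm n 2 (principalCurvatures u x) = σ ^ 2 := by
    rw [← heq, Real.sq_sqrt]
    by_contra! hneg
    rw [Real.sqrt_eq_zero_of_nonpos hneg.le] at heq
    exact hσ.ne heq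
  have hnR : (2:ℝ) ≤ n := by exact_mod_cast hn
  have hc : ((n.choose 2 : ℕ) : ℝ) = n * (n - 1) / 2 := Nat.cast_choose_two ℝ n
  have hc0 : ((n.choose 2 : ℕ) : ℝ) ≠ 0 := by
    rw [hc]
    have : (0:ℝ) < n - 1 := by linarith
    positivity
  unfold normSymm at h3
  rw [div_eq_iff hc0, hc] at h3
  rw [h3]; ring

theorem meanCurvature_eq (hu : ContDiffAt ℝ 2 u x) (hpos : 0 < u x) :
    meanCurvature u x = (shapeMat u x).trace / n := by
  unfold meanCurvature normSymm
  rw [(principalCurvatures_sums hu hpos.ne').1, Nat.choose_one_right]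

/-- The linear algebra content of the equation in an adapted frame. -/
theorem SolvesAt.frame {w : Fin n → EuclideanSpace ℝ (Fin n)}
    {A : Fin n → Fin n → EuclideanSpace ℝ (Fin n) → ℝ} {b lam : Fin n → ℝ}
    {φ : EuclideanSpace ℝ (Fin n) → ℝ}
    (hs : SolvesAt σ u x) (h : AdaptedFrame x w φ (angle u) A b lam)
    (h1 : ∀ y, ∑ i, A i i y = (shapeMat u y).trace)
    (h2 : ∀ y, ∑ i, ∑ j, A i j y * A j i y = (shapeMat u y * shapeMat u y).trace) :
    0 < ∑ i, lam i ∧ (shapeMat u x).trace = angle u x * ∑ i, lam i ∧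
    angle u x ^ 2 * ((∑ i, lam i) ^ 2 - ∑ i, lam i ^ 2) = n * (n - 1) * σ ^ 2 := by
  have e1 := h.trace_value
  rw [h1] at e1
  refine ⟨?_, e1, ?_⟩
  · have := hs.1
    rw [e1] at this
    exact pos_of_mul_pos_right this h.angle_pos.le
  · rw [← h.second_symm_value, h1, h2, ← hs.2]; ring

theorem SolvesAt.le_trace (hs : SolvesAt σ u x) (hn : 2 ≤ n) (hu : ContDiffAt ℝ ∞ u x)
    (hpos : 0 < u x) : n * σ ≤ (shapeMat u x).trace := by
  obtain ⟨w, A, b, lam, h, h1, h2⟩ := exists_adaptedFrame hu hpos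
  obtain ⟨hL, e1, e2⟩ := hs.frame h h1 h2
  rw [e1]
  exact AdaptedFrame.mul_le_angle_mul_sum lam hn (angle_pos u x) hL e2

/-- The curvature equation near a point, in a frame. -/
theorem eventually_frame_eq {A : Fin n → Fin n → EuclideanSpace ℝ (Fin n) → ℝ}
    (hs : ∀ᶠ y in 𝓝 x, SolvesAt σ u y)
    (h1 : ∀ y, ∑ i, A i i y = (shapeMat u y).trace)
    (h2 : ∀ y, ∑ i, ∑ j, A i j y * A j i y = (shapeMat u y * shapeMat u y).trace) :
    ∀ᶠ y in 𝓝 x, (∑ i, A i i y) * (∑ i, A i i y) + (-1) * ∑ i, ∑ j, A i j y * A j i y =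
      n * (n - 1) * σ ^ 2 := by
  filter_upwards [hs] with y hy
  rw [h1, h2, ← hy.2]; ring

theorem not_isLocalMax_gap (hn : 2 ≤ n) (hσ0 : 0 < σ) (hσ1 : σ < 1) {δ : ℝ} (hδ : 0 < δ)
    (hu : ContDiffAt ℝ ∞ u x) (hpos : 0 < u x) (hs : ∀ᶠ y in 𝓝 x, SolvesAt σ u y) :
    ¬ IsLocalMax (fun y => (σ + δ - angle u y) / u y) x := by
  intro hmax
  obtain ⟨w, A, b, lam, h, h1, h2⟩ := exists_adaptedFrame hu hpos
  obtain ⟨hL, e1, e2⟩ := hs.self_of_nhds.frame h h1 h2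
  refine h.no_interior_max hn hσ0 hσ1 hδ hL (eventually_frame_eq hs h1 h2) ?_
  filter_upwards [hmax] with y hy
  have e : ∀ z, (σ + δ - angle u z) / (1 / u x * u z) = u x * ((σ + δ - angle u z) / u z) := by
    intro z
    rw [one_div, mul_comm, ← div_div, div_inv_eq_mul, mul_comm]
  rw [e, e]
  exact mul_le_mul_of_nonneg_left hy hpos.le

theorem trace_le_of_isLocalMax (hn : 3 ≤ n) (hσ0 : 0 < σ) (hσν : σ ≤ angle u x)
    (hu : ContDiffAt ℝ ∞ u x) (hpos : 0 < u x) (hs : ∀ᶠ y in 𝓝 x, SolvesAt σ u y)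
    (hmax : IsLocalMax (fun y => (n - 1 : ℝ) * Real.log (shapeMat u y).trace +
      (-n : ℝ) * Real.log (angle u y)) x) :
    (shapeMat u x).trace ≤ 20 * n / σ + 10 * n ^ 2 := by
  obtain ⟨w, A, b, lam, h, h1, h2⟩ := exists_adaptedFrame hu hpos
  obtain ⟨hL, e1, e2⟩ := hs.self_of_nhds.frame h h1 h2
  have h3 := h.trace_le_of_isLocalMax hn hσ0 hσν hL (eventually_frame_eq hs h1 h2)
    (by simpa only [h1] using hmax)
  rw [e1]
  exact le_trans (mul_le_of_le_one_left hL.le (angle_le_one u x)) h3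

/-- At a local minimum of the height the eigenvalues `lam` are at least `1` and `ν = 1`, so that
`H₂ ≥ 1 > σ²`. -/
theorem not_isLocalMin_height (hn : 2 ≤ n) (hσ0 : 0 < σ) (hσ1 : σ < 1)
    (hu : ContDiffAt ℝ ∞ u x) (hpos : 0 < u x) (hs : SolvesAt σ u x) : ¬ IsLocalMin u x := by
  intro hmin
  obtain ⟨w, A, b, lam, h, h1, h2⟩ := exists_adaptedFrame hu hpos
  obtain ⟨hL, e1, e2⟩ := hs.frame h h1 h2
  have hmax : IsLocalMax (fun y => (-1) * (1 / u x * u y)) x := by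
    filter_upwards [hmin] with y hy
    have := mul_le_mul_of_nonneg_left hy (one_div_pos.2 hpos).le
    linarith
  have hjet : ∀ i, b i = 0 ∧ 1 ≤ lam i := by
    intro i
    have hJ := (HasJet.const (v := w i) (x := x) (-1)).mul (h.jet_height i)
    have h3 := dd_eq_zero_of_isLocalMax (v := w i) hmax
    have h4 := dd_dd_nonpos_of_isLocalMax (v := w i) (hJ.smooth.of_le (by norm_cast)) hmax
    rw [hJ.first] at h3
    rw [hJ.second] at h4
    constructor <;> linarith
  have hν : angle u x ^ 2 = 1 := by
    have := h.angle_sq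
    simpa [fun i => (hjet i).1] using this
  rw [hν, one_mul, ← AdaptedFrame.sum_coeff_mul] at e2
  have h5 : ∀ c, (n - 1 : ℝ) ≤ ∑ j, lam j - lam c := by
    intro c
    have h6 : ∑ j ∈ Finset.univ.erase c, (1:ℝ) ≤ ∑ j ∈ Finset.univ.erase c, lam j :=
      Finset.sum_le_sum fun j _ => (hjet j).2
    rw [Finset.sum_erase_eq_sub (Finset.mem_univ c),
      Finset.sum_erase_eq_sub (Finset.mem_univ c)] at h6
    simpa using h6
  have hnR : (2:ℝ) ≤ n := by exact_mod_cast hn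
  have h7 : ∑ c : Fin n, (n - 1 : ℝ) ≤ ∑ c, (∑ j, lam j - lam c) * lam c := by
    refine Finset.sum_le_sum fun c _ => ?_
    have := h5 c
    have h8 := (hjet c).2
    calc (n - 1 : ℝ) = (n - 1) * 1 := (mul_one _).symm
      _ ≤ _ := mul_le_mul this h8 zero_le_one (by linarith)
  rw [e2] at h7
  simp only [Finset.sum_const, Finset.card_univ, Fintype.card_fin, nsmul_eq_mul] at h7
  have h9 : (0:ℝ) < n * (n - 1) := mul_pos (by linarith) (by linarith)
  have h10 : σ ^ 2 < 1 := by nlinarith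
  have := mul_lt_mul_of_pos_left h10 h9
  linarith

end Interior

/-! ### Secants of level sets -/

section LevelSet

variable {E : Type*} [NormedAddCommGroup E] [NormedSpace ℝ E] {f g : E → ℝ} {y t : E}
  {s : ℕ → ℝ} {v : ℕ → E}

theorem eventually_lt_of_fderiv_neg {w : E} (hd : DifferentiableAt ℝ f y)
    (hw : fderiv ℝ f y w < 0) : ∀ᶠ r in 𝓝[>] (0:ℝ), f (y + r • w) < f y := by
  have h1 : HasDerivAt (fun r : ℝ => y + r • w) w 0 := by
    simpa using ((hasDerivAt_id (0:ℝ)).smul_const w).const_add y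
  have h2 : HasFDerivAt f (fderiv ℝ f y) (y + (0:ℝ) • w) := by simpa using hd.hasFDerivAt
  have h3 : HasDerivAt (fun r : ℝ => f (y + r • w)) (fderiv ℝ f y w) 0 := h2.comp_hasDerivAt 0 h1
  have h4 := h3.tendsto_slope.mono_left
    (nhdsWithin_mono (0:ℝ) (fun r (hr : r ∈ Ioi (0:ℝ)) => (ne_of_gt hr : r ≠ 0)))
  filter_upwards [h4.eventually (gt_mem_nhds hw), self_mem_nhdsWithin] with r h5 h6
  rw [slope_def_field] at h5
  simp only [zero_smul, add_zero, sub_zero] at h5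
  have h7 := mul_neg_of_neg_of_pos h5 (mem_Ioi.1 h6)
  rw [div_mul_cancel₀ _ (ne_of_gt h6)] at h7
  linarith

theorem eventually_lt_of_fderiv_pos {w : E} (hd : DifferentiableAt ℝ f y)
    (hw : 0 < fderiv ℝ f y w) : ∀ᶠ r in 𝓝[>] (0:ℝ), f y < f (y + r • w) := by
  have h : fderiv ℝ (-f) y w < 0 := by
    rw [fderiv_neg]; simpa using hw
  filter_upwards [eventually_lt_of_fderiv_neg hd.neg h] with r hr
  simpa using hr

/-- At a regular point of a level set, every vector in the kernel of the derivative is the limit of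
rescaled secants of the level set. The points are found by the intermediate value theorem on short
segments transversal to the level set. -/
theorem exists_secants_of_fderiv_eq_zero (hf : Continuous f) (hd : DifferentiableAt ℝ f y)
    (h0 : f y = 0) (hne : fderiv ℝ f y ≠ 0) (ht : fderiv ℝ f y t = 0) :
    ∃ (s : ℕ → ℝ) (v : ℕ → E), (∀ k, 0 < s k) ∧ Tendsto s atTop (𝓝 0) ∧
      Tendsto v atTop (𝓝 t) ∧ ∀ k, f (y + s k • v k) = 0 := by
  obtain ⟨N, hN⟩ : ∃ N, fderiv ℝ f y N ≠ 0 := by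
    by_contra! h
    exact hne (ContinuousLinearMap.ext h)
  obtain ⟨N, hN⟩ : ∃ N, fderiv ℝ f y N = 1 :=
    ⟨(fderiv ℝ f y N)⁻¹ • N, by simp [hN]⟩
  have hpos : ∀ w : E, 0 < fderiv ℝ f y w → ∀ᶠ r in 𝓝[>] (0:ℝ), 0 < f (y + r • w) := by
    simpa only [h0] using fun w hw => eventually_lt_of_fderiv_pos (w := w) hd hw
  have hneg : ∀ w : E, fderiv ℝ f y w < 0 → ∀ᶠ r in 𝓝[>] (0:ℝ), f (y + r • w) < 0 := by
    simpa only [h0] using fun w hw => eventually_lt_of_fderiv_neg (w := w) hd hw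
  have key : ∀ k : ℕ, ∃ r : ℝ, ∃ c : ℝ, 0 < r ∧ r ≤ 1 / ((k:ℝ) + 1) ∧ |c| ≤ 1 / ((k:ℝ) + 1) ∧
      f (y + r • (t + c • N)) = 0 := by
    intro k
    set η : ℝ := 1 / ((k:ℝ) + 1)
    have hη : 0 < η := by positivity
    have hr := (hpos (t + η • N) (by simp [ht, hN, hη])).and
      ((hneg (t + (-η) • N) (by simp [ht, hN, hη])).and
        (Ioo_mem_nhdsGT hη))
    obtain ⟨r, h1, h2, h3⟩ := hr.exists
    have hc : ContinuousOn (fun c : ℝ => f (y + r • (t + c • N))) (Icc (-η) η) :=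
      (hf.comp (by fun_prop)).continuousOn
    obtain ⟨c, hc1, hc2⟩ := intermediate_value_Icc (by linarith) hc ⟨h2.le, h1.le⟩
    exact ⟨r, c, h3.1, h3.2.le, abs_le.2 ⟨hc1.1, hc1.2⟩, hc2⟩
  choose r c hr0 hr1 hc hz using key
  have hlim := tendsto_one_div_add_atTop_nhds_zero_nat (𝕜 := ℝ)
  refine ⟨r, fun k => t + c k • N, hr0,
    squeeze_zero (fun k => (hr0 k).le) hr1 hlim, ?_, hz⟩
  have hc0 : Tendsto c atTop (𝓝 0) := squeeze_zero_norm hc hlim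
  simpa using (hc0.smul_const N).const_add t

theorem fderiv_eq_zero_of_secants (hg : DifferentiableAt ℝ g y) (hs : ∀ k, 0 < s k)
    (hs0 : Tendsto s atTop (𝓝 0)) (hv : Tendsto v atTop (𝓝 t))
    (h : ∀ᶠ k in atTop, g (y + s k • v k) = g y) : fderiv ℝ g y t = 0 := by
  have h2 : Tendsto (fun k => (s k)⁻¹ • (s k • v k)) atTop (𝓝 t) := by
    simpa only [inv_smul_smul₀ (hs _).ne'] using hv
  have h3 := (hasFDerivWithinAt_univ.2 hg.hasFDerivAt).lim (by simpa using hs0.smul hv)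
    (Eventually.of_forall fun _ => mem_univ _) h2
  refine tendsto_nhds_unique h3 (tendsto_const_nhds.congr' ?_)
  filter_upwards [h] with k hk
  simp [hk]

/-- A function with a critical point at `y` that is constant on secants converging to `t` has
vanishing second derivative in the direction `t`, by applying Rolle's theorem twice. -/
theorem fderiv_fderiv_eq_zero_of_secants (hg : ContDiffAt ℝ 2 g y) (hcrit : fderiv ℝ g y = 0)
    (hs : ∀ k, 0 < s k) (hs0 : Tendsto s atTop (𝓝 0)) (hv : Tendsto v atTop (𝓝 t))
    (h : ∀ᶠ k in atTop, g (y + s k • v k) = g y) : fderiv ℝ (fderiv ℝ g) y t t = 0 := by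
  obtain ⟨ε, hε, hball⟩ := Metric.eventually_nhds_iff_ball.1 (hg.eventually (by simp))
  have hev : ∀ᶠ k in atTop, s k * ‖v k‖ < ε := by
    have : Tendsto (fun k => s k * ‖v k‖) atTop (𝓝 0) := by simpa using hs0.mul hv.norm
    exact this.eventually (gt_mem_nhds hε)
  have hroll : ∀ᶠ k in atTop, ∃ τ ∈ Ioo 0 (s k),
      fderiv ℝ (fderiv ℝ g) (y + τ • v k) (v k) (v k) = 0 := by
    filter_upwards [h, hev] with k h1 h2
    have hin : ∀ τ ∈ Icc 0 (s k), ContDiffAt ℝ 2 g (y + τ • v k) := by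
      intro τ hτ
      refine hball _ ?_
      rw [mem_ball_iff_norm, add_sub_cancel_left, norm_smul, Real.norm_of_nonneg hτ.1]
      exact (mul_le_mul_of_nonneg_right hτ.2 (norm_nonneg _)).trans_lt h2
    have hl : ∀ τ : ℝ, HasDerivAt (fun r : ℝ => y + r • v k) (v k) τ := fun τ => by
      simpa using ((hasDerivAt_id τ).smul_const (v k)).const_add y
    have hd1 : ∀ τ ∈ Icc 0 (s k), HasDerivAt (fun r : ℝ => g (y + r • v k))
        (fderiv ℝ g (y + τ • v k) (v k)) τ := fun τ hτ =>
      (((hin τ hτ).differentiableAt (by simp)).hasFDerivAt).comp_hasDerivAt τ (hl τ)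
    have hd2 : ∀ τ ∈ Icc 0 (s k), HasDerivAt (fun r : ℝ => fderiv ℝ g (y + r • v k) (v k))
        (fderiv ℝ (fderiv ℝ g) (y + τ • v k) (v k) (v k)) τ := fun τ hτ => by
      have h3 : DifferentiableAt ℝ (fderiv ℝ g) (y + τ • v k) :=
        ((hin τ hτ).fderiv_right (m := 1) (by norm_num)).differentiableAt (by simp)
      have h4 : HasDerivAt (fun r : ℝ => fderiv ℝ g (y + r • v k))
          (fderiv ℝ (fderiv ℝ g) (y + τ • v k) (v k)) τ := h3.hasFDerivAt.comp_hasDerivAt τ (hl τ)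
      exact (ContinuousLinearMap.apply ℝ ℝ (v k)).hasFDerivAt.comp_hasDerivAt τ h4
    obtain ⟨τ₁, hτ₁, e1⟩ := exists_hasDerivAt_eq_zero (hs k)
      (fun τ hτ => (hd1 τ hτ).continuousAt.continuousWithinAt) (by simp [h1])
      (fun τ hτ => hd1 τ (Ioo_subset_Icc_self hτ))
    have hsub : Icc 0 τ₁ ⊆ Icc 0 (s k) := Icc_subset_Icc_right hτ₁.2.le
    obtain ⟨τ₂, hτ₂, e2⟩ := exists_hasDerivAt_eq_zero hτ₁.1
      (fun τ hτ => (hd2 τ (hsub hτ)).continuousAt.continuousWithinAt)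
      (by simp only [zero_smul, add_zero, hcrit]; rw [e1]; rfl)
      (fun τ hτ => hd2 τ (hsub (Ioo_subset_Icc_self hτ)))
    exact ⟨τ₂, ⟨hτ₂.1, hτ₂.2.trans hτ₁.2⟩, e2⟩
  obtain ⟨φ, hφ⟩ := hroll.choice
  have hφ0 : Tendsto φ atTop (𝓝 0) :=
    tendsto_of_tendsto_of_tendsto_of_le_of_le' tendsto_const_nhds hs0
      (hφ.mono fun k hk => hk.1.1.le) (hφ.mono fun k hk => hk.1.2.le)
  have hc : ContinuousAt (fderiv ℝ (fderiv ℝ g)) y :=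
    ((hg.fderiv_right (m := 1) (by norm_num)).fderiv_right (m := 0) (by norm_num)).continuousAt
  have hlim : Tendsto (fun k => y + φ k • v k) atTop (𝓝 y) := by
    simpa using (hφ0.smul hv).const_add y
  have h4 : Tendsto (fun k => fderiv ℝ (fderiv ℝ g) (y + φ k • v k)) atTop
      (𝓝 (fderiv ℝ (fderiv ℝ g) y)) := hc.tendsto.comp hlim
  have h5 : Tendsto (fun k => fderiv ℝ (fderiv ℝ g) (y + φ k • v k) (v k)) atTop
      (𝓝 (fderiv ℝ (fderiv ℝ g) y t)) :=
    (isBoundedBilinearMap_apply.continuous.tendsto (_, t)).comp (h4.prodMk_nhds hv)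
  have h6 : Tendsto (fun k => fderiv ℝ (fderiv ℝ g) (y + φ k • v k) (v k) (v k)) atTop
      (𝓝 (fderiv ℝ (fderiv ℝ g) y t t)) :=
    (isBoundedBilinearMap_apply.continuous.tendsto (_, t)).comp (h5.prodMk_nhds hv)
  exact tendsto_nhds_unique h6 (tendsto_const_nhds.congr' (hφ.mono fun k hk => hk.2.symm))

end LevelSet

/-! ### Second derivatives at a mean-convex boundary -/

section Boundary

variable {n : ℕ} {u ρ : EuclideanSpace ℝ (Fin n) → ℝ} {y : EuclideanSpace ℝ (Fin n)}
  {ε : ℝ} {Ω : Set (EuclideanSpace ℝ (Fin n))}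

theorem IsDefiningFunctionAt.eq_zero (h : IsDefiningFunctionAt Ω ρ y) (hΩ : IsOpen Ω)
    (hy : y ∈ frontier Ω) : ρ y = 0 := by
  obtain ⟨hρ, -, hiff⟩ := h
  rw [hΩ.frontier_eq] at hy
  refine le_antisymm ?_ ?_
  · by_contra! hpos
    have h1 : ∀ᶠ z in 𝓝 y, z ∉ Ω := by
      filter_upwards [hiff, hρ.continuous.continuousAt.eventually (lt_mem_nhds hpos)] with z h2 h3
      rw [h2]; exact not_lt.2 (le_of_lt h3)
    obtain ⟨z, hz1, hz2⟩ := (mem_closure_iff_frequently.1 hy.1).and_eventually h1 |>.exists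
    exact hz2 hz1
  · have := hiff.self_of_nhds
    exact not_lt.1 fun h => hy.2 (this.2 h)

theorem IsDefiningFunctionAt.eventually_mem_frontier (h : IsDefiningFunctionAt Ω ρ y) :
    ∀ᶠ z in 𝓝 y, ρ z = 0 → z ∈ frontier Ω := by
  obtain ⟨hρ, hne, hiff⟩ := h
  have hd : ∀ᶠ z in 𝓝 y, fderiv ℝ ρ z ≠ 0 :=
    ((hρ.continuous_fderiv (by simp)).continuousAt).eventually_ne hne
  filter_upwards [hiff.eventually_nhds, hd] with z h1 h2 h0
  refine ⟨?_, fun h3 => absurd (h1.self_of_nhds.1 (interior_subset h3)) (by simp [h0])⟩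
  -- Otherwise `ρ ≥ 0` near `z`, so that `z` would be a critical point.
  by_contra hz
  have h4 : ∀ᶠ z' in 𝓝 z, z' ∉ Ω := by
    simpa [mem_closure_iff_frequently] using hz
  have h5 : IsLocalMin ρ z := by
    filter_upwards [h1, h4] with z' h6 h7
    rw [h0]; exact not_lt.1 fun h => h7 (h6.2 h)
  exact h2 h5.fderiv_eq_zero

/-- The divergence of the unit normal field of the level sets, in terms of second derivatives. The
derivatives of `W = |Dρ|` are found by differentiating `W W = |Dρ|²` and `(ρ_i / W) W = ρ_i`. -/
theorem levelMeanCurvature_mul (hρ : ContDiffAt ℝ 2 ρ y) (hne : 0 < ∑ j, pderiv j ρ y ^ 2) :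
    levelMeanCurvature ρ y * Real.sqrt (∑ j, pderiv j ρ y ^ 2) ^ 3 =
      (∑ i, pderiv i (pderiv i ρ) y) * ∑ j, pderiv j ρ y ^ 2 -
        ∑ i, ∑ j, pderiv i ρ y * pderiv j ρ y * pderiv i (pderiv j ρ) y := by
  set W : EuclideanSpace ℝ (Fin n) → ℝ := fun z => Real.sqrt (∑ j, pderiv j ρ z ^ 2) with hW
  have hp : ∀ j, ContDiffAt ℝ 1 (pderiv j ρ) y := fun j => contDiffAt_pderiv hρ (by norm_num) j
  have hpd : ∀ j, DifferentiableAt ℝ (pderiv j ρ) y := fun j => (hp j).differentiableAt (by simp)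
  have hq : ContDiffAt ℝ 1 (fun z => ∑ j, pderiv j ρ z ^ 2) y :=
    ContDiffAt.sum fun j _ => (hp j).pow 2
  have hWc : ContDiffAt ℝ 1 W y := hq.sqrt hne.ne'
  have hWd : DifferentiableAt ℝ W y := hWc.differentiableAt (by simp)
  have hW0 : 0 < W y := Real.sqrt_pos.2 hne
  have hWq : W y ^ 2 = ∑ j, pderiv j ρ y ^ 2 := Real.sq_sqrt hne.le
  have hWW : (fun z => W z * W z) = fun z => ∑ j, pderiv j ρ z * pderiv j ρ z := by
    ext z
    rw [Real.mul_self_sqrt (Finset.sum_nonneg fun j _ => sq_nonneg _)]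
    exact Finset.sum_congr rfl fun j _ => sq _
  have hdW : ∀ i, W y * pderiv i W y = ∑ j, pderiv j ρ y * pderiv i (pderiv j ρ) y := by
    intro i
    have h1 := congrArg (fun f => dd (EuclideanSpace.single i 1) f y) hWW
    rw [dd_mul hWd hWd, dd_sum (F := fun j z => pderiv j ρ z * pderiv j ρ z)
      (fun j _ => (hpd j).fun_mul (hpd j))] at h1
    simp only [fun j => dd_mul (v := EuclideanSpace.single i 1) (hpd j) (hpd j)] at h1
    have h2 : ∀ f : EuclideanSpace ℝ (Fin n) → ℝ, dd (EuclideanSpace.single i 1) f y =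
      pderiv i f y := fun _ => rfl
    simp only [h2] at h1
    have h3 : ∑ j, (pderiv i (pderiv j ρ) y * pderiv j ρ y + pderiv j ρ y * pderiv i (pderiv j ρ) y)
        = 2 * ∑ j, pderiv j ρ y * pderiv i (pderiv j ρ) y := by
      rw [Finset.mul_sum]
      exact Finset.sum_congr rfl fun j _ => by ring
    rw [h3] at h1
    linarith
  have hK : ∀ i, pderiv i (fun z => pderiv i ρ z / W z) y * W y ^ 3 =
      pderiv i (pderiv i ρ) y * W y ^ 2 -
        ∑ j, pderiv i ρ y * pderiv j ρ y * pderiv i (pderiv j ρ) y := by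
    intro i
    have h1 : (fun z => pderiv i ρ z / W z * W z) =ᶠ[𝓝 y] pderiv i ρ := by
      filter_upwards [hWd.continuousAt.eventually_ne hW0.ne'] with z hz
      exact div_mul_cancel₀ _ hz
    have h2 := dd_congr (v := EuclideanSpace.single i 1) h1
    have hKd : DifferentiableAt ℝ (fun z => pderiv i ρ z / W z) y :=
      ((hp i).div hWc hW0.ne').differentiableAt (by simp)
    rw [dd_mul hKd hWd] at h2
    change pderiv i (fun z => pderiv i ρ z / W z) y * W y + pderiv i ρ y / W y * pderiv i W y =
      pderiv i (pderiv i ρ) y at h2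
    simp only [mul_assoc]
    rw [← h2, ← Finset.mul_sum, ← hdW]
    field_simp
    ring
  change (∑ i, pderiv i (fun z => pderiv i ρ z / W z) y) * W y ^ 3 = _
  rw [← hWq]
  rw [Finset.sum_mul, Finset.sum_mul, ← Finset.sum_sub_distrib]
  exact Finset.sum_congr rfl fun i _ => hK i

/-- A bilinear form that vanishes on the diagonal of the hyperplane orthogonal to `r` has trace
`B(r, r) / |r|²`: the vectors `rᵢ eⱼ - rⱼ eᵢ` lie in this hyperplane. -/
theorem trace_mul_eq_of_apply_self_eq_zero {B : Fin n → Fin n → ℝ} {r : Fin n → ℝ}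
    (h : ∀ i j, r i * r i * B j j - r i * r j * B i j - r j * r i * B j i + r j * r j * B i i = 0) :
    (∑ i, B i i) * ∑ j, r j ^ 2 = ∑ i, ∑ j, r i * r j * B i j := by
  have h1 : ∑ i, ∑ j, (r i * r i * B j j - r i * r j * B i j - r j * r i * B j i
      + r j * r j * B i i) = 0 := Finset.sum_eq_zero fun i _ => Finset.sum_eq_zero fun j _ => h i j
  simp only [Finset.sum_add_distrib, Finset.sum_sub_distrib] at h1
  have h2 : ∑ i, ∑ j, r i * r i * B j j = (∑ i, B i i) * ∑ j, r j ^ 2 := by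
    rw [Finset.sum_mul_sum, Finset.sum_comm]
    exact Finset.sum_congr rfl fun i _ => Finset.sum_congr rfl fun j _ => by ring
  have h3 : ∑ i, ∑ j, r j * r j * B i i = (∑ i, B i i) * ∑ j, r j ^ 2 := by
    rw [Finset.sum_mul_sum]
    exact Finset.sum_congr rfl fun i _ => Finset.sum_congr rfl fun j _ => by ring
  have h4 : ∑ i, ∑ j, r j * r i * B j i = ∑ i, ∑ j, r i * r j * B i j := Finset.sum_comm
  rw [h2, h3, h4] at h1
  linarith

/-- Let `u` be at least `ε` in a mean-convex domain and equal to `ε` on its boundary. At a boundary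
point `Du = μ Dρ` with `μ ≤ 0`, and `u - μ ρ` has a vanishing Hessian on the tangent space of the
boundary, so that the quantity `Δu |Du|² - ∑ u_i u_j u_ij` is `μ³ |Dρ|³` times the mean curvature of
the boundary. -/
theorem hessian_trace_sub_le_of_mean_convex (hΩ : IsOpen Ω) (hy : y ∈ frontier Ω)
    (hρ : IsDefiningFunctionAt Ω ρ y) (hmc : 0 ≤ levelMeanCurvature ρ y) (hu : ContDiffAt ℝ 2 u y)
    (hfr : ∀ z ∈ frontier Ω, u z = ε) (hin : ∀ z ∈ Ω, ε ≤ u z) :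
    (∑ i, pderiv i (pderiv i u) y) * ∑ i, pderiv i u y ^ 2 ≤
      ∑ i, ∑ j, pderiv i u y * pderiv j u y * pderiv i (pderiv j u) y := by
  have h0 := hρ.eq_zero hΩ hy
  have hfrev := hρ.eventually_mem_frontier
  obtain ⟨hρs, hne, hiff⟩ := hρ
  have hρ2 : ContDiffAt ℝ 2 ρ y := hρs.contDiffAt.of_le (by norm_cast)
  have hρd : DifferentiableAt ℝ ρ y := hρ2.differentiableAt (by simp)
  have hud : DifferentiableAt ℝ u y := hu.differentiableAt (by simp)
  have hsec : ∀ t, fderiv ℝ ρ y t = 0 → ∃ (s : ℕ → ℝ) (v : ℕ → EuclideanSpace ℝ (Fin n)),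
      (∀ k, 0 < s k) ∧ Tendsto s atTop (𝓝 0) ∧ Tendsto v atTop (𝓝 t) ∧
      (∀ k, ρ (y + s k • v k) = 0) ∧ ∀ᶠ k in atTop, u (y + s k • v k) = u y := by
    intro t ht
    obtain ⟨s, v, hs, hs0, hv, hz⟩ := exists_secants_of_fderiv_eq_zero hρs.continuous hρd h0 hne ht
    refine ⟨s, v, hs, hs0, hv, hz, ?_⟩
    have hlim : Tendsto (fun k => y + s k • v k) atTop (𝓝 y) := by
      simpa using (hs0.smul hv).const_add y
    filter_upwards [hlim.eventually hfrev] with k hk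
    rw [hfr _ (hk (hz k)), hfr y hy]
  obtain ⟨N, hN⟩ : ∃ N, fderiv ℝ ρ y N ≠ 0 := by
    by_contra! h
    exact hne (ContinuousLinearMap.ext h)
  obtain ⟨N, hN⟩ : ∃ N, fderiv ℝ ρ y N = 1 :=
    ⟨(fderiv ℝ ρ y N)⁻¹ • N, by simp [hN]⟩
  set μ : ℝ := fderiv ℝ u y N with hμ
  have hgrad : fderiv ℝ u y = μ • fderiv ℝ ρ y := by
    ext t
    obtain ⟨s, v, hs, hs0, hv, -, hz⟩ := hsec (t - fderiv ℝ ρ y t • N) (by simp [hN])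
    have := fderiv_eq_zero_of_secants hud hs hs0 hv hz
    rw [map_sub, map_smul, sub_eq_zero] at this
    rw [this]
    simp [hμ, mul_comm]
  -- Moving from `y` into the domain, `u` cannot fall below `ε`.
  have hμ0 : μ ≤ 0 := by
    by_contra! hpos
    have h1 := eventually_lt_of_fderiv_neg (w := -N) hud (by rw [map_neg]; linarith)
    have h2 := eventually_lt_of_fderiv_neg (w := -N) hρd (by rw [map_neg, hN]; norm_num)
    have h3 : Tendsto (fun r : ℝ => y + r • (-N)) (𝓝[>] 0) (𝓝 y) := by
      have : Continuous fun r : ℝ => y + r • (-N) := by fun_prop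
      simpa using (this.tendsto 0).mono_left nhdsWithin_le_nhds
    obtain ⟨r, h4, h5, h6⟩ := (h1.and (h2.and (h3.eventually hiff))).exists
    rw [h0] at h5
    have h7 := hin _ (h6.2 h5)
    rw [hfr y hy] at h4
    linarith
  -- `u - μ ρ` has a critical point at `y` and is constant on the boundary.
  have hF : ContDiffAt ℝ 2 (u - μ • ρ) y := hu.sub (contDiffAt_const.smul hρ2)
  have hFcrit : fderiv ℝ (u - μ • ρ) y = 0 := by
    rw [fderiv_sub hud (hρd.const_smul μ), fderiv_const_smul hρd, hgrad, sub_self]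
  have hFF : fderiv ℝ (fderiv ℝ (u - μ • ρ)) y =
      fderiv ℝ (fderiv ℝ u) y - μ • fderiv ℝ (fderiv ℝ ρ) y := by
    have h1 : fderiv ℝ (u - μ • ρ) =ᶠ[𝓝 y] fderiv ℝ u - μ • fderiv ℝ ρ := by
      filter_upwards [hu.eventually (by simp), hρ2.eventually (by simp)] with z hz1 hz2
      have d1 : DifferentiableAt ℝ u z := hz1.differentiableAt (by simp)
      have d2 : DifferentiableAt ℝ ρ z := hz2.differentiableAt (by simp)
      rw [fderiv_sub d1 (d2.const_smul μ), fderiv_const_smul d2]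
      rfl
    have d1 : DifferentiableAt ℝ (fderiv ℝ u) y :=
      (hu.fderiv_right (m := 1) (by norm_num)).differentiableAt (by simp)
    have d2 : DifferentiableAt ℝ (fderiv ℝ ρ) y :=
      (hρ2.fderiv_right (m := 1) (by norm_num)).differentiableAt (by simp)
    rw [h1.fderiv_eq, fderiv_sub d1 (d2.const_smul μ), fderiv_const_smul d2]
  have htan : ∀ t, fderiv ℝ ρ y t = 0 → fderiv ℝ (fderiv ℝ u) y t t -
      μ * fderiv ℝ (fderiv ℝ ρ) y t t = 0 := by
    intro t ht
    obtain ⟨s, v, hs, hs0, hv, hz1, hz2⟩ := hsec t ht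
    have h1 := fderiv_fderiv_eq_zero_of_secants hF hFcrit hs hs0 hv (by
      filter_upwards [hz2] with k hk
      simp [hk, hz1, h0])
    rw [hFF] at h1
    simpa using h1
  set e : Fin n → EuclideanSpace ℝ (Fin n) := fun i => EuclideanSpace.single i 1 with he
  set r : Fin n → ℝ := fun i => pderiv i ρ y with hr
  have hre : ∀ i, fderiv ℝ ρ y (e i) = r i := fun i => rfl
  have hU : ∀ i j, pderiv i (pderiv j u) y = fderiv ℝ (fderiv ℝ u) y (e i) (e j) := fun i j =>
    dd_dd_apply hu
  have hR : ∀ i j, pderiv i (pderiv j ρ) y = fderiv ℝ (fderiv ℝ ρ) y (e i) (e j) := fun i j =>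
    dd_dd_apply hρ2
  have hkey := trace_mul_eq_of_apply_self_eq_zero (r := r)
    (B := fun i j => pderiv i (pderiv j u) y - μ * pderiv i (pderiv j ρ) y) (by
      intro i j
      have h1 := htan (r i • e j - r j • e i) (by simp [hre, mul_comm])
      simp only [map_sub, map_smul, sub_apply, smul_apply,
        smul_eq_mul] at h1
      simp only [hU, hR]
      linear_combination h1)
  have hrpos : 0 < ∑ j, r j ^ 2 := by
    refine lt_of_le_of_ne (Finset.sum_nonneg fun j _ => sq_nonneg _) fun h => hne ?_
    have h1 := (Finset.sum_eq_zero_iff_of_nonneg fun j _ => sq_nonneg (r j)).1 h.symm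
    ext t
    have h2 : fderiv ℝ ρ y t = ∑ k, t k * r k := dd_eq_sum_pderiv t ρ y
    rw [h2]
    exact Finset.sum_eq_zero fun k hk => by
      rw [pow_eq_zero_iff two_ne_zero |>.1 (h1 k hk), mul_zero]
  have hmc2 := levelMeanCurvature_mul hρ2 hrpos
  have hmc3 : 0 ≤ (∑ i, pderiv i (pderiv i ρ) y) * ∑ j, r j ^ 2 -
        ∑ i, ∑ j, r i * r j * pderiv i (pderiv j ρ) y := by
    rw [← hmc2]; positivity
  have hp : ∀ i, pderiv i u y = μ * r i := fun i => by
    change fderiv ℝ u y (e i) = _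
    rw [hgrad]; rfl
  simp only [hp]
  have e1 : ∑ i, (μ * r i) ^ 2 = μ ^ 2 * ∑ j, r j ^ 2 := by
    rw [Finset.mul_sum]; exact Finset.sum_congr rfl fun i _ => by ring
  have e2 : ∑ i, ∑ j, μ * r i * (μ * r j) * pderiv i (pderiv j u) y =
      μ ^ 2 * ∑ i, ∑ j, r i * r j * pderiv i (pderiv j u) y := by
    simp only [Finset.mul_sum]
    exact Finset.sum_congr rfl fun i _ => Finset.sum_congr rfl fun j _ => by ring
  have e3 : ∑ i, ∑ j, r i * r j * (pderiv i (pderiv j u) y - μ * pderiv i (pderiv j ρ) y) =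
      ∑ i, ∑ j, r i * r j * pderiv i (pderiv j u) y -
        μ * ∑ i, ∑ j, r i * r j * pderiv i (pderiv j ρ) y := by
    simp only [Finset.mul_sum, ← Finset.sum_sub_distrib]
    exact Finset.sum_congr rfl fun i _ => Finset.sum_congr rfl fun j _ => by ring
  rw [e3, Finset.sum_sub_distrib, ← Finset.mul_sum] at hkey
  rw [e1, e2]
  have h1 := mul_nonneg (mul_nonneg (sq_nonneg μ) (neg_nonneg.2 hμ0)) hmc3
  linear_combination h1 + μ ^ 2 * hkey

end Boundary

/-! ### The gradient bound -/

/-- The squared length `|Du|²` of the Euclidean gradient. -/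
noncomputable def gradSq {n : ℕ} (u : EuclideanSpace ℝ (Fin n) → ℝ)
    (x : EuclideanSpace ℝ (Fin n)) : ℝ :=
  ∑ i, pderiv i u x ^ 2

/-- The Euclidean Laplacian `∑ u_ii`. -/
noncomputable def lap {n : ℕ} (u : EuclideanSpace ℝ (Fin n) → ℝ)
    (x : EuclideanSpace ℝ (Fin n)) : ℝ :=
  ∑ i, pderiv i (pderiv i u) x

/-- The Hessian evaluated on the gradient, `∑ u_i u_j u_ij`. -/
noncomputable def hessGrad {n : ℕ} (u : EuclideanSpace ℝ (Fin n) → ℝ)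
    (x : EuclideanSpace ℝ (Fin n)) : ℝ :=
  ∑ i, ∑ j, pderiv i u x * pderiv j u x * pderiv i (pderiv j u) x

/-- The graph of `u` over the bounded open set `Ω` solves the curvature equation in the interior and
has height `ε` over the boundary. -/
structure IsSolution {n : ℕ} (σ ε : ℝ) (Ω : Set (EuclideanSpace ℝ (Fin n)))
    (u : EuclideanSpace ℝ (Fin n) → ℝ) : Prop where
  isOpen : IsOpen Ω
  isCompact : IsCompact (closure Ω)
  smooth : ∀ x ∈ Ω, ContDiffAt ℝ ∞ u x
  smooth_closure : ∀ x ∈ closure Ω, ContDiffAt ℝ 2 u x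
  pos : ∀ x ∈ Ω, 0 < u x
  boundary : ∀ x ∈ frontier Ω, u x = ε
  solves : ∀ x ∈ Ω, SolvesAt σ u x

section GradientBound

variable {n : ℕ} {u : EuclideanSpace ℝ (Fin n) → ℝ} {x : EuclideanSpace ℝ (Fin n)}
  {σ ε : ℝ} {Ω : Set (EuclideanSpace ℝ (Fin n))}

theorem continuousAt_pderiv (hu : ContDiffAt ℝ 2 u x) (i : Fin n) : ContinuousAt (pderiv i u) x :=
  (contDiffAt_pderiv (m := 1) hu (by norm_num) i).continuousAt

theorem continuousAt_pderiv_pderiv (hu : ContDiffAt ℝ 2 u x) (i j : Fin n) :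
    ContinuousAt (pderiv i (pderiv j u)) x :=
  (contDiffAt_pderiv (m := 0) (contDiffAt_pderiv (m := 1) hu (by norm_num) j)
    (by norm_num) i).continuousAt

theorem continuousAt_angle (hu : ContDiffAt ℝ 2 u x) : ContinuousAt (angle u) x :=
  (contDiffAt_angle (m := 1) hu (by norm_num)).continuousAt

theorem continuousAt_gradSq (hu : ContDiffAt ℝ 2 u x) : ContinuousAt (gradSq u) x :=
  tendsto_finsetSum _ fun i _ => (continuousAt_pderiv hu i).pow 2

theorem continuousAt_lap (hu : ContDiffAt ℝ 2 u x) : ContinuousAt (lap u) x :=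
  tendsto_finsetSum _ fun i _ => continuousAt_pderiv_pderiv hu i i

theorem continuousAt_hessGrad (hu : ContDiffAt ℝ 2 u x) : ContinuousAt (hessGrad u) x :=
  tendsto_finsetSum _ fun i _ => tendsto_finsetSum _ fun j _ =>
    ((continuousAt_pderiv hu i).mul (continuousAt_pderiv hu j)).mul
      (continuousAt_pderiv_pderiv hu i j)

theorem continuousAt_trace (hu : ContDiffAt ℝ 2 u x) :
    ContinuousAt (fun y => (shapeMat u y).trace) x :=
  tendsto_finsetSum _ fun i _ => (contDiffAt_shapeMat (m := 0) hu (by norm_num) i i).continuousAt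

theorem angle_sq_mul_gradSq (u : EuclideanSpace ℝ (Fin n) → ℝ) (x : EuclideanSpace ℝ (Fin n)) :
    angle u x ^ 2 * (1 + gradSq u x) = 1 := angle_sq_mul u x

theorem gradSq_pos_of_angle_lt_one (h : angle u x < 1) : 0 < gradSq u x := by
  have h1 := angle_sq_mul_gradSq u x
  have h2 := angle_pos u x
  by_contra! h3
  nlinarith [mul_nonneg (sq_nonneg (angle u x)) (neg_nonneg.2 h3)]

theorem trace_shapeMat (u : EuclideanSpace ℝ (Fin n) → ℝ) (x : EuclideanSpace ℝ (Fin n)) :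
    (shapeMat u x).trace =
      angle u x * (n + u x * lap u x - angle u x ^ 2 * (u x * hessGrad u x)) := by
  have hν := angle_sq_mul_gradSq u x
  have h1 : (secondMat u x).trace = n + gradSq u x + u x * lap u x := by
    simp only [secondMat, Matrix.trace_add, Matrix.trace_one, Matrix.trace_smul,
      Fintype.card_fin, smul_eq_mul]
    congr 2
    exact Finset.sum_congr rfl fun i _ => (sq _).symm
  have h2 : (Matrix.vecMulVec (gradVec u x) (gradVec u x) * secondMat u x).trace =
      gradSq u x + gradSq u x ^ 2 + u x * hessGrad u x := by
    have e : gradVec u x ⬝ᵥ gradVec u x = gradSq u x :=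
      Finset.sum_congr rfl fun i _ => (sq _).symm
    have e1 : ∑ i, gradVec u x i ^ 2 = gradSq u x := rfl
    have e2 : (Matrix.vecMulVec (gradVec u x) (gradVec u x) *
        Matrix.of fun i j => pderiv i (pderiv j u) x).trace = hessGrad u x := by
      simp only [Matrix.trace, Matrix.diag, Matrix.mul_apply, Matrix.vecMulVec_apply, hessGrad,
        gradVec, Matrix.of_apply]
      rw [Finset.sum_comm]
      exact Finset.sum_congr rfl fun i _ => Finset.sum_congr rfl fun j _ => by ring
    rw [secondMat, Matrix.mul_add, Matrix.mul_add, Matrix.mul_one, Matrix.trace_add,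
      Matrix.trace_add, Matrix.mul_smul, Matrix.trace_smul, e2, vecMulVec_self_mul_self,
      Matrix.trace_smul, Matrix.trace_vecMulVec, e, e1, smul_eq_mul, smul_eq_mul]
    ring
  rw [shapeMat, Matrix.sub_mul, Matrix.one_mul, Matrix.smul_mul, Matrix.trace_smul,
    Matrix.trace_sub, Matrix.trace_smul, h1, h2]
  simp only [smul_eq_mul]
  linear_combination (-angle u x * gradSq u x) * hν

/-- The derivative of the angle function in the direction of the gradient of the height. -/
theorem dd_gradVec_angle (hu : ContDiffAt ℝ 2 u x) :
    dd (WithLp.toLp 2 (gradVec u x)) (angle u) x = -(angle u x ^ 3 * hessGrad u x) := by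
  set v : EuclideanSpace ℝ (Fin n) := WithLp.toLp 2 (gradVec u x)
  have hpd : ∀ j, DifferentiableAt ℝ (pderiv j u) x := fun j =>
    (contDiffAt_pderiv (m := 1) hu (by norm_num) j).differentiableAt (by simp)
  have had : DifferentiableAt ℝ (angle u) x :=
    (contDiffAt_angle (m := 1) hu (by norm_num)).differentiableAt (by simp)
  have hS : DifferentiableAt ℝ (fun y => ∑ j, pderiv j u y * pderiv j u y) x :=
    DifferentiableAt.fun_sum fun j _ => (hpd j).fun_mul (hpd j)
  have h1 : (fun y => angle u y * angle u y * (1 + ∑ j, pderiv j u y * pderiv j u y)) =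
      fun _ => 1 := by
    ext y
    simpa only [sq, gradVec] using angle_sq_mul u y
  have h2 := congrFun (congrArg (dd v) h1) x
  rw [dd_mul (f := fun y => angle u y * angle u y) (had.fun_mul had)
    ((differentiableAt_const _).fun_add hS), dd_mul had had,
    dd_add (differentiableAt_const _) hS, dd_const,
    dd_sum (F := fun j y => pderiv j u y * pderiv j u y) fun j _ => (hpd j).fun_mul (hpd j)] at h2
  have h3 : ∑ j, dd v (fun y => pderiv j u y * pderiv j u y) x = 2 * hessGrad u x := by
    simp only [hessGrad]
    rw [Finset.sum_comm, Finset.mul_sum]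
    refine Finset.sum_congr rfl fun j _ => ?_
    rw [dd_mul (hpd j) (hpd j), dd_eq_sum_pderiv, Finset.sum_mul, Finset.mul_sum, Finset.mul_sum,
      ← Finset.sum_add_distrib]
    refine Finset.sum_congr rfl fun i _ => ?_
    simp only [v, gradVec]
    ring
  rw [h3] at h2
  have h4 := angle_sq_mul_gradSq u x
  have h5 : ∑ j, pderiv j u x * pderiv j u x = gradSq u x :=
    Finset.sum_congr rfl fun j _ => (sq _).symm
  rw [h5] at h2
  have h6 := angle_pos u x
  have h7 : angle u x * (dd v (angle u) x + angle u x ^ 3 * hessGrad u x) = 0 := by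
    linear_combination (angle u x ^ 2 / 2) * h2 - (angle u x * dd v (angle u) x) * h4
  linarith [(mul_eq_zero.1 h7).resolve_left h6.ne']

theorem dd_gradVec_self (u : EuclideanSpace ℝ (Fin n) → ℝ) (x : EuclideanSpace ℝ (Fin n)) :
    dd (WithLp.toLp 2 (gradVec u x)) u x = gradSq u x := by
  rw [dd_eq_sum_pderiv]
  exact Finset.sum_congr rfl fun j _ => (sq _).symm

/-- The height has no interior minimum, so that it exceeds its boundary value. -/
theorem IsSolution.lt_height (h : IsSolution σ ε Ω u) (hn : 2 ≤ n) (hσ0 : 0 < σ) (hσ1 : σ < 1)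
    (hx : x ∈ Ω) : ε < u x := by
  have hno : ∀ z ∈ Ω, ¬ ∀ y ∈ Ω, u z ≤ u y := fun z hz hmin =>
    not_isLocalMin_height hn hσ0 hσ1 (h.smooth z hz) (h.pos z hz) (h.solves z hz)
      (by filter_upwards [h.isOpen.mem_nhds hz] with y hy using hmin y hy)
  have hc : ContinuousOn u (closure Ω) := fun z hz =>
    (h.smooth_closure z hz).continuousAt.continuousWithinAt
  obtain ⟨z, hz, hmin⟩ := h.isCompact.exists_isMinOn ⟨x, subset_closure hx⟩ hc
  have hzf : z ∈ frontier Ω := by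
    rw [h.isOpen.frontier_eq]
    exact ⟨hz, fun hzΩ => hno z hzΩ fun y hy => hmin (subset_closure hy)⟩
  have hle : ∀ y ∈ Ω, ε ≤ u y := fun y hy => h.boundary z hzf ▸ hmin (subset_closure hy)
  exact lt_of_le_of_ne (hle x hx) fun he => hno x hx fun y hy => he ▸ hle y hy

/-- On the level set `{u = τ}` there is a point at which the gap function
`(σ + τη - angle) / u` is maximal in `{u ≥ τ}`. Its derivative in the direction of the gradient then
has a sign, which turns the curvature equation into an inequality for the mean curvature of the
level set of `u`. -/
theorem IsSolution.exists_gap_point (h : IsSolution σ ε Ω u) (hn : 2 ≤ n) (hσ0 : 0 < σ)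
    (hσ1 : σ < 1) (hx : x ∈ Ω) {τ η : ℝ} (hτ0 : 0 < τ) (hετ : ε < τ) (hτ : τ < u x) (hη : 0 < η)
    (hτη : τ * η ≤ (1 - σ) / 2) (hν : angle u x < σ) :
    ∃ y ∈ Ω, u y = τ ∧ angle u y ≤ (1 + σ) / 2 ∧
      ((n - 1) * ((σ - angle u x) / u x) - n * η) * gradSq u y ≤
        angle u y * (lap u y * gradSq u y - hessGrad u y) := by
  have hux := h.pos x hx
  set K : Set (EuclideanSpace ℝ (Fin n)) := closure Ω ∩ u ⁻¹' Ici τ with hK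
  have hc : ContinuousOn u (closure Ω) := fun z hz =>
    (h.smooth_closure z hz).continuousAt.continuousWithinAt
  have hKc : IsCompact K := h.isCompact.of_isClosed_subset
    (hc.preimage_isClosed_of_isClosed isClosed_closure isClosed_Ici) inter_subset_left
  set θ : EuclideanSpace ℝ (Fin n) → ℝ := fun y => (σ + τ * η - angle u y) / u y with hθ
  have hθc : ∀ y ∈ K, ContinuousAt θ y := fun y hy =>
    (continuousAt_const.sub (continuousAt_angle (h.smooth_closure y hy.1))).div
      (h.smooth_closure y hy.1).continuousAt (hτ0.trans_le hy.2).ne'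
  have hxK : x ∈ K := ⟨subset_closure hx, hτ.le⟩
  obtain ⟨y, hyK, hmax⟩ := hKc.exists_isMaxOn ⟨x, hxK⟩
    (fun y hy => (hθc y hy).continuousWithinAt)
  have hyΩ : y ∈ Ω := by
    by_contra hy
    have : y ∈ frontier Ω := by
      rw [h.isOpen.frontier_eq]; exact ⟨hyK.1, hy⟩
    have h1 := h.boundary y this
    have h2 : τ ≤ u y := hyK.2
    linarith
  have hu2 := h.smooth_closure y hyK.1
  have hsol : ∀ᶠ z in 𝓝 y, SolvesAt σ u z := by
    filter_upwards [h.isOpen.mem_nhds hyΩ] with z hz using h.solves z hz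
  have huy : u y = τ := by
    refine le_antisymm ?_ hyK.2
    by_contra! hlt
    refine not_isLocalMax_gap hn hσ0 hσ1 (mul_pos hτ0 hη) (h.smooth y hyΩ) (h.pos y hyΩ) hsol ?_
    filter_upwards [h.isOpen.mem_nhds hyΩ, hu2.continuousAt.eventually (lt_mem_nhds hlt)]
      with z hz1 hz2 using hmax ⟨subset_closure hz1, le_of_lt hz2⟩
  have hθy : (σ - angle u x) / u x ≤ θ y := by
    refine le_trans ?_ (hmax hxK)
    exact div_le_div_of_nonneg_right (by linarith [mul_pos hτ0 hη]) hux.le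
  have hm0 : 0 < (σ - angle u x) / u x := div_pos (by linarith) hux
  have hθτ : θ y * τ = σ + τ * η - angle u y := by
    simp only [hθ, huy]
    exact div_mul_cancel₀ _ hτ0.ne'
  have hνy : angle u y ≤ (1 + σ) / 2 := by
    nlinarith [mul_pos (hm0.trans_le hθy) hτ0]
  have ha : 0 < gradSq u y := gradSq_pos_of_angle_lt_one (by linarith)
  set v : EuclideanSpace ℝ (Fin n) := WithLp.toLp 2 (gradVec u y) with hv
  have hud : DifferentiableAt ℝ u y := hu2.differentiableAt (by simp)
  have had : DifferentiableAt ℝ (angle u) y :=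
    (contDiffAt_angle (m := 1) hu2 (by norm_num)).differentiableAt (by simp)
  have hθd : DifferentiableAt ℝ θ y := by
    have h1 : ContDiffAt ℝ 1 θ y :=
      (contDiffAt_const.sub (contDiffAt_angle (m := 1) hu2 (by norm_num))).div
        (hu2.of_le (by norm_num)) (h.pos y hyΩ).ne'
    exact h1.differentiableAt (by simp)
  -- Moving up the gradient stays in `{u ≥ τ}`, where `θ` is largest at `y`.
  have hdθ : dd v θ y ≤ 0 := by
    by_contra! hpos
    have h1 := eventually_lt_of_fderiv_pos (w := v) hθd hpos
    have h2 := eventually_lt_of_fderiv_pos (w := v) hud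
      (by change 0 < dd v u y; rw [hv, dd_gradVec_self]; exact ha)
    have h3 : Tendsto (fun r : ℝ => y + r • v) (𝓝[>] 0) (𝓝 y) := by
      have : Continuous fun r : ℝ => y + r • v := by fun_prop
      simpa using (this.tendsto 0).mono_left nhdsWithin_le_nhds
    obtain ⟨r, h4, h5, h6⟩ := (h1.and (h2.and (h3.eventually (h.isOpen.mem_nhds hyΩ)))).exists
    rw [huy] at h5
    exact absurd (hmax (show y + r • v ∈ K from ⟨subset_closure h6, le_of_lt h5⟩)) (not_le.2 h4)
  have hmul : (fun z => θ z * u z + angle u z) =ᶠ[𝓝 y] fun _ => σ + τ * η := by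
    filter_upwards [hud.continuousAt.eventually_ne (h.pos y hyΩ).ne'] with z hz
    simp only [hθ]
    rw [div_mul_cancel₀ _ hz]; ring
  have hdd := dd_congr (v := v) hmul
  rw [dd_add (f := fun z => θ z * u z) (hθd.fun_mul hud) had, dd_mul hθd hud, dd_const, hv,
    dd_gradVec_angle hu2, dd_gradVec_self, ← hv, huy] at hdd
  have h1 : τ * (angle u y ^ 3 * hessGrad u y) ≤ θ y * τ * gradSq u y := by
    nlinarith [mul_nonneg (mul_pos hτ0 hτ0).le (neg_nonneg.2 hdθ)]
  have h2 := (h.solves y hyΩ).le_trace hn (h.smooth y hyΩ) (h.pos y hyΩ)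
  rw [trace_shapeMat, huy] at h2
  have h3 := angle_sq_mul_gradSq u y
  refine ⟨y, hyΩ, huy, hνy, ?_⟩
  have h4 := mul_le_mul_of_nonneg_right h2 ha.le
  have h5 : angle u y * (n + τ * lap u y - angle u y ^ 2 * (τ * hessGrad u y)) * gradSq u y =
      n * angle u y * gradSq u y + τ * (angle u y * (lap u y * gradSq u y - hessGrad u y)) +
        τ * (angle u y ^ 3 * hessGrad u y) := by
    linear_combination (-angle u y * τ * hessGrad u y) * h3
  have hnR : (2:ℝ) ≤ n := by exact_mod_cast hn
  have h6 : ((n - 1) * (θ y * τ) - n * (τ * η)) * gradSq u y ≤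
      τ * (angle u y * (lap u y * gradSq u y - hessGrad u y)) := by
    rw [h5] at h4
    have h7 : angle u y = σ + τ * η - θ y * τ := by linarith
    have h8 : n * angle u y * gradSq u y =
      n * σ * gradSq u y + n * (τ * η) * gradSq u y - n * (θ y * τ) * gradSq u y := by
      rw [h7]; ring
    linarith
  have h9 : ((n - 1) * θ y - n * η) * gradSq u y ≤
      angle u y * (lap u y * gradSq u y - hessGrad u y) := by
    refine le_of_mul_le_mul_left ?_ hτ0
    linarith
  refine le_trans (mul_le_mul_of_nonneg_right ?_ ha.le) h9
  have := mul_le_mul_of_nonneg_left hθy (by linarith : (0:ℝ) ≤ n - 1)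
  linarith

/-- The gradient bound: the angle function is at least `σ`. A smaller value would give, on the level
sets `{u = τ}` with `τ → ε`, points where the level set is bent strictly against mean-convexity;
these accumulate at a boundary point. -/
theorem IsSolution.le_angle (h : IsSolution σ ε Ω u) (hn : 2 ≤ n) (hσ0 : 0 < σ) (hσ1 : σ < 1)
    (hε : 0 ≤ ε)
    (hbd : ∀ y ∈ frontier Ω, lap u y * gradSq u y ≤ hessGrad u y) (hx : x ∈ Ω) :
    σ ≤ angle u x := by
  by_contra! hν
  have hux := h.pos x hx
  have hεx := h.lt_height hn hσ0 hσ1 hx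
  set m : ℝ := (σ - angle u x) / u x with hm
  have hm0 : 0 < m := div_pos (by linarith) hux
  set η : ℕ → ℝ := fun k => (1 - σ) / (2 * u x) * (1 / ((k : ℝ) + 1)) with hη
  set τ : ℕ → ℝ := fun k => ε + (u x - ε) / 2 * (1 / ((k : ℝ) + 1)) with hτ
  have hlim := tendsto_one_div_add_atTop_nhds_zero_nat (𝕜 := ℝ)
  have hτlim : Tendsto τ atTop (𝓝 ε) := by
    simpa [hτ] using (hlim.const_mul ((u x - ε) / 2)).const_add ε
  have hηlim : Tendsto η atTop (𝓝 0) := by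
    simpa [hη] using hlim.const_mul ((1 - σ) / (2 * u x))
  -- The choice of `η` keeps the angle function at these points below `(1 + σ) / 2`, hence the
  -- gradient away from zero in the limit.
  have hpt : ∀ k, ∃ y ∈ Ω, u y = τ k ∧ angle u y ≤ (1 + σ) / 2 ∧
      ((n - 1) * m - n * η k) * gradSq u y ≤
        angle u y * (lap u y * gradSq u y - hessGrad u y) := by
    intro k
    have hk0 : 0 < 1 / ((k : ℝ) + 1) := by positivity
    have hk1 : 1 / ((k : ℝ) + 1) ≤ 1 := by
      rw [div_le_one (by positivity)]; linarith [(Nat.cast_nonneg k : (0:ℝ) ≤ k)]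
    have h1 : ε < τ k := by
      have := mul_pos (half_pos (sub_pos.2 hεx)) hk0
      simp only [hτ]; linarith
    have h2 : τ k < u x := by
      have := mul_le_mul_of_nonneg_left hk1 (half_pos (sub_pos.2 hεx)).le
      simp only [hτ]; linarith
    have h3 : 0 < η k := mul_pos (div_pos (by linarith) (by linarith)) hk0
    have h4 : η k ≤ (1 - σ) / (2 * u x) :=
      mul_le_of_le_one_right (div_pos (by linarith) (by linarith)).le hk1
    have h5 : τ k * η k ≤ (1 - σ) / 2 := by
      calc τ k * η k ≤ u x * ((1 - σ) / (2 * u x)) :=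
            mul_le_mul h2.le h4 h3.le hux.le
        _ = _ := by field_simp
    exact h.exists_gap_point hn hσ0 hσ1 hx (hε.trans_lt h1) h1 h2 h3 h5 hν
  choose y hyΩ hyτ hyν hy using hpt
  obtain ⟨z, hz, φ, hφ, hlimz⟩ := h.isCompact.tendsto_subseq fun k => subset_closure (hyΩ k)
  have hu2 := h.smooth_closure z hz
  have huz : u z = ε := by
    have h1 : Tendsto (fun k => u (y (φ k))) atTop (𝓝 (u z)) := hu2.continuousAt.tendsto.comp hlimz
    simp only [hyτ] at h1
    exact tendsto_nhds_unique h1 (hτlim.comp hφ.tendsto_atTop)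
  have hzf : z ∈ frontier Ω := by
    rw [h.isOpen.frontier_eq]
    exact ⟨hz, fun hzΩ => (h.lt_height hn hσ0 hσ1 hzΩ).ne' huz⟩
  have hνz : Tendsto (fun k => angle u (y (φ k))) atTop (𝓝 (angle u z)) :=
    (continuousAt_angle hu2).tendsto.comp hlimz
  have haz : Tendsto (fun k => gradSq u (y (φ k))) atTop (𝓝 (gradSq u z)) :=
    (continuousAt_gradSq hu2).tendsto.comp hlimz
  have hlz : Tendsto (fun k => lap u (y (φ k))) atTop (𝓝 (lap u z)) :=
    (continuousAt_lap hu2).tendsto.comp hlimz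
  have hhz : Tendsto (fun k => hessGrad u (y (φ k))) atTop (𝓝 (hessGrad u z)) :=
    (continuousAt_hessGrad hu2).tendsto.comp hlimz
  have h1 : angle u z ≤ (1 + σ) / 2 := le_of_tendsto' hνz fun k => hyν (φ k)
  have h2 : 0 < gradSq u z := gradSq_pos_of_angle_lt_one (by linarith)
  have h3 : ((n - 1) * m - n * 0) * gradSq u z ≤
      angle u z * (lap u z * gradSq u z - hessGrad u z) :=
    le_of_tendsto_of_tendsto'
      ((((hηlim.comp hφ.tendsto_atTop).const_mul (n:ℝ)).const_sub ((n - 1) * m)).mul haz)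
      (hνz.mul ((hlz.mul haz).sub hhz)) fun k => hy (φ k)
  have h4 := mul_nonneg (angle_pos u z).le (sub_nonneg.2 (hbd z hzf))
  have hnR : (2:ℝ) ≤ n := by exact_mod_cast hn
  have h5 : 0 < (n - 1) * m * gradSq u z := mul_pos (mul_pos (by linarith) hm0) h2
  linarith

end GradientBound

/-! ### The global estimate -/

section Estimate

variable {n : ℕ} {u : EuclideanSpace ℝ (Fin n) → ℝ} {x : EuclideanSpace ℝ (Fin n)}
  {σ ε : ℝ} {Ω : Set (EuclideanSpace ℝ (Fin n))}

/-- The formula for `shapeMat` is continuous up to the boundary, also at height `0`, and so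
computes the continuous extension of the mean curvature. -/
theorem IsSolution.meanCurvatureExt_eq (h : IsSolution σ ε Ω u) (hx : x ∈ closure Ω) :
    meanCurvatureExt Ω u x = (shapeMat u x).trace / n := by
  refine extendFrom_eq hx ?_
  have h1 : Tendsto (fun y => (shapeMat u y).trace / (n : ℝ)) (𝓝[Ω] x)
      (𝓝 ((shapeMat u x).trace / n)) :=
    ((continuousAt_trace (h.smooth_closure x hx)).tendsto.mono_left
      nhdsWithin_le_nhds).div_const _
  refine h1.congr' ?_
  filter_upwards [self_mem_nhdsWithin] with y hy
  exact (meanCurvature_eq (h.smooth_closure y (subset_closure hy)) (h.pos y hy)).symm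

theorem IsSolution.le_trace_closure (h : IsSolution σ ε Ω u) (hn : 2 ≤ n) (hx : x ∈ closure Ω) :
    n * σ ≤ (shapeMat u x).trace :=
  ContinuousWithinAt.closure_le hx continuousWithinAt_const
    (continuousAt_trace (h.smooth_closure x hx)).continuousWithinAt
    fun y hy => (h.solves y hy).le_trace hn (h.smooth y hy) (h.pos y hy)

/-- The maximum principle for `trace ^ (n - 1) / angle ^ n`: the trace of the shape operator is
controlled by its values on the boundary. -/
theorem IsSolution.trace_le (h : IsSolution σ ε Ω u) (hn : 3 ≤ n) (hσ0 : 0 < σ)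
    (hν : ∀ y ∈ Ω, σ ≤ angle u y) {M : ℝ} (hM0 : 0 ≤ M)
    (hM : ∀ y ∈ frontier Ω, (shapeMat u y).trace ≤ M) (hx : x ∈ closure Ω) :
    (shapeMat u x).trace ≤ (20 * n / σ + 10 * n ^ 2 + M) / σ ^ 2 := by
  have hnR : (3:ℝ) ≤ n := by exact_mod_cast hn
  have htr : ∀ y ∈ closure Ω, 0 < (shapeMat u y).trace := fun y hy =>
    (mul_pos (by linarith) hσ0).trans_le (h.le_trace_closure (by lia) hy)
  have hνc : ∀ y ∈ closure Ω, σ ≤ angle u y := fun y hy =>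
    ContinuousWithinAt.closure_le hy continuousWithinAt_const
      (continuousAt_angle (h.smooth_closure y hy)).continuousWithinAt hν
  set Φ : EuclideanSpace ℝ (Fin n) → ℝ := fun y =>
    (n - 1 : ℝ) * Real.log (shapeMat u y).trace + (-n : ℝ) * Real.log (angle u y) with hΦ
  have hΦc : ContinuousOn Φ (closure Ω) := fun y hy =>
    ((continuousAt_const.mul ((continuousAt_trace (h.smooth_closure y hy)).log
      (htr y hy).ne')).add (continuousAt_const.mul
        ((continuousAt_angle (h.smooth_closure y hy)).log
          (angle_pos u y).ne'))).continuousWithinAt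
  obtain ⟨z, hz, hmax⟩ := h.isCompact.exists_isMaxOn ⟨x, hx⟩ hΦc
  have hzle : (shapeMat u z).trace ≤ 20 * n / σ + 10 * n ^ 2 + M := by
    by_cases hzΩ : z ∈ Ω
    · have h1 := trace_le_of_isLocalMax hn hσ0 (hν z hzΩ) (h.smooth z hzΩ) (h.pos z hzΩ)
        (by filter_upwards [h.isOpen.mem_nhds hzΩ] with y hy using h.solves y hy)
        (by filter_upwards [h.isOpen.mem_nhds hzΩ] with y hy using hmax (subset_closure hy))
      linarith
    · have h1 := hM z (by rw [h.isOpen.frontier_eq]; exact ⟨hz, hzΩ⟩)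
      have h2 : 0 ≤ 20 * n / σ + 10 * (n:ℝ) ^ 2 := by positivity
      linarith
  have h1 : Φ x ≤ Φ z := hmax hx
  have h2 : Real.log (angle u x) ≤ 0 := Real.log_nonpos (angle_pos u x).le (angle_le_one u x)
  have h3 : Real.log σ ≤ Real.log (angle u z) := Real.log_le_log hσ0 (hνc z hz)
  -- The comparison costs a factor `σ ^ (-n / (n - 1))`, which is at most `σ ^ (-2)`.
  have h4 : Real.log σ ≤ 0 := h3.trans
    (Real.log_nonpos (angle_pos u z).le (angle_le_one u z))
  have h5 : (n - 1 : ℝ) * Real.log (shapeMat u x).trace ≤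
      (n - 1) * (Real.log (shapeMat u z).trace - 2 * Real.log σ) := by
    simp only [hΦ] at h1
    have e1 : n * Real.log (angle u x) ≤ 0 := mul_nonpos_of_nonneg_of_nonpos (by linarith) h2
    have e2 : n * Real.log σ ≤ n * Real.log (angle u z) :=
      mul_le_mul_of_nonneg_left h3 (by linarith)
    have e3 : 0 ≤ (n - 2 : ℝ) * -Real.log σ := mul_nonneg (by linarith) (by linarith)
    linarith
  have h6 := le_of_mul_le_mul_left h5 (by linarith)
  have h7 : Real.log (shapeMat u z).trace - 2 * Real.log σ =
      Real.log ((shapeMat u z).trace / σ ^ 2) := by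
    rw [Real.log_div (htr z hz).ne' (by positivity), Real.log_pow]
    norm_num
  rw [h7, Real.log_le_log_iff (htr x hx) (div_pos (htr z hz) (by positivity))] at h6
  exact h6.trans (div_le_div_of_nonneg_right hzle (by positivity))

end Estimate
end HypGraph

theorem mainTheorem2 (n : ℕ) (hn : 3 ≤ n) (σ : ℝ) (hσ0 : 0 < σ) (hσ1 : σ < 1) :
    ∃ C : ℝ, 0 < C ∧
      ∀ (Ω : Set (EuclideanSpace ℝ (Fin n))) (ε : ℝ) (u : EuclideanSpace ℝ (Fin n) → ℝ),
        HypGraph.IsSmoothBoundedDomain Ω →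
        HypGraph.IsMeanConvex Ω →
        0 ≤ ε →
        ContDiffOn ℝ ∞ u Ω →
        (∀ x ∈ closure Ω, ContDiffAt ℝ 2 u x) →
        (∀ x ∈ Ω, 0 < u x) →
        (∀ x ∈ frontier Ω, u x = ε) →
        (∀ x ∈ Ω, HypGraph.InGardingCone 2 (HypGraph.principalCurvatures u x)) →
        (∀ x ∈ Ω, Real.sqrt (HypGraph.normSymm n 2 (HypGraph.principalCurvatures u x)) = σ) →
        ∃ M₁ M₂ : ℝ,
          IsGreatest ((fun x => |HypGraph.meanCurvatureExt Ω u x|) '' closure Ω) M₁ ∧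
          IsGreatest ((fun x => |HypGraph.meanCurvatureExt Ω u x|) '' frontier Ω) M₂ ∧
          M₁ ≤ C * (1 + M₂) := by
  have hnR : (3:ℝ) ≤ n := by exact_mod_cast hn
  have hn0 : (0:ℝ) < n := by linarith
  have hn2 : 2 ≤ n := by lia
  refine ⟨(20 / σ + 10 * n + 1) / σ ^ 2, by positivity, ?_⟩
  intro Ω ε u hΩ hmc hε hsm hc2 hpos hfr hcone heq
  have hsol : HypGraph.IsSolution σ ε Ω u :=
    { isOpen := hΩ.isOpen
      isCompact := hΩ.isBounded.isCompact_closure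
      smooth := fun x hx => hsm.contDiffAt (hΩ.isOpen.mem_nhds hx)
      smooth_closure := hc2
      pos := hpos
      boundary := hfr
      solves := fun x hx => HypGraph.solvesAt_of_curvature hn2 hσ0 (hc2 x (subset_closure hx))
        (hpos x hx) (hcone x hx) (heq x hx) }
  have hbd : ∀ y ∈ frontier Ω,
      HypGraph.lap u y * HypGraph.gradSq u y ≤ HypGraph.hessGrad u y := by
    intro y hy
    obtain ⟨ρ, hρ⟩ := hΩ.smooth_boundary y hy
    exact HypGraph.hessian_trace_sub_le_of_mean_convex hΩ.isOpen hy hρ (hmc y hy ρ hρ)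
      (hc2 y (frontier_subset_closure hy)) hfr
      fun z hz => (hsol.lt_height hn2 hσ0 hσ1 hz).le
  have hν : ∀ y ∈ Ω, σ ≤ HypGraph.angle u y := fun y hy =>
    hsol.le_angle hn2 hσ0 hσ1 hε hbd hy
  have htr : ∀ y ∈ closure Ω, 0 < (HypGraph.shapeMat u y).trace := fun y hy =>
    (mul_pos hn0 hσ0).trans_le (hsol.le_trace_closure hn2 hy)
  have habs : ∀ y ∈ closure Ω, |HypGraph.meanCurvatureExt Ω u y| =
      (HypGraph.shapeMat u y).trace / n := fun y hy => by
    rw [hsol.meanCurvatureExt_eq hy, abs_of_pos (div_pos (htr y hy) hn0)]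
  have hcont : ContinuousOn (fun y => |HypGraph.meanCurvatureExt Ω u y|) (closure Ω) := by
    refine ContinuousOn.congr (f := fun y => (HypGraph.shapeMat u y).trace / (n:ℝ)) ?_ habs
    exact fun y hy =>
      ((HypGraph.continuousAt_trace (hc2 y hy)).div_const _).continuousWithinAt
  have hfc : IsCompact (frontier Ω) :=
    hsol.isCompact.of_isClosed_subset isClosed_frontier frontier_subset_closure
  have hfne : (frontier Ω).Nonempty := by
    have : Nonempty (Fin n) := ⟨⟨0, by lia⟩⟩
    refine nonempty_frontier_iff.2 ⟨hΩ.isConnected.nonempty, fun h => ?_⟩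
    exact NormedSpace.unbounded_univ ℝ (EuclideanSpace ℝ (Fin n)) (h ▸ hΩ.isBounded)
  obtain ⟨x, hx, hxmax⟩ :=
    hsol.isCompact.exists_isMaxOn (hΩ.isConnected.nonempty.mono subset_closure) hcont
  obtain ⟨y, hy, hymax⟩ :=
    hfc.exists_isMaxOn hfne (hcont.mono frontier_subset_closure)
  refine ⟨_, _, ⟨mem_image_of_mem _ hx, forall_mem_image.2 hxmax⟩,
    ⟨mem_image_of_mem _ hy, forall_mem_image.2 hymax⟩, ?_⟩
  have hyc := frontier_subset_closure hy
  have hM : ∀ z ∈ frontier Ω, (HypGraph.shapeMat u z).trace ≤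
      (HypGraph.shapeMat u y).trace := by
    intro z hz
    have h1 : |HypGraph.meanCurvatureExt Ω u z| ≤ |HypGraph.meanCurvatureExt Ω u y| := hymax hz
    rw [habs z (frontier_subset_closure hz), habs y hyc] at h1
    exact (div_le_div_iff_of_pos_right hn0).1 h1
  have hfin := hsol.trace_le hn hσ0 hν (htr y hyc).le hM hx
  simp only [habs x hx, habs y hyc]
  have hy0 : 0 < (HypGraph.shapeMat u y).trace / n := div_pos (htr y hyc) hn0
  rw [div_le_iff₀ hn0]
  refine hfin.trans ?_
  rw [div_mul_eq_mul_div, div_mul_eq_mul_div]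
  refine div_le_div_of_nonneg_right ?_ (by positivity)
  have e : (HypGraph.shapeMat u y).trace = (HypGraph.shapeMat u y).trace / n * n := by
    field_simp
  have e2 : 20 * n / σ = 20 / σ * n := by ring
  have h3 : 0 ≤ (20 / σ + 10 * n) * ((HypGraph.shapeMat u y).trace / n) := by positivity
  have h4 := mul_nonneg h3 hn0.le
  generalize (HypGraph.shapeMat u y).trace / n = s at *
  rw [e, e2]
  linarith
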